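/- Theorem 5.1. Let $S^1=\mathbb R/\mathbb Z$. Let $f:\mathbb R\to\mathbb R$ be $C^\infty$ and strongly convex, $f''\ge\sigma>0$, and such that for every $m\ge 0$ there are $h(m)\ge 0$ and $C_m>0$ with $|f^{(m)}(x)|\le C_m(1+|x|)^{h(m)}$ for all $x\in\mathbb R$, where $1\le h(1)<2$. Write $L_2$ for the zero mean functions in $L_2(S^1)$ and $H^m$ ($m\ge0$) for the zero mean functions in the Sobolev space $H^m(S^1)$. Let $Q$ be a symmetric nonnegative operator on $L_2$ which maps $L_2$ continuously to $H^m$ for every $m\ge 0$. For every real $k\ge 1$ there is a constant $C$, depending only on $k$, $f$ and $Q$, such that the following holds. Let $w(t)$, $t\ge 0$, be a Wiener process with correlation operator $Q$ with respect to a filtration $(\mathcal F_t)_{t\ge0}$ on a probability space, in every space $H^m$, $m\ge 0$ (so that $w(0)=0$, almost surely the paths are $C^\infty(S^1)$-valued and continuous in every $H^m$, and for $s\le t$ the increment $w(t)-w(s)$ is independent of $\mathcal F_s$ and has the centred Gaussian law with covariance operator $(t-s)Q$). Let $\nu\in(0,1]$, and let $u$ be a solution of the white-forced generalised Burgers equation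 $$u_t+f'(u)u_x-\nu u_{xx}=\partial w/\partial t,\qquad t\ge0,\ x\in S^1,$$ that is, an $(\mathcal F_t)$-adapted $H^1$-valued process which is almost surely continuous in $H^1$ and satisfies, in the sense of distributions on $S^1$, $$u(t)=u(0)+\int_0^t\big(\nu u_{xx}(s)-f'(u(s))u_x(s)\big)\,ds+w(t),\qquad t\ge 0 .$$ The initial condition $u(0)$ is arbitrary. For $t\ge1$ let $$X_t=\max_{s\in[t,t+1]}\ \max_{x\in S^1}u_x(s,x).$$ Then, for every $t\ge1$, almost surely $u(s,\cdot)$ is differentiable for all $s\in[t,t+1]$ and the maximum is attained; $X_t$ is a random variable; and $$\mathbb E\,X_t^k\le C .$$ In particular the bound is uniform in $t\ge 1$, in $\nu\in(0,1]$ and in the initial condition. The bound also holds for the supremum of $X_t$ over initial conditions, in the following sense: for given $w$, $\nu$ and $t\ge 1$ there is a random variable $Y_t\ge 0$ with $\mathbb E\,Y_t^k\le C$ such that, for every solution $u$ as above, $X_t\le Y_t$ almost surely. -/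

import Mathlib

open MeasureTheory ProbabilityTheory Filter Topology Set
open scoped NNReal InnerProductSpace

namespace WhiteBurgers

/-! Functions on the circle `S¹ = ℝ/ℤ` are 1-periodic functions on `ℝ`; integrals over `S¹` are
integrals over `(0, 1]`. -/

/-- Lebesgue measure on the fundamental domain `(0, 1]` of the circle. -/
noncomputable abbrev circleMeasure : Measure ℝ := volume.restrict (Ioc (0 : ℝ) 1)

/-- The Hilbert space `L₂` of square integrable functions of zero mean on the circle. -/
noncomputable def L2Zero : Submodule ℝ (Lp ℝ 2 circleMeasure) where
  carrier := {v | ∫ x, v x ∂circleMeasure = 0}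
  zero_mem' := by
    have h : ∫ x, (0 : Lp ℝ 2 circleMeasure) x ∂circleMeasure = ∫ _, (0 : ℝ) ∂circleMeasure :=
      integral_congr_ae (Lp.coeFn_zero ℝ 2 circleMeasure)
    simpa using h
  add_mem' := by
    intro a b ha hb
    have hi : ∀ c : Lp ℝ 2 circleMeasure, Integrable c circleMeasure := fun c =>
      (Lp.memLp c).integrable (by norm_num)
    have h : ∫ x, (a + b) x ∂circleMeasure = ∫ x, (a x + b x) ∂circleMeasure :=
      integral_congr_ae (Lp.coeFn_add a b)
    rw [integral_add (hi a) (hi b)] at h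
    simp only [mem_ofPred_eq] at ha hb ⊢
    rw [h, ha, hb, add_zero]
  smul_mem' := by
    intro c a ha
    have h : ∫ x, (c • a) x ∂circleMeasure = ∫ x, c • a x ∂circleMeasure :=
      integral_congr_ae (Lp.coeFn_smul c a)
    rw [integral_smul] at h
    simp only [mem_ofPred_eq] at ha ⊢
    rw [h, ha, smul_zero]

/-- The space `C^∞` of smooth functions of zero mean on the circle. -/
structure MemSmooth (v : ℝ → ℝ) : Prop where
  contDiff : ContDiff ℝ (⊤ : ℕ∞) v
  periodic : Function.Periodic v 1
  zero_mean : ∫ x in (0 : ℝ)..1, v x = 0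

/-- The Sobolev space `H¹` of zero mean functions on the circle. An element is identified with its
continuous representative, which is absolutely continuous with (almost everywhere defined)
derivative in `L₂`. -/
structure MemH1 (v : ℝ → ℝ) : Prop where
  absolutelyContinuous : AbsolutelyContinuousOnInterval v 0 1
  periodic : Function.Periodic v 1
  zero_mean : ∫ x in (0 : ℝ)..1, v x = 0
  memLp_deriv : MemLp (deriv v) 2 circleMeasure

/-- The homogeneous norm `‖v‖_m = (∫_{S¹} (d^m v / dx^m)²)^{1/2}`. It is used for `m = 1` on `H¹`,
and for every `m` on `C^∞`. -/
noncomputable def sobolevNorm (m : ℕ) (v : ℝ → ℝ) : ℝ :=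
  Real.sqrt (∫ x in (0 : ℝ)..1, (iteratedDeriv m v x) ^ 2)

/-- Continuity of the path `t ↦ v t`, `t ≥ 0`, in the norm of `H^m`. -/
def ContinuousInH (m : ℕ) (v : ℝ → ℝ → ℝ) : Prop :=
  ∀ t : ℝ, 0 ≤ t →
    Tendsto (fun s : ℝ => sobolevNorm m (fun x => v s x - v t x)) (𝓝[Ici 0] t) (𝓝 0)

/-- The assumptions on the nonlinearity: `f` is smooth, strongly convex, and each derivative
`f^{(m)}` has polynomial growth of some order `h m`, with `1 ≤ h 1 < 2`. -/
structure IsFlux (f : ℝ → ℝ) : Prop where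
  smooth : ContDiff ℝ (⊤ : ℕ∞) f
  strongly_convex : ∃ σ : ℝ, 0 < σ ∧ ∀ x, σ ≤ iteratedDeriv 2 f x
  growth : ∃ h : ℕ → ℝ, (∀ m, 0 ≤ h m) ∧ 1 ≤ h 1 ∧ h 1 < 2 ∧
    ∀ m, ∃ C : ℝ, 0 < C ∧ ∀ x, |iteratedDeriv m f x| ≤ C * (1 + |x|) ^ h m

/-- The correlation operators: symmetric nonnegative operators on `L₂` that map `L₂` continuously
to `H^m` for every `m` (so that their values have smooth representatives). -/
structure IsCorrelationOperator (Q : L2Zero →L[ℝ] L2Zero) : Prop where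
  symmetric : ∀ ζ χ : L2Zero, ⟪Q ζ, χ⟫_ℝ = ⟪ζ, Q χ⟫_ℝ
  nonneg : ∀ ζ : L2Zero, 0 ≤ ⟪Q ζ, ζ⟫_ℝ
  smoothing : ∀ m : ℕ, ∃ C : ℝ, ∀ ζ : L2Zero, ∃ g : ℝ → ℝ,
    MemSmooth g ∧ g =ᵐ[circleMeasure] (Q ζ : Lp ℝ 2 circleMeasure) ∧ sobolevNorm m g ≤ C * ‖ζ‖

/-- `w` is a Wiener process with respect to the filtration `𝓕`, with correlation operator `Q`, in
every space `H^m`: it starts at `0`, is adapted, its paths are almost surely `C^∞`-valued and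
continuous in every `H^m`, and for `s ≤ t` the increment `w(t) - w(s)` is independent of `𝓕 s` and
has the centred Gaussian law with covariance operator `(t - s) Q`.

The time argument of a process is real; only its values at times `t ≥ 0` matter. Functions of `x`
carry the σ-algebra generated by the point evaluations, which on `H^m`, `m ≥ 1`, is the Borel
σ-algebra. -/
structure IsWiener {Ω : Type*} {mΩ : MeasurableSpace Ω} (P : Measure Ω) (𝓕 : Filtration ℝ≥0 mΩ)
    (Q : L2Zero →L[ℝ] L2Zero) (w : ℝ → Ω → ℝ → ℝ) : Prop where
  adapted : ∀ t : ℝ≥0, Measurable[𝓕 t] (w t)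
  zero : ∀ᵐ ω ∂P, ∀ x, w 0 ω x = 0
  smooth : ∀ᵐ ω ∂P, ∀ t : ℝ, 0 ≤ t → MemSmooth (w t ω)
  continuous : ∀ᵐ ω ∂P, ∀ m : ℕ, ContinuousInH m (fun t => w t ω)
  indep : ∀ s t : ℝ≥0, s ≤ t →
    Indep (MeasurableSpace.comap (fun ω x => w t ω x - w s ω x) MeasurableSpace.pi) (𝓕 s) P
  gaussian : ∀ s t : ℝ≥0, s ≤ t → ∀ ζ : L2Zero,
    HasLaw (fun ω => ∫ x in (0 : ℝ)..1,
        (w t ω x - w s ω x) * (ζ : Lp ℝ 2 circleMeasure) x)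
      (gaussianReal 0 (((t : ℝ) - s) * ⟪Q ζ, ζ⟫_ℝ).toNNReal) P

/-- `u` is a solution of `u_t + f'(u) u_x - ν u_xx = ∂w/∂t`: an adapted `H¹`-valued process which
is almost surely continuous in `H¹` and satisfies
`u(t) = u(0) + ∫₀ᵗ (ν u_xx(s) - f'(u(s)) u_x(s)) ds + w(t)` for all `t ≥ 0`, where `u_xx` is taken
in the sense of distributions on the circle, that is, the identity is tested against smooth
periodic functions `φ`. Nothing is assumed on `u(0)` beyond this. -/
structure IsSolution {Ω : Type*} {mΩ : MeasurableSpace Ω} (P : Measure Ω) (𝓕 : Filtration ℝ≥0 mΩ)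
    (f : ℝ → ℝ) (ν : ℝ) (w u : ℝ → Ω → ℝ → ℝ) : Prop where
  adapted : ∀ t : ℝ≥0, Measurable[𝓕 t] (u t)
  memH1 : ∀ᵐ ω ∂P, ∀ t : ℝ, 0 ≤ t → MemH1 (u t ω)
  continuous : ∀ᵐ ω ∂P, ContinuousInH 1 (fun t => u t ω)
  equation : ∀ᵐ ω ∂P, ∀ t : ℝ, 0 ≤ t →
    ∀ φ : ℝ → ℝ, ContDiff ℝ (⊤ : ℕ∞) φ → Function.Periodic φ 1 →
      ∫ x in (0 : ℝ)..1, u t ω x * φ x =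
        (∫ x in (0 : ℝ)..1, u 0 ω x * φ x)
        + (∫ s in (0 : ℝ)..t,
            (ν * (∫ x in (0 : ℝ)..1, u s ω x * iteratedDeriv 2 φ x)
              - ∫ x in (0 : ℝ)..1, deriv f (u s ω x) * deriv (u s ω) x * φ x))
        + ∫ x in (0 : ℝ)..1, w t ω x * φ x

/-- The set of the values `v_x(s, x)`, `s ∈ [t, t + 1]`, `x ∈ S¹`. -/
def slopes (v : ℝ → ℝ → ℝ) (t : ℝ) : Set ℝ :=
  {y | ∃ s ∈ Icc t (t + 1), ∃ x : ℝ, y = deriv (v s) x}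

/-- `X_t = max_{s ∈ [t, t + 1]} max_{x ∈ S¹} u_x(s, x)`. -/
noncomputable def maxSlope {Ω : Type*} (u : ℝ → Ω → ℝ → ℝ) (t : ℝ) (ω : Ω) : ℝ :=
  sSup (slopes (fun s => u s ω) t)

end WhiteBurgers

/-! The bound is pathwise, with a single Gaussian input. Put `a = t - 1/2` and let `K` bound the
first three `x`-derivatives of `w(s) - w(a)` for `s ∈ [a, a + 3/2]`. Subtracting the noise gives `z
= u_x - (w(s) - w(a))_x`, which is differentiable in time. Let `N` be the maximum of `(s - a) z`;
the factor `s - a` vanishes at time `a`, so the size of `u(a)` never enters. At a maximum point with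
`τ = s - a > 0` the time derivative is nonnegative, `z_x = 0` and `z_xx ≤ 0`, and the differentiated
equation together with `f'' ≥ σ` gives `σ (τ u_x)² ≤ N + τ² K (1 + |f'(u)|)`. Viscosity costs only
`K`, because `ν ≤ 1`. A function of zero mean whose slope is at most `N/τ + K` is itself at most
`N/τ + K` in absolute value, so the growth of `f'` makes the right side at most of order `(1 + K)
N^η` with `η < 2`, while the left side is of order `N²` as soon as `N` dominates `K`. Hence `N ≤ D
(1 + K)^q` with `D`, `q` depending only on `f`, and division by `s - a ≥ 1/2` bounds `u_x` on `[t, t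
+ 1]` (`exists_bound_of_quadratic`, `IsPath.inequality_at_max`, `IsPath.exists_slope_bound`).

Solutions are a priori only in `H¹`, so the maximum principle needs smoothing at positive times.
This is done on Fourier coefficients. Each mode of `u - w` solves a scalar linear equation with
damping `ν (2πk)²`. Duhamel's formula gains two powers of `k`, the derivative in `∂_x f(u)` loses
one, and `f(u)` inherits the decay of `u` (`decayBy_comp`); iteration gives decay of every order
(`IsPath.exists_decayBy`), hence classical derivatives.

It remains to see that `K` has moments of all orders. Every trigonometric mode of an increment of
`w` is Gaussian, with variance proportional to the time step and decaying fast in the frequency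
because `Q` is smoothing. A weighted sum of the `2n`-th powers of all dyadic increments of all modes
therefore has finite expectation (`exists_lintegral_incrementSum_le`), and chaining bounds `K` by a
multiple of the `2n`-th root `R` of that sum (`abs_dser_sub_le`). With `2n ≥ qk`, the variable `Y =
D (1 + c R)^q` has the required moment. It is built from the noise alone, so it serves all solutions
at once. -/

namespace WhiteBurgers

/-! ### Fourier series of periodic functions -/

/-- The character `x ↦ exp (2πikx)` of the circle. -/
noncomputable def expo (k : ℤ) (x : ℝ) : ℂ := Complex.exp (2 * Real.pi * Complex.I * k * x)

/-- The Fourier coefficients of a function on the circle. -/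
noncomputable def fc (v : ℝ → ℝ) (k : ℤ) : ℂ := ∫ x in (0 : ℝ)..1, (v x : ℂ) * expo (-k) x

/-- The weight `1 + |k|`. -/
noncomputable def wt (k : ℤ) : ℝ := 1 + |(k : ℝ)|

/-- The multiplier `2πik` of the derivative. -/
noncomputable def freq (k : ℤ) : ℂ := 2 * Real.pi * Complex.I * k

/-- The sum of the Fourier series with coefficients `c`. -/
noncomputable def ser (c : ℤ → ℂ) (x : ℝ) : ℂ := ∑' k, c k * expo k x

/-- The coefficients `c k` are at most `C (1 + |k|)^(-r)`. -/
def DecayBy (r : ℕ) (C : ℝ) (c : ℤ → ℂ) : Prop := ∀ k, wt k ^ r * ‖c k‖ ≤ C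

/-- The sum `∑ (1 + |k|)^(-2)`. -/
noncomputable def wtSum : ℝ := ∑' k : ℤ, (wt k ^ 2)⁻¹

theorem norm_expo (k : ℤ) (x : ℝ) : ‖expo k x‖ = 1 := by
  have : (2 * Real.pi * Complex.I * k * x : ℂ) = ((2 * Real.pi * k * x : ℝ) : ℂ) * Complex.I := by
    push_cast; ring
  rw [expo, this, Complex.norm_exp_ofReal_mul_I]

theorem expo_add (k l : ℤ) (x : ℝ) : expo (k + l) x = expo k x * expo l x := by
  rw [expo, expo, expo, ← Complex.exp_add]
  congr 1; push_cast; ring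

theorem expo_periodic (k : ℤ) : Function.Periodic (expo k) 1 := by
  intro x
  have : (2 * Real.pi * Complex.I * k * ((x + 1 : ℝ) : ℂ) : ℂ)
      = 2 * Real.pi * Complex.I * k * x + k * (2 * Real.pi * Complex.I) := by
    push_cast; ring
  rw [expo, this, Complex.exp_add, Complex.exp_int_mul_two_pi_mul_I, mul_one, expo]

theorem hasDerivAt_expo (k : ℤ) (x : ℝ) : HasDerivAt (expo k) (freq k * expo k x) x := by
  have h : HasDerivAt (fun y : ℝ => freq k * (y : ℂ)) (freq k) x := by
    simpa using (Complex.ofRealCLM.hasDerivAt (x := x)).const_mul (freq k)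
  have h2 := h.cexp
  rw [mul_comm] at h2
  exact h2

theorem continuous_expo (k : ℤ) : Continuous (expo k) := by
  unfold expo; fun_prop

theorem expo_re (k : ℤ) (x : ℝ) : (expo k x).re = Real.cos (2 * Real.pi * k * x) := by
  have : (2 * Real.pi * Complex.I * k * x : ℂ) = ((2 * Real.pi * k * x : ℝ) : ℂ) * Complex.I := by
    push_cast; ring
  rw [expo, this, Complex.exp_ofReal_mul_I_re]

theorem expo_im (k : ℤ) (x : ℝ) : (expo k x).im = Real.sin (2 * Real.pi * k * x) := by
  have : (2 * Real.pi * Complex.I * k * x : ℂ) = ((2 * Real.pi * k * x : ℝ) : ℂ) * Complex.I := by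
    push_cast; ring
  rw [expo, this, Complex.exp_ofReal_mul_I_im]

theorem norm_freq (k : ℤ) : ‖freq k‖ = 2 * Real.pi * |(k : ℝ)| := by
  simp [freq, abs_of_pos Real.pi_pos]

theorem one_le_wt (k : ℤ) : 1 ≤ wt k := by
  have := abs_nonneg (k : ℝ)
  unfold wt; linarith

theorem wt_pos (k : ℤ) : 0 < wt k := zero_lt_one.trans_le (one_le_wt k)

theorem norm_freq_le (k : ℤ) : ‖freq k‖ ≤ 7 * wt k := by
  rw [norm_freq, wt]
  have := abs_nonneg (k : ℝ)
  nlinarith [Real.pi_lt_d2]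

theorem wt_le_one_add_norm_freq (k : ℤ) : wt k ≤ 1 + ‖freq k‖ := by
  rw [norm_freq, wt]
  have := abs_nonneg (k : ℝ)
  nlinarith [Real.pi_gt_three]

theorem wt_le_add (k j : ℤ) : wt k ≤ wt j + wt (k - j) := by
  have h : |(k : ℝ)| ≤ |(j : ℝ)| + |(k : ℝ) - j| := by
    have := abs_add_le (j : ℝ) ((k : ℝ) - j)
    simpa using this
  simp only [wt]; push_cast; linarith

theorem summable_wt : Summable (fun k : ℤ => (wt k ^ 2)⁻¹) := by
  have h1 : Summable (fun k : ℤ => ((k : ℝ) ^ 2)⁻¹) := by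
    simpa using (Real.summable_one_div_int_pow (p := 2)).mpr (by norm_num)
  -- The indicator of `0` supplies the term `k = 0`, where `(k ^ 2)⁻¹` is `0` by convention but the
  -- weight is `1`.
  refine (h1.add (summable_of_hasFiniteSupport (f := fun k : ℤ => if k = 0 then (1 : ℝ) else 0)
    ((Set.finite_singleton (0 : ℤ)).subset (by
      intro k hk; by_contra h; simp_all)))).of_nonneg_of_le
    (fun k => by have := wt_pos k; positivity) (fun k => ?_)
  by_cases hk : k = 0
  · subst hk; simp [wt]
  · have h0 : 0 < |(k : ℝ)| := abs_pos.mpr (by exact_mod_cast hk)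
    simp only [hk, if_false, add_zero]
    rw [← sq_abs (k : ℝ)]
    apply inv_anti₀ (by positivity)
    unfold wt
    nlinarith

theorem wtSum_nonneg : 0 ≤ wtSum :=
  tsum_nonneg fun k => by have := wt_pos k; positivity

theorem DecayBy.nonneg {r : ℕ} {C : ℝ} {c : ℤ → ℂ} (h : DecayBy r C c) : 0 ≤ C := by
  refine le_trans ?_ (h 0)
  have := wt_pos 0
  positivity

theorem DecayBy.mono {r : ℕ} {C C' : ℝ} {c : ℤ → ℂ} (h : DecayBy r C c) (hC : C ≤ C') :
    DecayBy r C' c := fun k => (h k).trans hC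

theorem DecayBy.norm_le {r : ℕ} {C : ℝ} {c : ℤ → ℂ} (h : DecayBy r C c) (k : ℤ) :
    ‖c k‖ ≤ C * (wt k ^ r)⁻¹ := by
  have := wt_pos k
  rw [← div_eq_mul_inv, le_div_iff₀ (by positivity), mul_comm]
  exact h k

theorem DecayBy.anti {r s : ℕ} {C : ℝ} {c : ℤ → ℂ} (h : DecayBy r C c) (hs : s ≤ r) :
    DecayBy s C c := fun k =>
  (mul_le_mul_of_nonneg_right (pow_le_pow_right₀ (one_le_wt k) hs) (norm_nonneg _)).trans (h k)

theorem DecayBy.freq_mul {r : ℕ} {C : ℝ} {c : ℤ → ℂ} (h : DecayBy (r + 1) C c) :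
    DecayBy r (7 * C) (fun k => freq k * c k) := by
  intro k
  have h1 := norm_freq_le k
  have h2 := wt_pos k
  calc wt k ^ r * ‖freq k * c k‖ = ‖freq k‖ * (wt k ^ r * ‖c k‖) := by rw [norm_mul]; ring
    _ ≤ 7 * wt k * (wt k ^ r * ‖c k‖) := by gcongr
    _ = 7 * (wt k ^ (r + 1) * ‖c k‖) := by ring
    _ ≤ 7 * C := by gcongr; exact h k

theorem DecayBy.add {r : ℕ} {C D : ℝ} {c d : ℤ → ℂ} (h : DecayBy r C c) (h' : DecayBy r D d) :
    DecayBy r (C + D) (fun k => c k + d k) := by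
  intro k
  have h2 := wt_pos k
  calc wt k ^ r * ‖c k + d k‖ ≤ wt k ^ r * (‖c k‖ + ‖d k‖) := by gcongr; exact norm_add_le _ _
    _ ≤ C + D := by rw [mul_add]; exact add_le_add (h k) (h' k)

theorem DecayBy.const_mul {r : ℕ} {C : ℝ} {c : ℤ → ℂ} (h : DecayBy r C c) (a : ℂ) :
    DecayBy r (‖a‖ * C) (fun k => a * c k) := by
  intro k
  calc wt k ^ r * ‖a * c k‖ = ‖a‖ * (wt k ^ r * ‖c k‖) := by rw [norm_mul]; ring
    _ ≤ ‖a‖ * C := by gcongr; exact h k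

theorem DecayBy.summable {r : ℕ} {C : ℝ} {c : ℤ → ℂ} (h : DecayBy (r + 2) C c) :
    Summable c := by
  refine Summable.of_norm_bounded (summable_wt.mul_left C) fun k => ?_
  exact (h.anti (by omega : 2 ≤ r + 2)).norm_le k

/-! ### Sums of Fourier series -/

theorem hasDerivAt_ser {r : ℕ} {C : ℝ} {c : ℤ → ℂ} (h : DecayBy (r + 3) C c) (x : ℝ) :
    HasDerivAt (ser c) (ser (fun k => freq k * c k) x) x := by
  have h1 : DecayBy (r + 2) (7 * C) (fun k => freq k * c k) := h.freq_mul
  have h3 : DecayBy 2 (7 * C) (fun k => freq k * c k) := h1.anti (by omega)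
  have h2 : Summable fun k => c k * expo k 0 := by
    refine Summable.of_norm ?_
    simp only [norm_mul, norm_expo, mul_one]
    exact (DecayBy.summable (r := r + 1) (by simpa using h)).norm
  have := hasDerivAt_tsum (g := fun k y => c k * expo k y)
    (g' := fun k y => freq k * c k * expo k y) (summable_wt.mul_left (7 * C))
    (fun k y => by
      have := (hasDerivAt_expo k y).const_mul (c k)
      rwa [← mul_assoc, mul_comm (c k)] at this)
    (fun k y => by
      rw [norm_mul, norm_expo, mul_one]
      exact h3.norm_le k) (y₀ := 0) h2 x
  exact this

theorem continuousOn_ser {S : Set ℝ} {C : ℝ} {c : ℝ → ℤ → ℂ} (h : ∀ s ∈ S, DecayBy 2 C (c s))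
    (hc : ∀ k, ContinuousOn (fun s => c s k) S) :
    ContinuousOn (fun p : ℝ × ℝ => ser (c p.1) p.2) (S ×ˢ univ) := by
  unfold ser
  refine continuousOn_tsum (u := fun k => C * (wt k ^ 2)⁻¹) (fun k => ?_)
    (summable_wt.mul_left C) (fun k p hp => ?_)
  · refine ContinuousOn.mul ?_ ((continuous_expo k).comp continuous_snd).continuousOn
    exact (hc k).comp continuous_fst.continuousOn (fun p hp => hp.1)
  · rw [norm_mul, norm_expo, mul_one]
    exact (h p.1 hp.1).norm_le k

theorem hasDerivAt_ser_time {a b C C' : ℝ} {c d : ℝ → ℤ → ℂ}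
    (h : ∀ s ∈ Ioo a b, DecayBy 2 C' (c s)) (h' : ∀ s ∈ Ioo a b, DecayBy 2 C (d s))
    (hcd : ∀ s ∈ Ioo a b, ∀ k, HasDerivAt (fun s => c s k) (d s k) s) {s : ℝ} (hs : s ∈ Ioo a b)
    (x : ℝ) : HasDerivAt (fun s => ser (c s) x) (ser (d s) x) s := by
  refine hasDerivAt_tsum_of_isPreconnected (g := fun k s => c s k * expo k x)
    (g' := fun k s => d s k * expo k x) (summable_wt.mul_left C) isOpen_Ioo isPreconnected_Ioo
    (fun k y hy => (hcd y hy k).mul_const _) (fun k y hy => ?_) hs ?_ hs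
  · rw [norm_mul, norm_expo, mul_one]
    exact (h' y hy).norm_le k
  · refine Summable.of_norm ?_
    simp only [norm_mul, norm_expo, mul_one]
    exact (DecayBy.summable (r := 0) (h s hs)).norm

theorem norm_ser_le {C : ℝ} {c : ℤ → ℂ} (h : DecayBy 2 C c) (x : ℝ) :
    ‖ser c x‖ ≤ C * wtSum := by
  unfold ser wtSum
  rw [← tsum_mul_left]
  refine tsum_of_norm_bounded (summable_wt.mul_left C).hasSum fun k => ?_
  rw [norm_mul, norm_expo, mul_one]
  exact h.norm_le k

/-! ### Fourier coefficients -/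

theorem fc_eq_fourierCoeff (F : C(UnitAddCircle, ℂ)) (v : ℝ → ℝ) (hF : ∀ x : ℝ, F x = v x) (k : ℤ) :
    fourierCoeff F k = fc v k := by
  rw [fourierCoeff_eq_intervalIntegral _ _ 0]
  simp only [zero_add, div_one, one_smul, fc]
  refine intervalIntegral.integral_congr fun x _ => ?_
  simp only [fourier_coe_apply, hF, smul_eq_mul, expo]
  rw [mul_comm]
  simp

/-- A continuous periodic function with summable Fourier coefficients is the sum of its Fourier
series. -/
theorem ser_fc {v : ℝ → ℝ} (hc : Continuous v) (hp : Function.Periodic v 1)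
    (hs : Summable (fc v)) (x : ℝ) : ser (fc v) x = v x := by
  have hp' : Function.Periodic (fun x => (v x : ℂ)) 1 := fun x => by simp [hp x]
  let F : C(UnitAddCircle, ℂ) :=
    ⟨hp'.lift, continuous_coinduced_dom.mpr
      (by fun_prop : Continuous fun x => (v x : ℂ))⟩
  have hF : ∀ x : ℝ, F x = v x := fun x => hp'.lift_coe x
  have hco : fourierCoeff F = fc v := funext fun k => fc_eq_fourierCoeff F v hF k
  have := has_pointwise_sum_fourier_series_of_summable (f := F) (by rw [hco]; exact hs) (x : ℝ)
  rw [hF, hco] at this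
  rw [← this.tsum_eq, ser]
  refine tsum_congr fun k => ?_
  simp only [fourier_coe_apply, smul_eq_mul, expo]
  simp

theorem fc_congr {v w : ℝ → ℝ} (h : ∀ᵐ x, x ∈ Ioc (0 : ℝ) 1 → v x = w x) (k : ℤ) :
    fc v k = fc w k := by
  refine intervalIntegral.integral_congr_ae ?_
  filter_upwards [h] with x hx hx'
  rw [uIoc_of_le zero_le_one] at hx'
  rw [hx hx']

theorem intervalIntegrable_mul_expo {v : ℝ → ℝ} (hv : IntervalIntegrable v volume 0 1) (k : ℤ) :
    IntervalIntegrable (fun x => (v x : ℂ) * expo k x) volume 0 1 :=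
  (IntervalIntegrable.mul_continuousOn (f := fun x => (v x : ℂ)) (by
    rw [intervalIntegrable_iff] at hv ⊢
    exact hv.ofReal) (continuous_expo k).continuousOn)

theorem fc_re_im {v : ℝ → ℝ} (hv : IntervalIntegrable v volume 0 1) (k : ℤ) :
    fc v k = ((∫ x in (0 : ℝ)..1, v x * Real.cos (2 * Real.pi * k * x) : ℝ) : ℂ)
      - ((∫ x in (0 : ℝ)..1, v x * Real.sin (2 * Real.pi * k * x) : ℝ) : ℂ) * Complex.I := by
  have h1 := intervalIntegrable_mul_expo hv (-k)
  have hre : (fc v k).re = ∫ x in (0 : ℝ)..1, v x * Real.cos (2 * Real.pi * k * x) := by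
    rw [fc, ← Complex.reCLM_apply, ← ContinuousLinearMap.intervalIntegral_comp_comm _ h1]
    refine intervalIntegral.integral_congr fun x _ => ?_
    simp [expo_re]
  have him : (fc v k).im = -∫ x in (0 : ℝ)..1, v x * Real.sin (2 * Real.pi * k * x) := by
    rw [fc, ← Complex.imCLM_apply, ← ContinuousLinearMap.intervalIntegral_comp_comm _ h1,
      ← intervalIntegral.integral_neg]
    refine intervalIntegral.integral_congr fun x _ => ?_
    simp [expo_im]
  apply Complex.ext <;> simp [hre, him]

theorem fc_sub {v w : ℝ → ℝ} (hv : IntervalIntegrable v volume 0 1)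
    (hw : IntervalIntegrable w volume 0 1) (k : ℤ) :
    fc (fun x => v x - w x) k = fc v k - fc w k := by
  rw [fc, fc, fc, ← intervalIntegral.integral_sub (intervalIntegrable_mul_expo hv _)
    (intervalIntegrable_mul_expo hw _)]
  refine intervalIntegral.integral_congr fun x _ => ?_
  push_cast; ring

theorem norm_fc_le {v : ℝ → ℝ} (k : ℤ) :
    ‖fc v k‖ ≤ ∫ x in (0 : ℝ)..1, |v x| := by
  refine (intervalIntegral.norm_integral_le_integral_norm zero_le_one).trans (le_of_eq ?_)
  refine intervalIntegral.integral_congr fun x _ => ?_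
  simp [norm_expo]

theorem fc_zero_eq {v : ℝ → ℝ} (hv : ∫ x in (0 : ℝ)..1, v x = 0) : fc v 0 = 0 := by
  rw [fc]
  simp only [neg_zero, expo, Int.cast_zero, mul_zero, zero_mul, Complex.exp_zero, mul_one]
  rw [intervalIntegral.integral_ofReal, hv, Complex.ofReal_zero]

theorem norm_fc_le_of_bound {v : ℝ → ℝ} {M : ℝ} (h : ∀ x, |v x| ≤ M) (k : ℤ) : ‖fc v k‖ ≤ M := by
  have := intervalIntegral.norm_integral_le_of_norm_le_const (a := (0 : ℝ)) (b := 1)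
    (f := fun x => (v x : ℂ) * expo (-k) x) (C := M) (fun x _ => by simpa [norm_expo] using h x)
  simpa [fc] using this

/-- Integration by parts for absolutely continuous functions. -/
theorem fc_deriv {v : ℝ → ℝ} (hv : AbsolutelyContinuousOnInterval v 0 1) (h01 : v 1 = v 0)
    (k : ℤ) : fc (deriv v) k = freq k * fc v k := by
  have hc : ∀ c : ℝ, AbsolutelyContinuousOnInterval (fun x => Real.cos (c * x)) 0 1 := fun c =>
    ContDiffOn.absolutelyContinuousOnInterval (by fun_prop)
  have hs : ∀ c : ℝ, AbsolutelyContinuousOnInterval (fun x => Real.sin (c * x)) 0 1 := fun c =>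
    ContDiffOn.absolutelyContinuousOnInterval (by fun_prop)
  have hdc : ∀ c : ℝ, deriv (fun x => Real.cos (c * x)) = fun x => -c * Real.sin (c * x) := by
    intro c; funext x
    have := ((hasDerivAt_id x).const_mul c).cos
    rw [show (fun x => Real.cos (c * x)) = fun x => Real.cos (c * id x) from rfl, this.deriv]
    simp; ring
  have hds : ∀ c : ℝ, deriv (fun x => Real.sin (c * x)) = fun x => c * Real.cos (c * x) := by
    intro c; funext x
    have := ((hasDerivAt_id x).const_mul c).sin
    rw [show (fun x => Real.sin (c * x)) = fun x => Real.sin (c * id x) from rfl, this.deriv]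
    simp; ring
  have hint : IntervalIntegrable v volume 0 1 := hv.continuousOn.intervalIntegrable
  set c : ℝ := 2 * Real.pi * k with hcdef
  have e1 : Real.cos (c * 1) = 1 := by
    rw [mul_one, hcdef, mul_comm]; exact Real.cos_int_mul_two_pi k
  have e2 : Real.sin (c * 1) = 0 := by
    rw [mul_one, hcdef, show 2 * Real.pi * (k : ℝ) = ((2 * k : ℤ) : ℝ) * Real.pi by push_cast; ring]
    exact Real.sin_int_mul_pi _
  have i1 := hv.integral_mul_deriv_eq_deriv_mul (hc c)
  have i2 := hv.integral_mul_deriv_eq_deriv_mul (hs c)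
  rw [hdc] at i1
  rw [hds] at i2
  simp only [e1, e2, mul_zero, Real.cos_zero, Real.sin_zero, h01] at i1 i2
  have j1 : ∫ x in (0 : ℝ)..1, v x * (-c * Real.sin (c * x))
      = -c * ∫ x in (0 : ℝ)..1, v x * Real.sin (c * x) := by
    rw [← intervalIntegral.integral_const_mul]; congr 1; funext x; ring
  have j2 : ∫ x in (0 : ℝ)..1, v x * (c * Real.cos (c * x))
      = c * ∫ x in (0 : ℝ)..1, v x * Real.cos (c * x) := by
    rw [← intervalIntegral.integral_const_mul]; congr 1; funext x; ring
  rw [j1] at i1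
  rw [j2] at i2
  rw [fc_re_im hv.intervalIntegrable_deriv, fc_re_im hint, freq]
  have k1 : ∫ x in (0 : ℝ)..1, deriv v x * Real.cos (c * x)
      = c * ∫ x in (0 : ℝ)..1, v x * Real.sin (c * x) := by linarith
  have k2 : ∫ x in (0 : ℝ)..1, deriv v x * Real.sin (c * x)
      = -c * ∫ x in (0 : ℝ)..1, v x * Real.cos (c * x) := by linarith
  rw [k1, k2]
  apply Complex.ext <;> simp [hcdef]

/-- Bessel's inequality. -/
theorem hasSum_sq_fc {g : ℝ → ℝ} (hg : MemLp g 2 circleMeasure) :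
    HasSum (fun k => ‖fc g k‖ ^ 2) (∫ x in (0 : ℝ)..1, g x ^ 2) := by
  have h := hasSum_sq_fourierCoeffOn (zero_lt_one (α := ℝ)) (f := fun x => (g x : ℂ)) hg.ofReal
  convert h using 1
  · funext k
    rw [fourierCoeffOn_eq_integral]
    simp only [sub_zero, div_one, one_smul, fc]
    congr 2
    refine intervalIntegral.integral_congr fun x _ => ?_
    simp only [fourier_coe_apply, smul_eq_mul, expo]
    rw [mul_comm]
    simp
  · simp

/-- The Fourier coefficients of a product. -/
theorem hasSum_fc_mul {A B : ℝ → ℝ} (hA : Continuous A) (hp : Function.Periodic A 1)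
    (hs : Summable (fc A)) (hB : IntervalIntegrable B volume 0 1) (k : ℤ) :
    HasSum (fun j => fc A j * fc B (k - j)) (fc (fun x => A x * B x) k) := by
  have hI : ∀ j, Integrable (fun x => fc A j * expo j x * ((B x : ℂ) * expo (-k) x))
      circleMeasure := fun j => by
    have h1 := (intervalIntegrable_mul_expo hB (-(k - j))).const_mul (fc A j)
    rw [intervalIntegrable_iff_integrableOn_Ioc_of_le zero_le_one] at h1
    refine h1.congr (ae_of_all _ fun x => ?_)
    simp only
    rw [neg_sub, sub_eq_add_neg, expo_add]
    ring
  have hn : ∀ j x, ‖fc A j * expo j x * ((B x : ℂ) * expo (-k) x)‖ = ‖fc A j‖ * |B x| := by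
    intro j x
    simp [norm_expo]
  have h := hasSum_integral_of_summable_integral_norm hI (by
    simp only [hn, integral_const_mul]
    exact hs.norm.mul_right _)
  have e1 : (fun j => fc A j * fc B (k - j)) = fun j =>
      ∫ x, fc A j * expo j x * ((B x : ℂ) * expo (-k) x) ∂circleMeasure := by
    funext j
    rw [show fc B (k - j) = ∫ x in (0 : ℝ)..1, (B x : ℂ) * expo (-(k - j)) x from rfl,
      ← intervalIntegral.integral_const_mul,
      intervalIntegral.integral_of_le zero_le_one]
    refine integral_congr_ae (ae_of_all _ fun x => ?_)
    simp only
    rw [neg_sub, sub_eq_add_neg, expo_add]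
    ring
  have e2 : fc (fun x => A x * B x) k =
      ∫ x, ∑' j, fc A j * expo j x * ((B x : ℂ) * expo (-k) x) ∂circleMeasure := by
    rw [fc, intervalIntegral.integral_of_le zero_le_one]
    refine integral_congr_ae (ae_of_all _ fun x => ?_)
    simp only
    rw [tsum_mul_right]
    have := ser_fc hA hp hs x
    rw [ser] at this
    rw [this]
    push_cast; ring
  rw [e1, e2]
  exact h

/-! ### Decay of convolutions -/

/-- The borderline product estimate: decay of order one is not summable, so one factor is controlled
in a weighted `ℓ²` norm instead. The weight at `k` splits as `wt j + wt (k - j)`, and each resulting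
product is handled by `2xy ≤ x² + y²`. -/
theorem norm_tsum_mul_le_of_sq {a b : ℤ → ℂ} {A2 β : ℝ}
    (ha : Summable fun j => wt j ^ 2 * ‖a j‖ ^ 2) (ha' : ∑' j, wt j ^ 2 * ‖a j‖ ^ 2 ≤ A2)
    (hb : DecayBy 1 β b) : DecayBy 1 (β * (A2 + wtSum)) (fun k => ∑' j, a j * b (k - j)) := by
  intro k
  have hβ := hb.nonneg
  have hw := wt_pos k
  have hshift : Summable fun j => (wt (k - j) ^ 2)⁻¹ :=
    (Equiv.subLeft k).summable_iff (f := fun j => (wt j ^ 2)⁻¹) |>.mpr summable_wt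
  have hshift' : ∑' j, (wt (k - j) ^ 2)⁻¹ = wtSum :=
    (Equiv.subLeft k).tsum_eq (fun j => (wt j ^ 2)⁻¹)
  have key : ∀ j, wt k * ‖a j * b (k - j)‖ ≤
      β * (wt j ^ 2 * ‖a j‖ ^ 2 + ((wt j ^ 2)⁻¹ + (wt (k - j) ^ 2)⁻¹) / 2) := by
    intro j
    have h1 := hb.norm_le (k - j)
    have hj := wt_pos j
    have hkj := wt_pos (k - j)
    rw [pow_one] at h1
    have h2 := wt_le_add k j
    have h3 : ‖a j‖ ≤ (wt j ^ 2 * ‖a j‖ ^ 2 + (wt j ^ 2)⁻¹) / 2 := by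
      have : wt j * ‖a j‖ * (wt j)⁻¹ = ‖a j‖ := by field_simp
      have e := two_mul_le_add_sq (wt j * ‖a j‖) (wt j)⁻¹
      rw [mul_assoc, this, inv_pow, mul_pow] at e
      linarith
    have h4 : wt j * ‖a j‖ * (wt (k - j))⁻¹
        ≤ (wt j ^ 2 * ‖a j‖ ^ 2 + (wt (k - j) ^ 2)⁻¹) / 2 := by
      have e := two_mul_le_add_sq (wt j * ‖a j‖) (wt (k - j))⁻¹
      rw [inv_pow, mul_pow] at e
      linarith
    calc wt k * ‖a j * b (k - j)‖ = wt k * (‖a j‖ * ‖b (k - j)‖) := by rw [norm_mul]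
      _ ≤ (wt j + wt (k - j)) * (‖a j‖ * (β * (wt (k - j))⁻¹)) := by gcongr
      _ = β * (wt j * ‖a j‖ * (wt (k - j))⁻¹ + ‖a j‖ * (wt (k - j) * (wt (k - j))⁻¹)) := by ring
      _ = β * (wt j * ‖a j‖ * (wt (k - j))⁻¹ + ‖a j‖) := by
        rw [mul_inv_cancel₀ hkj.ne', mul_one]
      _ ≤ _ := mul_le_mul_of_nonneg_left (by linarith) hβ
  have hS : Summable fun j => β * (wt j ^ 2 * ‖a j‖ ^ 2 +
      ((wt j ^ 2)⁻¹ + (wt (k - j) ^ 2)⁻¹) / 2) :=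
    (ha.add ((summable_wt.add hshift).div_const 2)).mul_left β
  have hS2 : ∑' j, β * (wt j ^ 2 * ‖a j‖ ^ 2 + ((wt j ^ 2)⁻¹ + (wt (k - j) ^ 2)⁻¹) / 2)
      ≤ β * (A2 + wtSum) := by
    rw [tsum_mul_left, (ha.tsum_add ((summable_wt.add hshift).div_const 2)), tsum_div_const,
      summable_wt.tsum_add hshift, hshift', ← wtSum]
    gcongr
    linarith
  refine le_trans ?_ hS2
  have := tsum_of_norm_bounded hS.hasSum (f := fun j => (wt k : ℂ) * (a j * b (k - j))) (by
    intro j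
    rw [norm_mul, Complex.norm_real, Real.norm_of_nonneg hw.le]
    exact key j)
  rw [tsum_mul_left, norm_mul, Complex.norm_real, Real.norm_of_nonneg hw.le] at this
  simpa using this

/-- The power of `wt k` falls on one of the two factors up to a constant; the other factor, decaying
at least quadratically, is summed. -/
theorem norm_tsum_mul_le {a b : ℤ → ℂ} {r : ℕ} {α β : ℝ}
    (ha : DecayBy (r + 2) α a) (hb : DecayBy (r + 2) β b) :
    DecayBy (r + 2) (2 ^ (r + 2) * α * β * (2 * wtSum)) (fun k => ∑' j, a j * b (k - j)) := by
  intro k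
  have hα := ha.nonneg
  have hβ := hb.nonneg
  have hw := wt_pos k
  have hshift : Summable fun j => (wt (k - j) ^ 2)⁻¹ :=
    (Equiv.subLeft k).summable_iff (f := fun j => (wt j ^ 2)⁻¹) |>.mpr summable_wt
  have hshift' : ∑' j, (wt (k - j) ^ 2)⁻¹ = wtSum :=
    (Equiv.subLeft k).tsum_eq (fun j => (wt j ^ 2)⁻¹)
  have key : ∀ j, wt k ^ (r + 2) * ‖a j * b (k - j)‖ ≤
      2 ^ (r + 2) * α * β * ((wt j ^ 2)⁻¹ + (wt (k - j) ^ 2)⁻¹) := by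
    intro j
    have hj := wt_pos j
    have hkj := wt_pos (k - j)
    have h2 : wt k ^ (r + 2) ≤ 2 ^ (r + 2) * (wt j ^ (r + 2) + wt (k - j) ^ (r + 2)) := by
      calc wt k ^ (r + 2) ≤ (wt j + wt (k - j)) ^ (r + 2) := by
            gcongr; exact wt_le_add k j
        _ ≤ 2 ^ (r + 2 - 1) * (wt j ^ (r + 2) + wt (k - j) ^ (r + 2)) :=
            add_pow_le hj.le hkj.le _
        _ ≤ _ := by
            gcongr
            · norm_num
            · omega
    have ha2 := (ha.anti (by omega : 2 ≤ r + 2)).norm_le j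
    have hb2 := (hb.anti (by omega : 2 ≤ r + 2)).norm_le (k - j)
    calc wt k ^ (r + 2) * ‖a j * b (k - j)‖ = wt k ^ (r + 2) * (‖a j‖ * ‖b (k - j)‖) := by
          rw [norm_mul]
      _ ≤ 2 ^ (r + 2) * (wt j ^ (r + 2) + wt (k - j) ^ (r + 2)) * (‖a j‖ * ‖b (k - j)‖) := by
          gcongr
      _ = 2 ^ (r + 2) * ((wt j ^ (r + 2) * ‖a j‖) * ‖b (k - j)‖
            + ‖a j‖ * (wt (k - j) ^ (r + 2) * ‖b (k - j)‖)) := by ring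
      _ ≤ 2 ^ (r + 2) * (α * (β * (wt (k - j) ^ 2)⁻¹) + α * (wt j ^ 2)⁻¹ * β) := by
          gcongr
          · exact ha j
          · exact hb (k - j)
      _ = _ := by ring
  have hS : Summable fun j => 2 ^ (r + 2) * α * β * ((wt j ^ 2)⁻¹ + (wt (k - j) ^ 2)⁻¹) :=
    (summable_wt.add hshift).mul_left _
  have hS2 : ∑' j, 2 ^ (r + 2) * α * β * ((wt j ^ 2)⁻¹ + (wt (k - j) ^ 2)⁻¹)
      = 2 ^ (r + 2) * α * β * (2 * wtSum) := by
    rw [tsum_mul_left, summable_wt.tsum_add hshift, hshift', ← wtSum, two_mul]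
  rw [← hS2]
  have := tsum_of_norm_bounded hS.hasSum
    (f := fun j => ((wt k ^ (r + 2) : ℝ) : ℂ) * (a j * b (k - j))) (by
    intro j
    rw [norm_mul, Complex.norm_real, Real.norm_of_nonneg (by positivity)]
    exact key j)
  rw [tsum_mul_left, norm_mul, Complex.norm_real, Real.norm_of_nonneg (by positivity)] at this
  simpa using this

/-! ### The space `H¹` and superposition operators -/

theorem periodic_fract {v : ℝ → ℝ} (hp : Function.Periodic v 1) (x : ℝ) :
    v (Int.fract x) = v x := by
  have := hp.sub_int_mul_eq ⌊x⌋ (x := x)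
  rwa [mul_one] at this

theorem continuous_of_periodic {v : ℝ → ℝ} (hp : Function.Periodic v 1)
    (hc : ContinuousOn v (Icc 0 1)) : Continuous v := by
  have : Fact ((0 : ℝ) < 1) := ⟨zero_lt_one⟩
  have h := AddCircle.liftIco_zero_continuous (p := (1 : ℝ)) (f := v)
    (by simpa using (hp 0).symm) hc
  have h2 : v = fun x : ℝ => AddCircle.liftIco (1 : ℝ) 0 v (x : AddCircle (1 : ℝ)) := by
    funext x
    have hq : (x : AddCircle (1 : ℝ)) = ((Int.fract x : ℝ) : AddCircle (1 : ℝ)) := by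
      rw [eq_comm, ← sub_eq_zero, ← AddCircle.coe_sub, AddCircle.coe_eq_zero_iff]
      refine ⟨-⌊x⌋, ?_⟩
      have := Int.self_sub_floor x
      simp only [zsmul_eq_mul, mul_one, Int.cast_neg]
      linarith
    rw [hq, AddCircle.liftIco_zero_coe_apply ⟨Int.fract_nonneg x, Int.fract_lt_one x⟩,
      periodic_fract hp]
  rw [h2]
  exact h.comp (AddCircle.continuous_mk' 1)

/-- Cauchy's inequality on the circle. -/
theorem integral_abs_sq_le {g : ℝ → ℝ} (hg : MemLp g 2 circleMeasure) :
    (∫ x in (0 : ℝ)..1, |g x|) ^ 2 ≤ ∫ x in (0 : ℝ)..1, g x ^ 2 := by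
  have h1 : IntervalIntegrable (fun x => |g x|) volume 0 1 := by
    rw [intervalIntegrable_iff_integrableOn_Ioc_of_le zero_le_one]
    exact (hg.integrable (by norm_num)).abs
  have h2 : IntervalIntegrable (fun x => g x ^ 2) volume 0 1 := by
    rw [intervalIntegrable_iff_integrableOn_Ioc_of_le zero_le_one]
    exact hg.integrable_sq
  set m := ∫ x in (0 : ℝ)..1, |g x|
  -- The variance of `|g|` about its mean `m` is nonnegative.
  have h3 : 0 ≤ ∫ x in (0 : ℝ)..1, (g x ^ 2 - 2 * m * |g x| + m ^ 2) :=
    intervalIntegral.integral_nonneg zero_le_one fun x _ => by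
      nlinarith [sq_abs (g x), sq_nonneg (|g x| - m)]
  rw [intervalIntegral.integral_add (h2.sub (h1.const_mul _)) intervalIntegrable_const,
    intervalIntegral.integral_sub h2 (h1.const_mul _), intervalIntegral.integral_const_mul,
    intervalIntegral.integral_const] at h3
  simp only [sub_zero, one_smul] at h3
  have : ∫ x in (0 : ℝ)..1, |g x| = m := rfl
  nlinarith

theorem MemH1.continuous {v : ℝ → ℝ} (h : MemH1 v) : Continuous v :=
  continuous_of_periodic h.periodic
    (by simpa using h.absolutelyContinuous.continuousOn)

theorem sobolevNorm_one_sq (v : ℝ → ℝ) :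
    sobolevNorm 1 v ^ 2 = ∫ x in (0 : ℝ)..1, deriv v x ^ 2 := by
  rw [sobolevNorm, Real.sq_sqrt, iteratedDeriv_one]
  exact intervalIntegral.integral_nonneg zero_le_one fun x _ => sq_nonneg _

theorem sobolevNorm_nonneg (m : ℕ) (v : ℝ → ℝ) : 0 ≤ sobolevNorm m v := Real.sqrt_nonneg _

theorem MemH1.integral_abs_deriv_le {v : ℝ → ℝ} (h : MemH1 v) :
    ∫ x in (0 : ℝ)..1, |deriv v x| ≤ sobolevNorm 1 v := by
  refine le_of_sq_le_sq ?_ (sobolevNorm_nonneg 1 v)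
  rw [sobolevNorm_one_sq]
  exact integral_abs_sq_le h.memLp_deriv

theorem MemH1.abs_sub_le {v : ℝ → ℝ} (h : MemH1 v) {x y : ℝ} (hx : 0 ≤ x) (hxy : x ≤ y)
    (hy : y ≤ 1) : |v y - v x| ≤ sobolevNorm 1 v := by
  have hsub : uIcc x y ⊆ uIcc 0 1 := by
    rw [uIcc_of_le hxy, uIcc_of_le zero_le_one]; exact Icc_subset_Icc hx hy
  rw [← (h.absolutelyContinuous.mono hsub).integral_deriv_eq_sub]
  refine (intervalIntegral.abs_integral_le_integral_abs hxy).trans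
    (le_trans ?_ h.integral_abs_deriv_le)
  exact intervalIntegral.integral_mono_interval hx hxy hy (ae_of_all _ fun x => abs_nonneg _)
    h.absolutelyContinuous.intervalIntegrable_deriv.abs

/-- The uniform norm is bounded by the `H¹` norm. -/
theorem MemH1.abs_le {v : ℝ → ℝ} (h : MemH1 v) (x : ℝ) : |v x| ≤ sobolevNorm 1 v := by
  rw [← periodic_fract h.periodic x]
  set z := Int.fract x
  have hz0 : 0 ≤ z := Int.fract_nonneg x
  have hz1 : z ≤ 1 := (Int.fract_lt_one x).le
  have hi : IntervalIntegrable v volume 0 1 := h.continuous.intervalIntegrable 0 1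
  have e : v z = ∫ y in (0 : ℝ)..1, (v z - v y) := by
    rw [intervalIntegral.integral_sub intervalIntegrable_const hi, h.zero_mean]
    simp
  rw [e]
  have := intervalIntegral.norm_integral_le_of_norm_le_const (a := (0 : ℝ)) (b := 1)
    (f := fun y => v z - v y) (C := sobolevNorm 1 v) (fun y hy => by
      rw [uIoc_of_le zero_le_one] at hy
      rw [Real.norm_eq_abs]
      rcases le_total y z with hyz | hyz
      · exact h.abs_sub_le hy.1.le hyz hz1
      · rw [abs_sub_comm]; exact h.abs_sub_le hz0 hyz hy.2)
  simpa using this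

theorem absolutelyContinuous_comp {v F : ℝ → ℝ} {a b : ℝ}
    (hv : AbsolutelyContinuousOnInterval v a b) (hF : ContDiff ℝ 1 F) :
    AbsolutelyContinuousOnInterval (fun x => F (v x)) a b := by
  obtain ⟨C, hC⟩ := hv.exists_bound
  obtain ⟨K, hK⟩ := (hF.contDiffOn (s := Icc (-C) C)).exists_lipschitzOnWith (by decide)
    (convex_Icc _ _) isCompact_Icc
  rw [absolutelyContinuousOnInterval_iff] at hv ⊢
  intro ε hε
  -- Dividing by `K + 1` keeps the final inequality strict and allows `K = 0`.
  obtain ⟨δ, hδ, h⟩ := hv (ε / (K + 1)) (by positivity)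
  refine ⟨δ, hδ, fun E hE hEδ => ?_⟩
  have hmem : ∀ x ∈ uIcc a b, v x ∈ Icc (-C) C := fun x hx => abs_le.mp (hC x hx)
  calc ∑ i ∈ Finset.range E.1, dist (F (v (E.2 i).1)) (F (v (E.2 i).2))
      ≤ ∑ i ∈ Finset.range E.1, K * dist (v (E.2 i).1) (v (E.2 i).2) :=
        Finset.sum_le_sum fun i hi =>
          hK.dist_le_mul _ (hmem _ (hE.1 i hi).1) _ (hmem _ (hE.1 i hi).2)
    _ = K * ∑ i ∈ Finset.range E.1, dist (v (E.2 i).1) (v (E.2 i).2) := by rw [Finset.mul_sum]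
    _ ≤ K * (ε / (K + 1)) := by gcongr; exact (h E hE hEδ).le
    _ < (K + 1) * (ε / (K + 1)) := by gcongr; linarith
    _ = ε := by field

/-- The chain rule for `F ∘ v`, with `v` in `H¹`. -/
theorem MemH1.deriv_comp_ae {v F : ℝ → ℝ} (h : MemH1 v) (hF : ContDiff ℝ 1 F) :
    ∀ᵐ x, x ∈ Ioc (0 : ℝ) 1 → deriv (fun x => F (v x)) x = deriv F (v x) * deriv v x := by
  filter_upwards [h.absolutelyContinuous.ae_differentiableAt] with x hx hx'
  have hd := hx (by rw [uIcc_of_le zero_le_one]; exact Ioc_subset_Icc_self hx')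
  exact ((hF.differentiable (by norm_num) (v x)).hasDerivAt.comp x hd.hasDerivAt).deriv

theorem MemH1.fc_deriv_comp {v F : ℝ → ℝ} (h : MemH1 v) (hF : ContDiff ℝ 1 F) (k : ℤ) :
    fc (fun x => deriv F (v x) * deriv v x) k = freq k * fc (fun x => F (v x)) k := by
  rw [← fc_deriv (absolutelyContinuous_comp h.absolutelyContinuous hF)
    (by have := h.periodic 0; rw [zero_add] at this; simp only [this])]
  exact fc_congr ((h.deriv_comp_ae hF).mono fun x hx hx' => (hx hx').symm) k

theorem MemH1.memLp_comp_mul {v G : ℝ → ℝ} (h : MemH1 v) (hG : Continuous G) :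
    MemLp (fun x => G (v x) * deriv v x) 2 circleMeasure := by
  obtain ⟨C, hC⟩ := (isCompact_Icc (a := -sobolevNorm 1 v) (b := sobolevNorm 1 v)).exists_bound_of_continuousOn
    hG.continuousOn
  refine (h.memLp_deriv.const_mul C).of_le
    ((hG.comp h.continuous).aestronglyMeasurable.mul h.memLp_deriv.1) (ae_of_all _ fun x => ?_)
  have h1 := hC (v x) (_root_.abs_le.mp (h.abs_le x))
  rw [norm_mul, norm_mul]
  exact mul_le_mul_of_nonneg_right (h1.trans (le_abs_self C)) (norm_nonneg _)

theorem MemH1.integral_comp_mul_sq_le {v G : ℝ → ℝ} {C : ℝ} (h : MemH1 v) (hG : Continuous G)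
    (hC : ∀ y, |y| ≤ sobolevNorm 1 v → |G y| ≤ C) :
    ∫ x in (0 : ℝ)..1, (G (v x) * deriv v x) ^ 2 ≤ C ^ 2 * sobolevNorm 1 v ^ 2 := by
  rw [sobolevNorm_one_sq, ← intervalIntegral.integral_const_mul]
  refine intervalIntegral.integral_mono_on zero_le_one ?_ ?_ fun x _ => ?_
  · rw [intervalIntegrable_iff_integrableOn_Ioc_of_le zero_le_one]
    exact (h.memLp_comp_mul hG).integrable_sq
  · refine IntervalIntegrable.const_mul ?_ _
    rw [intervalIntegrable_iff_integrableOn_Ioc_of_le zero_le_one]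
    exact h.memLp_deriv.integrable_sq
  · have h1 := hC (v x) (h.abs_le x)
    rw [mul_pow]
    refine mul_le_mul_of_nonneg_right ?_ (sq_nonneg _)
    rw [← sq_abs (G (v x))]
    exact pow_le_pow_left₀ (abs_nonneg _) h1 2

theorem continuous_deriv_of_contDiff {F : ℝ → ℝ} (hF : ContDiff ℝ 1 F) : Continuous (deriv F) :=
  hF.continuous_deriv le_rfl

theorem exists_bound_abs {G : ℝ → ℝ} (hG : Continuous G) (M : ℝ) :
    ∃ C, 0 ≤ C ∧ ∀ y, |y| ≤ M → |G y| ≤ C := by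
  obtain ⟨C, hC⟩ := (isCompact_Icc (a := -M) (b := M)).exists_bound_of_continuousOn
    hG.continuousOn
  exact ⟨|C|, abs_nonneg C, fun y hy => (hC y (_root_.abs_le.mp hy)).trans (le_abs_self C)⟩

theorem intervalIntegrable_of_memLp {g : ℝ → ℝ} (hg : MemLp g 2 circleMeasure) :
    IntervalIntegrable g volume 0 1 := by
  rw [intervalIntegrable_iff_integrableOn_Ioc_of_le zero_le_one]
  exact hg.integrable (by norm_num)

theorem norm_fc_le_of_sq {g : ℝ → ℝ} {D : ℝ} (hg : MemLp g 2 circleMeasure)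
    (hD : 0 ≤ D) (h : ∫ x in (0 : ℝ)..1, g x ^ 2 ≤ D ^ 2) (k : ℤ) : ‖fc g k‖ ≤ D := by
  refine (norm_fc_le k).trans (le_of_sq_le_sq ?_ hD)
  exact (integral_abs_sq_le hg).trans h

/-- One derivative of `F ∘ v` costs one power of the weight. -/
theorem MemH1.wt_mul_norm_fc_comp_le {v F : ℝ → ℝ} (h : MemH1 v) (hF : ContDiff ℝ 1 F) (k : ℤ) :
    wt k * ‖fc (fun x => F (v x)) k‖ ≤
      ‖fc (fun x => F (v x)) k‖ + ‖fc (fun x => deriv F (v x) * deriv v x) k‖ := by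
  rw [h.fc_deriv_comp hF, norm_mul]
  nlinarith [wt_le_one_add_norm_freq k, norm_nonneg (fc (fun x => F (v x)) k)]

/-- The derivative `F'(v) v_x` is bounded in `L₂` on balls of `H¹`, which is worth one power of the
frequency. This starts the regularity bootstrap. -/
theorem decayBy_one_comp {F : ℝ → ℝ} (hF : ContDiff ℝ 1 F) (M : ℝ) :
    ∃ C, ∀ v, MemH1 v → sobolevNorm 1 v ≤ M → DecayBy 1 C (fc fun x => F (v x)) := by
  obtain ⟨C0, hC0, h0⟩ := exists_bound_abs hF.continuous M
  obtain ⟨C1, hC1, h1⟩ := exists_bound_abs (continuous_deriv_of_contDiff hF) M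
  refine ⟨C0 + C1 * M, fun v hv hM k => ?_⟩
  have hM0 := (sobolevNorm_nonneg 1 v).trans hM
  rw [pow_one]
  refine (hv.wt_mul_norm_fc_comp_le hF k).trans (add_le_add ?_ ?_)
  · exact norm_fc_le_of_bound (fun x => h0 _ ((hv.abs_le x).trans hM)) k
  · refine norm_fc_le_of_sq (hv.memLp_comp_mul (continuous_deriv_of_contDiff hF))
      (by positivity) ?_ k
    refine (hv.integral_comp_mul_sq_le (continuous_deriv_of_contDiff hF)
      fun y hy => h1 y (hy.trans hM)).trans ?_
    rw [mul_pow]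
    have := sobolevNorm_nonneg 1 v
    gcongr

/-- Parseval's identity for `F ∘ v` and for its derivative. It is the `ℓ²` input needed where
pointwise decay of order one is too weak to sum. -/
theorem summable_sq_fc_comp {F : ℝ → ℝ} (hF : ContDiff ℝ 1 F) (M : ℝ) :
    ∃ A, ∀ v, MemH1 v → sobolevNorm 1 v ≤ M →
      (Summable fun k => wt k ^ 2 * ‖fc (fun x => F (v x)) k‖ ^ 2) ∧
      ∑' k, wt k ^ 2 * ‖fc (fun x => F (v x)) k‖ ^ 2 ≤ A := by
  obtain ⟨C0, hC0, h0⟩ := exists_bound_abs hF.continuous M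
  obtain ⟨C1, hC1, h1⟩ := exists_bound_abs (continuous_deriv_of_contDiff hF) M
  refine ⟨2 * (C0 ^ 2 + C1 ^ 2 * M ^ 2), fun v hv hM => ?_⟩
  have hcont : Continuous fun x => F (v x) := hF.continuous.comp hv.continuous
  have hm0 : MemLp (fun x => F (v x)) 2 circleMeasure :=
    MemLp.of_bound hcont.aestronglyMeasurable C0
      (ae_of_all _ fun x => h0 _ ((hv.abs_le x).trans hM))
  have hm1 := hv.memLp_comp_mul (continuous_deriv_of_contDiff hF)
  have s0 := hasSum_sq_fc hm0
  have s1 := hasSum_sq_fc hm1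
  have hs := (s0.add s1).mul_left 2
  have hle : ∀ k, wt k ^ 2 * ‖fc (fun x => F (v x)) k‖ ^ 2 ≤ 2 *
      (‖fc (fun x => F (v x)) k‖ ^ 2 + ‖fc (fun x => deriv F (v x) * deriv v x) k‖ ^ 2) := by
    intro k
    have h2 := hv.wt_mul_norm_fc_comp_le hF k
    have h3 : 0 ≤ wt k * ‖fc (fun x => F (v x)) k‖ := mul_nonneg (wt_pos k).le (norm_nonneg _)
    rw [← mul_pow]
    refine (pow_le_pow_left₀ h3 h2 2).trans ?_
    nlinarith [sq_nonneg (‖fc (fun x => F (v x)) k‖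
      - ‖fc (fun x => deriv F (v x) * deriv v x) k‖)]
  have hsum : Summable fun k => wt k ^ 2 * ‖fc (fun x => F (v x)) k‖ ^ 2 :=
    hs.summable.of_nonneg_of_le (fun k => by positivity) hle
  refine ⟨hsum, (hsum.tsum_le_tsum hle hs.summable).trans ?_⟩
  rw [hs.tsum_eq]
  have i0 : ∫ x in (0 : ℝ)..1, F (v x) ^ 2 ≤ C0 ^ 2 := by
    have := intervalIntegral.integral_mono_on (a := 0) (b := 1) (μ := volume) zero_le_one
      (f := fun x => F (v x) ^ 2) (g := fun _ => C0 ^ 2)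
      ((hcont.pow 2).intervalIntegrable 0 1) (continuous_const.intervalIntegrable 0 1) fun x _ => by
        rw [← sq_abs (F (v x))]
        exact pow_le_pow_left₀ (abs_nonneg _) (h0 _ ((hv.abs_le x).trans hM)) 2
    simpa using this
  have i1 := hv.integral_comp_mul_sq_le (continuous_deriv_of_contDiff hF)
      fun y hy => h1 y (hy.trans hM)
  have := sobolevNorm_nonneg 1 v
  have i2 : C1 ^ 2 * sobolevNorm 1 v ^ 2 ≤ C1 ^ 2 * M ^ 2 := by gcongr
  linarith

/-- Superposition operators preserve the decay of the Fourier coefficients, uniformly on bounded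
subsets of `H¹`. -/
theorem decayBy_comp (r : ℕ) : ∀ F : ℝ → ℝ, ContDiff ℝ (⊤ : ℕ∞) F → ∀ M B : ℝ,
    ∃ C, ∀ v, MemH1 v → sobolevNorm 1 v ≤ M → DecayBy (r + 1) B (fc v) →
      DecayBy (r + 1) C (fc fun x => F (v x)) := by
  induction r with
  | zero =>
    intro F hF M B
    obtain ⟨C, hC⟩ := decayBy_one_comp (hF.of_le (by exact_mod_cast le_top)) M
    exact ⟨C, fun v hv hM _ => hC v hv hM⟩
  | succ r ih =>
    intro F hF M B
    have hF1 : ContDiff ℝ 1 F := hF.of_le (by exact_mod_cast le_top)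
    have hF' : ContDiff ℝ (⊤ : ℕ∞) (deriv F) := (contDiff_infty_iff_deriv.mp hF).2
    have hF'1 : ContDiff ℝ 1 (deriv F) := hF'.of_le (by exact_mod_cast le_top)
    obtain ⟨C0, hC0⟩ := ih F hF M B
    obtain ⟨C1, hC1⟩ := ih (deriv F) hF' M B
    obtain ⟨A, hA⟩ := summable_sq_fc_comp hF'1 M
    -- The derivative of `F ∘ v` has as coefficients the convolution of those of `F'(v)` and of
    -- `v_x`. The induction hypothesis for `F'` covers the first, and `v_x` loses one power against
    -- `v`.
    have hprod : ∃ D, ∀ v, MemH1 v → sobolevNorm 1 v ≤ M → DecayBy (r + 1 + 1) B (fc v) →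
        DecayBy (r + 1) D (fc fun x => deriv F (v x) * deriv v x) := by
      have hfc : ∀ v, MemH1 v → sobolevNorm 1 v ≤ M →
          (fc fun x => deriv F (v x) * deriv v x)
            = fun k => ∑' j, fc (fun x => deriv F (v x)) j * fc (deriv v) (k - j) := by
        intro v hv hM
        funext k
        obtain ⟨hA1, -⟩ := hA v hv hM
        have hs : Summable (fc fun x => deriv F (v x)) := by
          refine Summable.of_norm_bounded (hA1.add summable_wt) fun j => ?_
          have hj := wt_pos j
          have : wt j * ‖fc (fun x => deriv F (v x)) j‖ * (wt j)⁻¹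
            = ‖fc (fun x => deriv F (v x)) j‖ := by field_simp
          have e := two_mul_le_add_sq (wt j * ‖fc (fun x => deriv F (v x)) j‖) (wt j)⁻¹
          rw [mul_assoc, this, inv_pow, mul_pow] at e
          have := norm_nonneg (fc (fun x => deriv F (v x)) j)
          linarith
        exact (hasSum_fc_mul (hF'1.continuous.comp hv.continuous)
          (fun x => congrArg (deriv F) (hv.periodic x)) hs
          hv.absolutelyContinuous.intervalIntegrable_deriv k).tsum_eq.symm
      have hderiv : ∀ v, MemH1 v → DecayBy (r + 1 + 1) B (fc v) →
          DecayBy (r + 1) (7 * B) (fc (deriv v)) := by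
        intro v hv hB
        have e : fc (deriv v) = fun k => freq k * fc v k := funext fun k =>
          fc_deriv hv.absolutelyContinuous (by simpa using hv.periodic 0) k
        rw [e]
        exact hB.freq_mul
      -- In the first step both factors decay only to order one, so the `ℓ²` bound on `F'(v)` is
      -- used; afterwards both have order at least two.
      rcases r with _ | r
      · refine ⟨7 * B * (A + wtSum), fun v hv hM hB => ?_⟩
        rw [hfc v hv hM]
        obtain ⟨hA1, hA2⟩ := hA v hv hM
        exact norm_tsum_mul_le_of_sq hA1 hA2 (hderiv v hv hB)
      · refine ⟨2 ^ (r + 2) * C1 * (7 * B) * (2 * wtSum), fun v hv hM hB => ?_⟩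
        rw [hfc v hv hM]
        exact norm_tsum_mul_le (hC1 v hv hM (hB.anti (by omega))) (hderiv v hv hB)
    obtain ⟨D, hD⟩ := hprod
    refine ⟨C0 + D, fun v hv hM hB k => ?_⟩
    have h1 := hv.wt_mul_norm_fc_comp_le hF1 k
    have hw := wt_pos k
    calc wt k ^ (r + 1 + 1) * ‖fc (fun x => F (v x)) k‖
        = wt k ^ (r + 1) * (wt k * ‖fc (fun x => F (v x)) k‖) := by ring
      _ ≤ wt k ^ (r + 1) * (‖fc (fun x => F (v x)) k‖
          + ‖fc (fun x => deriv F (v x) * deriv v x) k‖) := by gcongr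
      _ = wt k ^ (r + 1) * ‖fc (fun x => F (v x)) k‖
          + wt k ^ (r + 1) * ‖fc (fun x => deriv F (v x) * deriv v x) k‖ := by ring
      _ ≤ C0 + D := add_le_add (hC0 v hv hM (hB.anti (by omega)) k) (hD v hv hM hB k)

/-! ### Paths of solutions -/

/-- A single path `u` of a solution, driven by the path `w`. -/
structure IsPath (f : ℝ → ℝ) (ν : ℝ) (w u : ℝ → ℝ → ℝ) : Prop where
  memH1 : ∀ t : ℝ, 0 ≤ t → MemH1 (u t)
  continuous : ContinuousInH 1 u
  smooth : ∀ t : ℝ, 0 ≤ t → MemSmooth (w t)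
  continuous_force : ∀ m, ContinuousInH m w
  equation : ∀ t : ℝ, 0 ≤ t →
    ∀ φ : ℝ → ℝ, ContDiff ℝ (⊤ : ℕ∞) φ → Function.Periodic φ 1 →
      ∫ x in (0 : ℝ)..1, u t x * φ x =
        (∫ x in (0 : ℝ)..1, u 0 x * φ x)
        + (∫ s in (0 : ℝ)..t,
            (ν * (∫ x in (0 : ℝ)..1, u s x * iteratedDeriv 2 φ x)
              - ∫ x in (0 : ℝ)..1, deriv f (u s x) * deriv (u s) x * φ x))
        + ∫ x in (0 : ℝ)..1, w t x * φ x

theorem MemH1.deriv_sub_ae {v w : ℝ → ℝ} (hv : MemH1 v) (hw : MemH1 w) :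
    ∀ᵐ x, x ∈ Ioc (0 : ℝ) 1 → deriv (fun x => v x - w x) x = deriv v x - deriv w x := by
  filter_upwards [hv.absolutelyContinuous.ae_differentiableAt,
    hw.absolutelyContinuous.ae_differentiableAt] with x h1 h2 hx
  have hx' : x ∈ uIcc (0 : ℝ) 1 := by
    rw [uIcc_of_le zero_le_one]; exact Ioc_subset_Icc_self hx
  exact deriv_fun_sub (h1 hx') (h2 hx')

theorem MemH1.sub {v w : ℝ → ℝ} (hv : MemH1 v) (hw : MemH1 w) : MemH1 (fun x => v x - w x) where
  absolutelyContinuous := hv.absolutelyContinuous.sub hw.absolutelyContinuous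
  periodic := hv.periodic.sub hw.periodic
  zero_mean := by
    rw [intervalIntegral.integral_sub (hv.continuous.intervalIntegrable 0 1)
      (hw.continuous.intervalIntegrable 0 1), hv.zero_mean, hw.zero_mean, sub_zero]
  memLp_deriv := by
    refine (hv.memLp_deriv.sub hw.memLp_deriv).ae_eq ?_
    rw [Filter.EventuallyEq, ae_restrict_iff' measurableSet_Ioc]
    exact (hv.deriv_sub_ae hw).mono fun x hx hx' => (hx hx').symm

/-- A squared substitute for the triangle inequality: pointwise, the difference of the two sides is
`(v' - 2w')²`. -/
theorem MemH1.sobolevNorm_sq_le {v w : ℝ → ℝ} (hv : MemH1 v) (hw : MemH1 w) :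
    sobolevNorm 1 v ^ 2 ≤
      2 * sobolevNorm 1 (fun x => v x - w x) ^ 2 + 2 * sobolevNorm 1 w ^ 2 := by
  have hsq : ∀ {g : ℝ → ℝ}, MemH1 g →
      IntervalIntegrable (fun x => deriv g x ^ 2) volume 0 1 := fun hg => by
    rw [intervalIntegrable_iff_integrableOn_Ioc_of_le zero_le_one]
    exact hg.memLp_deriv.integrable_sq
  rw [sobolevNorm_one_sq, sobolevNorm_one_sq, sobolevNorm_one_sq,
    ← intervalIntegral.integral_const_mul, ← intervalIntegral.integral_const_mul,
    ← intervalIntegral.integral_add ((hsq (hv.sub hw)).const_mul 2) ((hsq hw).const_mul 2)]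
  refine intervalIntegral.integral_mono_ae_restrict zero_le_one (hsq hv)
    (((hsq (hv.sub hw)).const_mul 2).add ((hsq hw).const_mul 2)) ?_
  rw [Filter.EventuallyLE, ae_restrict_iff' measurableSet_Icc]
  have h0 : ∀ᵐ x : ℝ, x ≠ 0 := by simp [ae_iff]
  filter_upwards [hv.deriv_sub_ae hw, h0] with x hx hx0 hx'
  rw [hx ⟨lt_of_le_of_ne hx'.1 (Ne.symm hx0), hx'.2⟩]
  nlinarith [sq_nonneg (deriv v x - 2 * deriv w x)]

theorem MemSmooth.sub {v w : ℝ → ℝ} (hv : MemSmooth v) (hw : MemSmooth w) :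
    MemSmooth (fun x => v x - w x) where
  contDiff := hv.contDiff.sub hw.contDiff
  periodic := hv.periodic.sub hw.periodic
  zero_mean := by
    rw [intervalIntegral.integral_sub (hv.contDiff.continuous.intervalIntegrable 0 1)
      (hw.contDiff.continuous.intervalIntegrable 0 1), hv.zero_mean, hw.zero_mean, sub_zero]

theorem periodic_iteratedDeriv {v : ℝ → ℝ} (hp : Function.Periodic v 1) (m : ℕ) :
    Function.Periodic (iteratedDeriv m v) 1 := by
  intro x
  have e := iteratedDeriv_comp_add_const m v 1
  rw [show (fun y => v (y + 1)) = v from funext hp] at e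
  exact (congrFun e x).symm

theorem fc_iteratedDeriv {v : ℝ → ℝ} (hv : ContDiff ℝ (⊤ : ℕ∞) v) (hp : Function.Periodic v 1)
    (m : ℕ) (k : ℤ) : fc (iteratedDeriv m v) k = freq k ^ m * fc v k := by
  induction m with
  | zero => simp
  | succ m ih =>
    have h1 : ContDiff ℝ 1 (iteratedDeriv m v) := by
      rw [iteratedDeriv_eq_iterate]
      exact (hv.iterate_deriv m).of_le (by exact_mod_cast le_top)
    rw [iteratedDeriv_succ, fc_deriv h1.contDiffOn.absolutelyContinuousOnInterval
      (by simpa using periodic_iteratedDeriv hp m 0), ih, pow_succ]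
    ring

theorem norm_freq_pow_mul_fc_le {v : ℝ → ℝ} (hv : ContDiff ℝ (⊤ : ℕ∞) v)
    (hp : Function.Periodic v 1) (m : ℕ) (k : ℤ) :
    ‖freq k‖ ^ m * ‖fc v k‖ ≤ sobolevNorm m v := by
  rw [← norm_pow, ← norm_mul, ← fc_iteratedDeriv hv hp]
  have hc : Continuous (iteratedDeriv m v) :=
    hv.continuous_iteratedDeriv m (by exact_mod_cast le_top)
  refine norm_fc_le_of_sq ?_ (sobolevNorm_nonneg _ _) ?_ k
  · obtain ⟨C, hC⟩ := isCompact_Icc.exists_bound_of_continuousOn (hc.continuousOn (s := Icc 0 1))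
    refine MemLp.of_bound hc.aestronglyMeasurable C ?_
    rw [ae_restrict_iff' measurableSet_Ioc]
    exact ae_of_all _ fun x hx => hC x (Ioc_subset_Icc_self hx)
  · rw [sobolevNorm, Real.sq_sqrt]
    exact intervalIntegral.integral_nonneg zero_le_one fun x _ => sq_nonneg _

/-- The homogeneous norm sees `|freq k| ^ r` rather than `wt k ^ r`; the norm of order `0` makes up
for the low frequencies. -/
theorem MemSmooth.decayBy {v : ℝ → ℝ} (hv : MemSmooth v) (r : ℕ) :
    DecayBy r (2 ^ r * (sobolevNorm 0 v + sobolevNorm r v)) (fc v) := by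
  intro k
  have h0 := norm_freq_pow_mul_fc_le hv.contDiff hv.periodic 0 k
  have h1 := norm_freq_pow_mul_fc_le hv.contDiff hv.periodic r k
  have hw := wt_pos k
  have h2 : wt k ^ r ≤ 2 ^ r * (1 + ‖freq k‖ ^ r) := by
    calc wt k ^ r ≤ (1 + ‖freq k‖) ^ r := by gcongr; exact wt_le_one_add_norm_freq k
      _ ≤ 2 ^ (r - 1) * (1 ^ r + ‖freq k‖ ^ r) :=
          add_pow_le zero_le_one (norm_nonneg _) _
      _ ≤ _ := by
          rw [one_pow]
          gcongr
          · norm_num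
          · omega
  calc wt k ^ r * ‖fc v k‖ ≤ 2 ^ r * (1 + ‖freq k‖ ^ r) * ‖fc v k‖ := by gcongr
    _ = 2 ^ r * (‖freq k‖ ^ 0 * ‖fc v k‖ + ‖freq k‖ ^ r * ‖fc v k‖) := by ring
    _ ≤ _ := by gcongr

/-- Compactness of `[0, T]`: local bounds are glued along a finite cover, taking the larger constant
at each union. -/
theorem exists_bound_of_locally {T : ℝ} {p : ℝ → ℝ → Prop}
    (hmono : ∀ s C C', p s C → C ≤ C' → p s C')
    (h : ∀ t ∈ Icc 0 T, ∃ C, ∀ᶠ s in 𝓝[Ici 0] t, p s C) : ∃ C, ∀ s ∈ Icc 0 T, p s C := by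
  refine IsCompact.induction_on (p := fun S => ∃ C, ∀ s ∈ S, p s C) isCompact_Icc
    ⟨0, by simp⟩ ?_ ?_ ?_
  · rintro S S' hS ⟨C, hC⟩
    exact ⟨C, fun s hs => hC s (hS hs)⟩
  · rintro S S' ⟨C, hC⟩ ⟨C', hC'⟩
    refine ⟨max C C', ?_⟩
    rintro s (hs | hs)
    · exact hmono _ _ _ (hC s hs) (le_max_left _ _)
    · exact hmono _ _ _ (hC' s hs) (le_max_right _ _)
  · intro t ht
    obtain ⟨C, hC⟩ := h t ht
    exact ⟨_, nhdsWithin_mono t Icc_subset_Ici_self hC, C, fun s hs => hs⟩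

theorem continuousOn_fc_of_memSmooth {w : ℝ → ℝ → ℝ} (hw : ∀ t, 0 ≤ t → MemSmooth (w t))
    (hc : ContinuousInH 0 w) (k : ℤ) : ContinuousOn (fun s => fc (w s) k) (Ici 0) := by
  intro t ht
  rw [ContinuousWithinAt, tendsto_iff_norm_sub_tendsto_zero]
  refine squeeze_zero' (Eventually.of_forall fun s => norm_nonneg _) ?_ (hc t ht)
  filter_upwards [self_mem_nhdsWithin] with s hs
  have hws := hw s hs
  have hwt := hw t ht
  rw [← fc_sub (hws.contDiff.continuous.intervalIntegrable 0 1)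
      (hwt.contDiff.continuous.intervalIntegrable 0 1)]
  simpa using norm_freq_pow_mul_fc_le (hws.sub hwt).contDiff (hws.sub hwt).periodic 0 k

namespace IsPath

variable {f : ℝ → ℝ} {ν : ℝ} {w u : ℝ → ℝ → ℝ}

theorem exists_norm_le (h : IsPath f ν w u) (T : ℝ) :
    ∃ M, ∀ s ∈ Icc 0 T, sobolevNorm 1 (u s) ≤ M := by
  refine exists_bound_of_locally (p := fun s C => sobolevNorm 1 (u s) ≤ C)
    (fun _ _ _ => le_trans) fun t ht => ?_
  refine ⟨2 + 2 * sobolevNorm 1 (u t), ?_⟩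
  have h1 := (h.continuous t ht.1).eventually (gt_mem_nhds zero_lt_one)
  filter_upwards [h1, self_mem_nhdsWithin] with s hs hs0
  have h2 := (h.memH1 s hs0).sobolevNorm_sq_le (h.memH1 t ht.1)
  have h3 := sobolevNorm_nonneg 1 (fun x => u s x - u t x)
  have h4 := sobolevNorm_nonneg 1 (u t)
  refine le_of_sq_le_sq ?_ (by positivity)
  nlinarith

theorem exists_decayBy_force (h : IsPath f ν w u) (T : ℝ) (r : ℕ) :
    ∃ C, ∀ s ∈ Icc 0 T, DecayBy r C (fc (w s)) := by
  refine exists_bound_of_locally (p := fun s C => DecayBy r C (fc (w s)))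
    (fun _ _ _ hC hCC => hC.mono hCC) fun t ht => ?_
  refine ⟨2 ^ r * (sobolevNorm 0 (w t) + sobolevNorm r (w t)) + 2 ^ r * (1 + 1), ?_⟩
  have h1 := (h.continuous_force 0 t ht.1).eventually (gt_mem_nhds zero_lt_one)
  have h2 := (h.continuous_force r t ht.1).eventually (gt_mem_nhds zero_lt_one)
  filter_upwards [h1, h2, self_mem_nhdsWithin] with s hs hs' hs0
  have hws := h.smooth s hs0
  have hwt := h.smooth t ht.1
  have e : fc (w s) = fun k => fc (w t) k + fc (fun x => w s x - w t x) k := by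
    funext k
    rw [fc_sub (hws.contDiff.continuous.intervalIntegrable 0 1)
      (hwt.contDiff.continuous.intervalIntegrable 0 1)]
    ring
  rw [e]
  refine (hwt.decayBy r).add (((hws.sub hwt).decayBy r).mono ?_)
  gcongr

theorem continuousOn_fc_force (h : IsPath f ν w u) (k : ℤ) :
    ContinuousOn (fun s => fc (w s) k) (Ici 0) :=
  continuousOn_fc_of_memSmooth h.smooth (h.continuous_force 0) k

theorem continuousOn_eval (h : IsPath f ν w u) (x : ℝ) :
    ContinuousOn (fun s => u s x) (Ici 0) := by
  intro t ht
  rw [ContinuousWithinAt, tendsto_iff_norm_sub_tendsto_zero]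
  refine squeeze_zero' (Eventually.of_forall fun s => norm_nonneg _) ?_ (h.continuous t ht)
  filter_upwards [self_mem_nhdsWithin] with s hs
  exact ((h.memH1 s hs).sub (h.memH1 t ht)).abs_le x

theorem continuousOn_fc_comp (h : IsPath f ν w u) {F : ℝ → ℝ} (hF : ContDiff ℝ 1 F) (k : ℤ) :
    ContinuousOn (fun s => fc (fun x => F (u s x)) k) (Ici 0) := by
  intro t ht
  obtain ⟨M, hM⟩ := h.exists_norm_le (t + 1)
  obtain ⟨K, hK⟩ := (hF.contDiffOn (s := Icc (-M) M)).exists_lipschitzOnWith (by decide)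
    (convex_Icc _ _) isCompact_Icc
  rw [ContinuousWithinAt, tendsto_iff_norm_sub_tendsto_zero]
  have hlim := (h.continuous t ht).const_mul (K : ℝ)
  rw [mul_zero] at hlim
  refine squeeze_zero' (Eventually.of_forall fun s => norm_nonneg _) ?_ hlim
  have hlt : ∀ᶠ s in 𝓝[Ici 0] t, s < t + 1 :=
    nhdsWithin_le_nhds (gt_mem_nhds (by linarith))
  filter_upwards [self_mem_nhdsWithin, hlt] with s hs hst
  have hus := h.memH1 s hs
  have hut := h.memH1 t ht
  rw [← fc_sub (v := fun x => F (u s x)) (w := fun x => F (u t x))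
      ((hF.continuous.comp hus.continuous).intervalIntegrable 0 1)
      ((hF.continuous.comp hut.continuous).intervalIntegrable 0 1)]
  refine norm_fc_le_of_bound (fun x => ?_) k
  have h1 := hK.dist_le_mul (u s x) (abs_le.mp ((hus.abs_le x).trans (hM s ⟨hs, hst.le⟩)))
    (u t x) (abs_le.mp ((hut.abs_le x).trans (hM t ⟨ht, by linarith⟩)))
  rw [Real.dist_eq, Real.dist_eq] at h1
  refine h1.trans ?_
  gcongr
  exact (hus.sub hut).abs_le x

theorem continuousOn_fc (h : IsPath f ν w u) (k : ℤ) :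
    ContinuousOn (fun s => fc (u s) k) (Ici 0) :=
  h.continuousOn_fc_comp contDiff_id k

theorem iteratedDeriv_two_cos (c : ℝ) :
    iteratedDeriv 2 (fun x => Real.cos (c * x)) = fun x => -c ^ 2 * Real.cos (c * x) := by
  rw [iteratedDeriv_succ, iteratedDeriv_one]
  have h1 : deriv (fun x => Real.cos (c * x)) = fun x => -c * Real.sin (c * x) := by
    funext x
    have := (((hasDerivAt_id x).const_mul c).cos).deriv
    simp only [id] at this
    rw [this]; ring
  rw [h1]
  funext x
  have := ((((hasDerivAt_id x).const_mul c).sin).const_mul (-c)).deriv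
  simp only [id] at this
  rw [this]; ring

theorem iteratedDeriv_two_sin (c : ℝ) :
    iteratedDeriv 2 (fun x => Real.sin (c * x)) = fun x => -c ^ 2 * Real.sin (c * x) := by
  rw [iteratedDeriv_succ, iteratedDeriv_one]
  have h1 : deriv (fun x => Real.sin (c * x)) = fun x => c * Real.cos (c * x) := by
    funext x
    have := (((hasDerivAt_id x).const_mul c).sin).deriv
    simp only [id] at this
    rw [this]; ring
  rw [h1]
  funext x
  have := ((((hasDerivAt_id x).const_mul c).cos).const_mul c).deriv
  simp only [id] at this
  rw [this]; ring

theorem freq_sq (k : ℤ) : freq k ^ 2 = -(((2 * Real.pi * k) ^ 2 : ℝ) : ℂ) := by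
  rw [freq]; push_cast
  rw [mul_pow, mul_pow, Complex.I_sq]; ring

theorem continuousOn_modeField (h : IsPath f ν w u) (hf : ContDiff ℝ 1 f) (k : ℤ) :
    ContinuousOn (fun s => ν * freq k ^ 2 * fc (u s) k - freq k * fc (fun x => f (u s x)) k)
      (Ici 0) :=
  ((h.continuousOn_fc k).const_mul _).sub ((h.continuousOn_fc_comp hf k).const_mul _)

/-- The equation for the Fourier modes. -/
theorem fc_eq (h : IsPath f ν w u) (hf : ContDiff ℝ 1 f) (k : ℤ) {t : ℝ} (ht : 0 ≤ t) :
    fc (u t) k - fc (w t) k = fc (u 0) k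
      + ∫ s in (0 : ℝ)..t, (ν * freq k ^ 2 * fc (u s) k - freq k * fc (fun x => f (u s x)) k) := by
  set c : ℝ := 2 * Real.pi * k with hc
  have hperc : Function.Periodic (fun x => Real.cos (c * x)) 1 := fun x => by
    beta_reduce
    rw [mul_add, mul_one, hc, show 2 * Real.pi * (k : ℝ) * x + 2 * Real.pi * k
      = 2 * Real.pi * k * x + k * (2 * Real.pi) by ring]
    exact Real.cos_add_int_mul_two_pi _ _
  have hpers : Function.Periodic (fun x => Real.sin (c * x)) 1 := fun x => by
    beta_reduce
    rw [mul_add, mul_one, hc, show 2 * Real.pi * (k : ℝ) * x + 2 * Real.pi * k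
      = 2 * Real.pi * k * x + k * (2 * Real.pi) by ring]
    exact Real.sin_add_int_mul_two_pi _ _
  have E1 := h.equation t ht (fun x => Real.cos (c * x)) (by fun_prop) hperc
  have E2 := h.equation t ht (fun x => Real.sin (c * x)) (by fun_prop) hpers
  rw [iteratedDeriv_two_cos] at E1
  rw [iteratedDeriv_two_sin] at E2
  have hu : ∀ s, 0 ≤ s → IntervalIntegrable (u s) volume 0 1 := fun s hs =>
    (h.memH1 s hs).continuous.intervalIntegrable 0 1
  have hw : ∀ s, 0 ≤ s → IntervalIntegrable (w s) volume 0 1 := fun s hs =>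
    (h.smooth s hs).contDiff.continuous.intervalIntegrable 0 1
  have hg : ∀ s, 0 ≤ s →
      IntervalIntegrable (fun x => deriv f (u s x) * deriv (u s) x) volume 0 1 := fun s hs =>
    intervalIntegrable_of_memLp ((h.memH1 s hs).memLp_comp_mul (continuous_deriv_of_contDiff hf))
  have re : ∀ {v : ℝ → ℝ}, IntervalIntegrable v volume 0 1 →
      ∫ x in (0 : ℝ)..1, v x * Real.cos (c * x) = (fc v k).re := fun hv => by
    rw [fc_re_im hv]; simp [hc]
  have im : ∀ {v : ℝ → ℝ}, IntervalIntegrable v volume 0 1 →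
      ∫ x in (0 : ℝ)..1, v x * Real.sin (c * x) = -(fc v k).im := fun hv => by
    rw [fc_re_im hv]; simp [hc]
  have hI : IntervalIntegrable (fun s => ν * freq k ^ 2 * fc (u s) k
      - freq k * fc (fun x => f (u s x)) k) volume 0 t :=
    ((h.continuousOn_modeField hf k).mono (by
      rw [uIcc_of_le ht]; exact Icc_subset_Ici_self)).intervalIntegrable
  have I1 : (∫ s in (0 : ℝ)..t, (ν * (∫ x in (0 : ℝ)..1, u s x * (-c ^ 2 * Real.cos (c * x)))
      - ∫ x in (0 : ℝ)..1, deriv f (u s x) * deriv (u s) x * Real.cos (c * x)))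
      = (∫ s in (0 : ℝ)..t, (ν * freq k ^ 2 * fc (u s) k
        - freq k * fc (fun x => f (u s x)) k)).re := by
    rw [← Complex.reCLM_apply, ← ContinuousLinearMap.intervalIntegral_comp_comm _ hI]
    refine intervalIntegral.integral_congr fun s hs => ?_
    rw [uIcc_of_le ht] at hs
    have e1 : ∫ x in (0 : ℝ)..1, u s x * (-c ^ 2 * Real.cos (c * x))
        = -c ^ 2 * ∫ x in (0 : ℝ)..1, u s x * Real.cos (c * x) := by
      rw [← intervalIntegral.integral_const_mul]; congr 1; funext x; ring
    rw [e1, re (hu s hs.1), re (hg s hs.1), (h.memH1 s hs.1).fc_deriv_comp hf, freq_sq, ← hc]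
    simp only [Complex.reCLM_apply, Complex.sub_re]
    congr 1
    rw [show (ν : ℂ) * -((c ^ 2 : ℝ) : ℂ) = ((-(ν * c ^ 2) : ℝ) : ℂ) by push_cast; ring,
      Complex.re_ofReal_mul]
    ring
  have I2 : (∫ s in (0 : ℝ)..t, (ν * (∫ x in (0 : ℝ)..1, u s x * (-c ^ 2 * Real.sin (c * x)))
      - ∫ x in (0 : ℝ)..1, deriv f (u s x) * deriv (u s) x * Real.sin (c * x)))
      = -(∫ s in (0 : ℝ)..t, (ν * freq k ^ 2 * fc (u s) k
        - freq k * fc (fun x => f (u s x)) k)).im := by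
    rw [← Complex.imCLM_apply, ← ContinuousLinearMap.intervalIntegral_comp_comm _ hI,
      ← intervalIntegral.integral_neg]
    refine intervalIntegral.integral_congr fun s hs => ?_
    rw [uIcc_of_le ht] at hs
    have e1 : ∫ x in (0 : ℝ)..1, u s x * (-c ^ 2 * Real.sin (c * x))
        = -c ^ 2 * ∫ x in (0 : ℝ)..1, u s x * Real.sin (c * x) := by
      rw [← intervalIntegral.integral_const_mul]; congr 1; funext x; ring
    rw [e1, im (hu s hs.1), im (hg s hs.1), (h.memH1 s hs.1).fc_deriv_comp hf, freq_sq, ← hc]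
    simp only [Complex.imCLM_apply, Complex.sub_im]
    rw [show (ν : ℂ) * -((c ^ 2 : ℝ) : ℂ) = ((-(ν * c ^ 2) : ℝ) : ℂ) by push_cast; ring,
      Complex.im_ofReal_mul]
    ring
  rw [I1, re (hu t ht), re (hu 0 le_rfl), re (hw t ht)] at E1
  rw [I2, im (hu t ht), im (hu 0 le_rfl), im (hw t ht)] at E2
  apply Complex.ext
  · simp only [Complex.sub_re, Complex.add_re]
    linarith
  · simp only [Complex.sub_im, Complex.add_im]
    linarith

end IsPath

/-! ### Parabolic regularity of paths -/

/-- The bound on a linear equation `y' = -c y + p` given by Duhamel's formula. -/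
theorem norm_le_of_linear_ode {y p : ℝ → ℂ} {a b c M : ℝ} (hM : 0 ≤ M)
    (hy : ∀ s ∈ Icc a b, HasDerivAt y (-c * y s + p s) s) (hp : ∀ s ∈ Icc a b, ‖p s‖ ≤ M * c) :
    ∀ t ∈ Icc a b, ‖y t‖ ≤ Real.exp (-(c * (t - a))) * ‖y a‖ + M := by
  intro t ht
  have hE : ∀ s : ℝ, HasDerivAt (fun s => Real.exp (c * (s - a))) (c * Real.exp (c * (s - a))) s := by
    intro s
    have := (((hasDerivAt_id s).sub_const a).const_mul c).exp
    simpa [mul_comm] using this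
  have hE' : ∀ s : ℝ, HasDerivAt (fun s => (Real.exp (c * (s - a)) : ℂ))
      ((c * Real.exp (c * (s - a)) : ℝ) : ℂ) s := fun s => (hE s).ofReal_comp
  have hd : ∀ s ∈ Icc a b, HasDerivAt (fun s => (Real.exp (c * (s - a)) : ℂ) * y s)
      ((Real.exp (c * (s - a)) : ℂ) * p s) s := by
    intro s hs
    have := (hE' s).mul (hy s hs)
    refine this.congr_deriv ?_
    push_cast; ring
  -- The integrating factor `exp (c (s - a))` removes the damping. The comparison function `B` is
  -- the integral of the bound `M c exp (c (s - a))`, so no division by `c` is needed and `c = 0` is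
  -- allowed.
  have key := image_norm_le_of_norm_deriv_right_le_deriv_boundary
    (f := fun s => (Real.exp (c * (s - a)) : ℂ) * y s)
    (f' := fun s => (Real.exp (c * (s - a)) : ℂ) * p s) (a := a) (b := b)
    (B := fun s => ‖y a‖ + M * (Real.exp (c * (s - a)) - 1))
    (B' := fun s => M * (c * Real.exp (c * (s - a))))
    (fun s hs => (hd s hs).continuousAt.continuousWithinAt)
    (fun s hs => (hd s (Ico_subset_Icc_self hs)).hasDerivWithinAt) (by simp)
    (fun s => (((hE s).sub_const 1).const_mul M).const_add _)
    (fun s hs => by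
      rw [norm_mul, Complex.norm_real, Real.norm_of_nonneg (Real.exp_pos _).le]
      have := hp s (Ico_subset_Icc_self hs)
      have h2 := Real.exp_pos (c * (s - a))
      nlinarith) ht
  rw [norm_mul, Complex.norm_real, Real.norm_of_nonneg (Real.exp_pos _).le] at key
  have hpos := Real.exp_pos (c * (t - a))
  rw [Real.exp_neg, inv_mul_eq_div]
  rw [← sub_le_iff_le_add, le_div_iff₀ hpos]
  linarith

namespace IsPath

variable {f : ℝ → ℝ} {ν : ℝ} {w u : ℝ → ℝ → ℝ}

/-- Neither `u` nor `w` need be differentiable in time, but their difference is an integral of a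
continuous function of time. -/
theorem hasDerivAt_mode (h : IsPath f ν w u) (hf : ContDiff ℝ 1 f) (k : ℤ) {t : ℝ} (ht : 0 < t) :
    HasDerivAt (fun s => fc (u s) k - fc (w s) k)
      (ν * freq k ^ 2 * fc (u t) k - freq k * fc (fun x => f (u t x)) k) t := by
  have hc := h.continuousOn_modeField hf k
  have h1 := intervalIntegral.integral_hasDerivAt_right (a := 0) (b := t)
    (f := fun s => ν * freq k ^ 2 * fc (u s) k - freq k * fc (fun x => f (u s x)) k)
    (ContinuousOn.intervalIntegrable (hc.mono (by
      rw [uIcc_of_le ht.le]; exact Icc_subset_Ici_self)))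
    (ContinuousOn.stronglyMeasurableAtFilter isOpen_Ioi (hc.mono Ioi_subset_Ici_self) t ht)
    ((hc.mono Ioi_subset_Ici_self).continuousAt (Ioi_mem_nhds ht))
  refine (h1.const_add (fc (u 0) k)).congr_of_eventuallyEq ?_
  filter_upwards [Ioi_mem_nhds ht] with s hs
  exact h.fc_eq hf k (le_of_lt hs)

theorem fc_zero (h : IsPath f ν w u) {t : ℝ} (ht : 0 ≤ t) : fc (u t) 0 = 0 :=
  fc_zero_eq (h.memH1 t ht).zero_mean

theorem norm_fc_le_sobolevNorm (h : IsPath f ν w u) {t : ℝ} (ht : 0 ≤ t) (k : ℤ) :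
    ‖fc (u t) k‖ ≤ sobolevNorm 1 (u t) :=
  norm_fc_le_of_bound (h.memH1 t ht).abs_le k

theorem wt_sq_le (k : ℤ) (hk : k ≠ 0) : wt k ^ 2 ≤ (2 * Real.pi * k) ^ 2 := by
  have h1 : (1 : ℝ) ≤ |(k : ℝ)| := by
    rw [← Int.cast_abs]; exact_mod_cast Int.one_le_abs hk
  rw [← sq_abs (2 * Real.pi * (k : ℝ)), abs_mul, abs_of_pos Real.two_pi_pos]
  refine pow_le_pow_left₀ (wt_pos k).le ?_ 2
  unfold wt
  nlinarith [Real.pi_gt_three]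

/-- Heat smoothing: the exponential dominates one term of its Taylor series. -/
theorem wt_pow_mul_exp_le (n : ℕ) {β : ℝ} (hβ : 0 < β) (k : ℤ) :
    wt k ^ n * Real.exp (-(β * wt k ^ 2)) ≤ n.factorial / β ^ n := by
  have hw := wt_pos k
  have h1 := Real.pow_div_factorial_le_exp (β * wt k ^ 2) (by positivity) n
  rw [Real.exp_neg, ← div_eq_mul_inv, div_le_div_iff₀ (Real.exp_pos _) (by positivity)]
  rw [div_le_iff₀ (by positivity)] at h1
  calc wt k ^ n * β ^ n ≤ (wt k ^ 2) ^ n * β ^ n := by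
        gcongr
        exact le_self_pow₀ (one_le_wt k) (by norm_num)
    _ = (β * wt k ^ 2) ^ n := by rw [mul_pow]; ring
    _ ≤ _ := by linarith

/-- At positive times the Fourier coefficients of a solution decay faster than any power. -/
theorem exists_decayBy (h : IsPath f ν w u) (hf : ContDiff ℝ (⊤ : ℕ∞) f) (hν : 0 < ν) (r : ℕ) :
    ∀ a T : ℝ, 0 < a → ∃ C, ∀ s ∈ Icc a T, DecayBy (r + 1) C (fc (u s)) := by
  have hf1 : ContDiff ℝ 1 f := hf.of_le (by exact_mod_cast le_top)
  induction r with
  | zero =>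
    intro a T ha
    obtain ⟨M, hM⟩ := h.exists_norm_le T
    obtain ⟨C, hC⟩ := decayBy_one_comp (contDiff_id (𝕜 := ℝ) (E := ℝ)) M
    exact ⟨C, fun s hs => hC _ (h.memH1 s (ha.le.trans hs.1)) (hM s ⟨ha.le.trans hs.1, hs.2⟩)⟩
  | succ r ih =>
    intro a T ha
    obtain ⟨M, hM⟩ := h.exists_norm_le T
    obtain ⟨B, hB⟩ := ih (a / 2) T (by linarith)
    obtain ⟨C, hC⟩ := decayBy_comp r f hf M B
    obtain ⟨D, hD⟩ := h.exists_decayBy_force T (r + 2)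
    -- The first term is the data at time `a / 2`, damped over a time at least `a / 2`. The second
    -- is the Duhamel term: the force enters as `c ŵ` and keeps its decay, while the nonlinearity
    -- has order `r + 1`, loses one power to `∂_x` and gains two on division by `c ≥ ν wt²`. The
    -- last `D` passes from `u - w` back to `u`.
    refine ⟨(r + 2).factorial / (ν * (a / 2)) ^ (r + 2) * (M + D) + (D + 7 * C / ν) + D,
      fun t ht k => ?_⟩
    have hw := wt_pos k
    have ht0 : 0 ≤ t := ha.le.trans ht.1
    have htT : t ∈ Icc 0 T := ⟨ht0, ht.2⟩
    have hm : a / 2 ∈ Icc 0 T := ⟨by linarith, by linarith [ht.1, ht.2]⟩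
    have hM0 : 0 ≤ M := (sobolevNorm_nonneg _ _).trans (hM t htT)
    have hD0 : 0 ≤ D := (hD t htT).nonneg
    have hC0 : 0 ≤ C := (hC (u t) (h.memH1 t ht0) (hM t htT)
      (hB t ⟨by linarith [ht.1], ht.2⟩)).nonneg
    rcases eq_or_ne k 0 with rfl | hk
    · rw [h.fc_zero ht0, norm_zero, mul_zero]
      positivity
    set c : ℝ := ν * (2 * Real.pi * k) ^ 2 with hc
    have hcw : ν * wt k ^ 2 ≤ c := mul_le_mul_of_nonneg_left (wt_sq_le k hk) hν.le
    have hνf : (ν : ℂ) * freq k ^ 2 = -(c : ℂ) := by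
      rw [freq_sq, hc]; push_cast; ring
    have hc0 : 0 ≤ c := by positivity
    have key := norm_le_of_linear_ode (y := fun s => fc (u s) k - fc (w s) k)
      (p := fun s => -c * fc (w s) k - freq k * fc (fun x => f (u s x)) k) (a := a / 2) (b := T)
      (c := c) (M := (D + 7 * C / ν) * (wt k ^ (r + 2))⁻¹) (by positivity)
      (fun s hs => by
        refine (h.hasDerivAt_mode hf1 k (by linarith [hs.1])).congr_deriv ?_
        rw [hνf]; ring)
      (fun s hs => by
        have hs0 : 0 ≤ s := by linarith [hs.1]
        have e1 := (hD s ⟨hs0, hs.2⟩).norm_le k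
        have e2 := ((hC (u s) (h.memH1 s hs0) (hM s ⟨hs0, hs.2⟩) (hB s hs))).norm_le k
        calc ‖-(c : ℂ) * fc (w s) k - freq k * fc (fun x => f (u s x)) k‖
            ≤ c * ‖fc (w s) k‖ + ‖freq k‖ * ‖fc (fun x => f (u s x)) k‖ := by
              refine (norm_sub_le _ _).trans (le_of_eq ?_)
              rw [norm_mul, norm_mul, norm_neg, Complex.norm_real, Real.norm_of_nonneg hc0]
          _ ≤ c * (D * (wt k ^ (r + 2))⁻¹) + 7 * wt k * (C * (wt k ^ (r + 1))⁻¹) := by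
              gcongr
              exact norm_freq_le k
          _ = D * (wt k ^ (r + 2))⁻¹ * c + 7 * C / ν * (wt k ^ (r + 2))⁻¹ * (ν * wt k ^ 2) := by
              field_simp
              ring
          _ ≤ D * (wt k ^ (r + 2))⁻¹ * c + 7 * C / ν * (wt k ^ (r + 2))⁻¹ * c := by gcongr
          _ = _ := by ring) t ⟨by linarith [ht.1], ht.2⟩
    have e3 := (hD t htT) k
    have e4 : ‖fc (u (a / 2)) k - fc (w (a / 2)) k‖ ≤ M + D := by
      refine (norm_sub_le _ _).trans (add_le_add ?_ ?_)
      · exact (h.norm_fc_le_sobolevNorm hm.1 k).trans (hM _ hm)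
      · simpa using ((hD _ hm).anti (Nat.zero_le _)) k
    have e5 : wt k ^ (r + 2) * Real.exp (-(c * (t - a / 2))) ≤
        (r + 2).factorial / (ν * (a / 2)) ^ (r + 2) := by
      refine le_trans ?_ (wt_pow_mul_exp_le (r + 2) (by positivity) k)
      have e7 : ν * (a / 2) * wt k ^ 2 ≤ c * (t - a / 2) := by
        calc ν * (a / 2) * wt k ^ 2 = ν * wt k ^ 2 * (a / 2) := by ring
          _ ≤ c * (t - a / 2) := by gcongr; linarith [ht.1]
      exact mul_le_mul_of_nonneg_left (Real.exp_le_exp.mpr (neg_le_neg e7)) (by positivity)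
    have e6 : ‖fc (u t) k‖ ≤ ‖fc (u t) k - fc (w t) k‖ + ‖fc (w t) k‖ := by
      simpa using norm_add_le (fc (u t) k - fc (w t) k) (fc (w t) k)
    calc wt k ^ (r + 1 + 1) * ‖fc (u t) k‖
        ≤ wt k ^ (r + 2) * ((Real.exp (-(c * (t - a / 2))) * (M + D)
          + (D + 7 * C / ν) * (wt k ^ (r + 2))⁻¹) + ‖fc (w t) k‖) := by
          refine mul_le_mul_of_nonneg_left (e6.trans (add_le_add_left (key.trans ?_) _))
            (by positivity)
          gcongr
      _ = wt k ^ (r + 2) * Real.exp (-(c * (t - a / 2))) * (M + D)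
          + (D + 7 * C / ν) * (wt k ^ (r + 2) * (wt k ^ (r + 2))⁻¹)
          + wt k ^ (r + 2) * ‖fc (w t) k‖ := by ring
      _ = wt k ^ (r + 2) * Real.exp (-(c * (t - a / 2))) * (M + D)
          + (D + 7 * C / ν) + wt k ^ (r + 2) * ‖fc (w t) k‖ := by
          rw [mul_inv_cancel₀ (by positivity), mul_one]
      _ ≤ _ := by gcongr

theorem exists_decayBy_comp (h : IsPath f ν w u) (hf : ContDiff ℝ (⊤ : ℕ∞) f) (hν : 0 < ν)
    (r : ℕ) (a T : ℝ) (ha : 0 < a) :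
    ∃ C, ∀ s ∈ Icc a T, DecayBy (r + 1) C (fc fun x => f (u s x)) := by
  obtain ⟨M, hM⟩ := h.exists_norm_le T
  obtain ⟨B, hB⟩ := h.exists_decayBy hf hν r a T ha
  obtain ⟨C, hC⟩ := decayBy_comp r f hf M B
  exact ⟨C, fun s hs => hC _ (h.memH1 s (ha.le.trans hs.1)) (hM s ⟨ha.le.trans hs.1, hs.2⟩)
    (hB s hs)⟩

end IsPath

/-! ### Classical derivatives -/

/-- The `n`-th derivative of the function with Fourier coefficients `c`. -/
noncomputable def dser (n : ℕ) (c : ℤ → ℂ) (x : ℝ) : ℝ := (ser (fun k => freq k ^ n * c k) x).re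

theorem DecayBy.freq_pow_mul {r n : ℕ} {C : ℝ} {c : ℤ → ℂ} (h : DecayBy (r + n) C c) :
    DecayBy r (7 ^ n * C) (fun k => freq k ^ n * c k) := by
  induction n generalizing C c with
  | zero => simpa using h
  | succ n ih =>
    have h1 := (h.freq_mul (r := r + n))
    have h2 := ih h1
    convert h2 using 1
    · ring
    · funext k; ring

theorem hasDerivAt_dser {n : ℕ} {C : ℝ} {c : ℤ → ℂ} (h : DecayBy (3 + n) C c) (x : ℝ) :
    HasDerivAt (dser n c) (dser (n + 1) c x) x := by
  have h1 := hasDerivAt_ser (r := 0) (DecayBy.freq_pow_mul (r := 3) h) x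
  have h2 := (Complex.reCLM.hasFDerivAt.comp_hasDerivAt x h1)
  have h3 : HasDerivAt (dser n c) (ser (fun k => freq k * (freq k ^ n * c k)) x).re x := h2
  refine h3.congr_deriv ?_
  simp only [dser, pow_succ', mul_assoc]

theorem dser_zero_fc {v : ℝ → ℝ} {C : ℝ} (hc : Continuous v) (hp : Function.Periodic v 1)
    (h : DecayBy 2 C (fc v)) : dser 0 (fc v) = v := by
  funext x
  simp only [dser, pow_zero, one_mul]
  rw [show (fun k => fc v k) = fc v from rfl, ser_fc hc hp (DecayBy.summable (r := 0) h) x,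
    Complex.ofReal_re]

theorem dser_periodic (n : ℕ) (c : ℤ → ℂ) : Function.Periodic (dser n c) 1 := by
  intro x
  simp only [dser, ser, expo_periodic _ x]

theorem dser_sub {n : ℕ} {C D : ℝ} {c d : ℤ → ℂ} (hc : DecayBy (2 + n) C c)
    (hd : DecayBy (2 + n) D d) (x : ℝ) :
    dser n (fun k => c k - d k) x = dser n c x - dser n d x := by
  have hs : ∀ {C : ℝ} {c : ℤ → ℂ}, DecayBy (2 + n) C c →
      Summable fun k => freq k ^ n * c k * expo k x := fun h => by
    refine Summable.of_norm ?_
    simp only [norm_mul _ (expo _ x), norm_expo, mul_one]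
    exact (DecayBy.summable (r := 0) (DecayBy.freq_pow_mul (r := 2) h)).norm
  simp only [dser, ser]
  rw [← Complex.sub_re, ← (hs hc).tsum_sub (hs hd)]
  congr 2
  funext k; ring

theorem continuousOn_dser {n : ℕ} {S : Set ℝ} {C : ℝ} {c : ℝ → ℤ → ℂ}
    (h : ∀ s ∈ S, DecayBy (2 + n) C (c s)) (hc : ∀ k, ContinuousOn (fun s => c s k) S) :
    ContinuousOn (fun p : ℝ × ℝ => dser n (c p.1) p.2) (S ×ˢ univ) :=
  Complex.continuous_re.comp_continuousOn (continuousOn_ser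
    (fun s hs => DecayBy.freq_pow_mul (r := 2) (h s hs)) fun k => (hc k).const_mul _)

/-! ### The classical equation at positive times -/

namespace IsPath

variable {f : ℝ → ℝ} {ν : ℝ} {w u : ℝ → ℝ → ℝ}

theorem exists_decayBy_at (h : IsPath f ν w u) (hf : ContDiff ℝ (⊤ : ℕ∞) f) (hν : 0 < ν) (r : ℕ)
    {t : ℝ} (ht : 0 < t) : ∃ C, DecayBy r C (fc (u t)) := by
  obtain ⟨C, hC⟩ := h.exists_decayBy hf hν r t t ht
  exact ⟨C, (hC t ⟨le_rfl, le_rfl⟩).anti (Nat.le_succ r)⟩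

theorem dser_zero (h : IsPath f ν w u) (hf : ContDiff ℝ (⊤ : ℕ∞) f) (hν : 0 < ν)
    {t : ℝ} (ht : 0 < t) : dser 0 (fc (u t)) = u t := by
  obtain ⟨C, hC⟩ := h.exists_decayBy_at hf hν 2 ht
  exact dser_zero_fc (h.memH1 t ht.le).continuous (h.memH1 t ht.le).periodic hC

theorem hasDerivAt_dser (h : IsPath f ν w u) (hf : ContDiff ℝ (⊤ : ℕ∞) f) (hν : 0 < ν) (n : ℕ)
    {t : ℝ} (ht : 0 < t) (x : ℝ) :
    HasDerivAt (dser n (fc (u t))) (dser (n + 1) (fc (u t)) x) x := by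
  obtain ⟨C, hC⟩ := h.exists_decayBy_at hf hν (3 + n) ht
  exact WhiteBurgers.hasDerivAt_dser hC x

theorem hasDerivAt_space (h : IsPath f ν w u) (hf : ContDiff ℝ (⊤ : ℕ∞) f) (hν : 0 < ν)
    {t : ℝ} (ht : 0 < t) (x : ℝ) : HasDerivAt (u t) (dser 1 (fc (u t)) x) x := by
  have := h.hasDerivAt_dser hf hν 0 ht x
  rwa [h.dser_zero hf hν ht] at this

theorem hasDerivAt_dser_force (h : IsPath f ν w u) (n : ℕ) {t : ℝ} (ht : 0 ≤ t) (x : ℝ) :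
    HasDerivAt (dser n (fc (w t))) (dser (n + 1) (fc (w t)) x) x :=
  WhiteBurgers.hasDerivAt_dser ((h.smooth t ht).decayBy (3 + n)) x

theorem dser_two_comp (h : IsPath f ν w u) (hf : ContDiff ℝ (⊤ : ℕ∞) f) (hν : 0 < ν)
    {t : ℝ} (ht : 0 < t) (x : ℝ) : dser 2 (fc fun x => f (u t x)) x =
      iteratedDeriv 2 f (u t x) * dser 1 (fc (u t)) x ^ 2
        + deriv f (u t x) * dser 2 (fc (u t)) x := by
  obtain ⟨C, hC⟩ := h.exists_decayBy_comp hf hν 3 t t ht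
  have hC := hC t ⟨le_rfl, le_rfl⟩
  have hd : Differentiable ℝ f := hf.differentiable (by simp)
  have hd' : Differentiable ℝ (deriv f) :=
    (contDiff_infty_iff_deriv.mp hf).2.differentiable (by simp)
  have h0 : dser 0 (fc fun x => f (u t x)) = fun x => f (u t x) :=
    dser_zero_fc (hf.continuous.comp (h.memH1 t ht.le).continuous)
      (fun x => congrArg f ((h.memH1 t ht.le).periodic x)) (hC.anti (by norm_num))
  have h1 : dser 1 (fc fun x => f (u t x)) = fun x => deriv f (u t x) * dser 1 (fc (u t)) x := by
    funext y
    have e := WhiteBurgers.hasDerivAt_dser (n := 0) (hC.anti (by norm_num)) y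
    rw [h0] at e
    exact e.unique ((hd (u t y)).hasDerivAt.comp y (h.hasDerivAt_space hf hν ht y))
  have e := WhiteBurgers.hasDerivAt_dser (n := 1) (hC.anti (by norm_num)) x
  rw [h1] at e
  have e2 := ((hd' (u t x)).hasDerivAt.comp x (h.hasDerivAt_space hf hν ht x)).mul
    (h.hasDerivAt_dser hf hν 1 ht x)
  rw [e.unique e2, iteratedDeriv_succ, iteratedDeriv_one]
  simp only [Function.comp]
  ring

/-- The equation differentiated once in `x`, read for `u - w`. Termwise differentiation in time is
justified by decay bounds that are uniform on a neighbourhood of `t`. -/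
theorem hasDerivAt_time (h : IsPath f ν w u) (hf : ContDiff ℝ (⊤ : ℕ∞) f) (hν : 0 < ν)
    {t : ℝ} (ht : 0 < t) (x : ℝ) :
    HasDerivAt (fun s => dser 1 (fun k => fc (u s) k - fc (w s) k) x)
      (ν * dser 3 (fc (u t)) x - (iteratedDeriv 2 f (u t x) * dser 1 (fc (u t)) x ^ 2
        + deriv f (u t x) * dser 2 (fc (u t)) x)) t := by
  obtain ⟨C, hC⟩ := h.exists_decayBy hf hν 5 (t / 2) (t + 1) (by linarith)
  obtain ⟨D, hD⟩ := h.exists_decayBy_comp hf hν 5 (t / 2) (t + 1) (by linarith)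
  obtain ⟨B, hB⟩ := h.exists_decayBy_force (t + 1) 6
  have hc : ∀ s ∈ Ioo (t / 2) (t + 1), DecayBy 6 (C + ‖(-1 : ℂ)‖ * B)
      (fun k => fc (u s) k - fc (w s) k) := fun s hs => by
    have e := (hC s (Ioo_subset_Icc_self hs)).add
      ((hB s ⟨by linarith [hs.1], hs.2.le⟩).const_mul (-1))
    simpa [sub_eq_add_neg] using e
  have hd1 : ∀ s ∈ Ioo (t / 2) (t + 1), DecayBy 3 (‖(ν : ℂ)‖ * (7 ^ 2 * C))
      (fun k => ν * (freq k ^ 2 * fc (u s) k)) := fun s hs =>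
    (DecayBy.freq_pow_mul (r := 3) ((hC s (Ioo_subset_Icc_self hs)).anti (by norm_num))).const_mul _
  have hd2 : ∀ s ∈ Ioo (t / 2) (t + 1), DecayBy 3 (7 * D)
      (fun k => freq k * fc (fun x => f (u s x)) k) := fun s hs =>
    DecayBy.freq_mul ((hD s (Ioo_subset_Icc_self hs)).anti (by norm_num))
  have hd : ∀ s ∈ Ioo (t / 2) (t + 1), DecayBy 3 (‖(ν : ℂ)‖ * (7 ^ 2 * C) + ‖(-1 : ℂ)‖ * (7 * D))
      (fun k => ν * freq k ^ 2 * fc (u s) k - freq k * fc (fun x => f (u s x)) k) := fun s hs => by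
    have e := (hd1 s hs).add ((hd2 s hs).const_mul (-1))
    simpa [sub_eq_add_neg, mul_assoc] using e
  have hf1 : ContDiff ℝ 1 f := hf.of_le (by exact_mod_cast le_top)
  have hmem : t ∈ Ioo (t / 2) (t + 1) := ⟨by linarith, by linarith⟩
  have key := hasDerivAt_ser_time (a := t / 2) (b := t + 1)
    (c := fun s k => freq k ^ 1 * (fc (u s) k - fc (w s) k))
    (d := fun s k => freq k ^ 1 *
      (ν * freq k ^ 2 * fc (u s) k - freq k * fc (fun x => f (u s x)) k))
    (fun s hs => DecayBy.freq_pow_mul (r := 2) ((hc s hs).anti (by norm_num)))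
    (fun s hs => DecayBy.freq_pow_mul (r := 2) (hd s hs))
    (fun s hs k => (h.hasDerivAt_mode hf1 k (by linarith [hs.1])).const_mul _) hmem x
  have key2 : HasDerivAt (fun s => dser 1 (fun k => fc (u s) k - fc (w s) k) x)
      (dser 1 (fun k => ν * freq k ^ 2 * fc (u t) k - freq k * fc (fun x => f (u t x)) k) x) t :=
    Complex.reCLM.hasFDerivAt.comp_hasDerivAt t key
  refine key2.congr_deriv ?_
  have e0 := dser_sub (n := 1) (hd1 t hmem) (hd2 t hmem) x
  have e1 : dser 1 (fun k => ν * (freq k ^ 2 * fc (u t) k)) x = ν * dser 3 (fc (u t)) x := by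
    simp only [dser, ser]
    rw [← Complex.re_ofReal_mul, ← tsum_mul_left]
    congr 2
    funext k; ring
  have e2 : dser 1 (fun k => freq k * fc (fun x => f (u t x)) k) x
      = dser 2 (fc fun x => f (u t x)) x := by
    simp only [dser, ser]
    congr 2
    funext k; ring
  rw [e1, e2, h.dser_two_comp hf hν ht] at e0
  rw [← e0]
  congr 1
  funext k; ring

end IsPath

/-! ### The maximum principle -/

/-- Only earlier times are compared, since the maximum may sit at the right end of the time
interval. -/
theorem nonneg_of_hasDerivAt_of_le_left {g : ℝ → ℝ} {g' a s : ℝ} (has : a < s)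
    (hg : HasDerivAt g g' s) (hmax : ∀ r ∈ Icc a s, g r ≤ g s) : 0 ≤ g' := by
  have h1 := (hasDerivWithinAt_iff_tendsto_slope' (s := Iio s) (by simp)).mp
    hg.hasDerivWithinAt
  refine ge_of_tendsto h1 ?_
  filter_upwards [Ioo_mem_nhdsLT has] with r hr
  rw [slope_def_field]
  exact div_nonneg_of_nonpos (by linarith [hmax r ⟨hr.1.le, hr.2.le⟩]) (by linarith [hr.2])

/-- If the second derivative were positive, the maximum point would also be a local minimum, so `g`
would be locally constant and the second derivative zero. -/
theorem nonpos_of_hasDerivAt_hasDerivAt_of_forall_le {g g' : ℝ → ℝ} {c x : ℝ}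
    (hg : ∀ y, HasDerivAt g (g' y) y) (hg' : HasDerivAt g' c x) (hmax : ∀ y, g y ≤ g x) :
    g' x = 0 ∧ c ≤ 0 := by
  have hmax' : IsLocalMax g x := Eventually.of_forall hmax
  have h0 : g' x = 0 := hmax'.hasDerivAt_eq_zero (hg x)
  refine ⟨h0, ?_⟩
  by_contra! hc
  have hd : deriv g = g' := funext fun y => (hg y).deriv
  have hmin : IsLocalMin g x := isLocalMin_of_deriv_deriv_pos (by rw [hd, hg'.deriv]; exact hc)
    (by rw [hd, h0]) (hg x).continuousAt
  have heq : g =ᶠ[𝓝 x] fun _ => g x := by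
    filter_upwards [hmin] with y hy
    exact le_antisymm (hmax y) hy
  have h2 := heq.deriv.deriv_eq
  rw [hd, hg'.deriv] at h2
  simp at h2
  exact hc.ne' h2

/-- A periodic function of zero mean with derivative at most `B` is bounded by `B`. -/
theorem abs_le_of_deriv_le {v v' : ℝ → ℝ} {B : ℝ} (hB : 0 ≤ B) (hp : Function.Periodic v 1)
    (hmean : ∫ x in (0 : ℝ)..1, v x = 0) (hv : ∀ x, HasDerivAt v (v' x) x)
    (hv' : ∀ x, v' x ≤ B) (x : ℝ) : |v x| ≤ B := by
  have hd : Differentiable ℝ v := fun x => (hv x).differentiableAt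
  -- A one-sided slope bound limits only the rise over a period. Averaging over the period after `x`
  -- bounds `v x` from below, and over the period before `x` from above.
  have hlip : ∀ y z, y ≤ z → z ≤ y + 1 → v z - v y ≤ B := by
    intro y z hyz hz
    have h1 := image_sub_le_mul_sub_of_deriv_le hd
      (fun x => by rw [(hv x).deriv]; exact hv' x) hyz
    nlinarith
  have hint : ∀ a b, IntervalIntegrable v volume a b := fun a b =>
    hd.continuous.intervalIntegrable a b
  have hm : ∀ a, ∫ y in a..a + 1, v y = 0 := by
    intro a
    rw [hp.intervalIntegral_add_eq a 0, zero_add, hmean]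
  rw [abs_le]
  constructor
  · have h1 : ∫ y in x..x + 1, v y ≤ ∫ _ in x..x + 1, (v x + B) :=
      intervalIntegral.integral_mono_on (by linarith) (hint _ _) intervalIntegrable_const
        fun y hy => by linarith [hlip x y hy.1 hy.2]
    rw [hm, intervalIntegral.integral_const] at h1
    simp at h1
    linarith
  · have h1 : ∫ _ in (x - 1)..(x - 1) + 1, (v x - B) ≤ ∫ y in (x - 1)..(x - 1) + 1, v y :=
      intervalIntegral.integral_mono_on (by linarith) intervalIntegrable_const (hint _ _)
        fun y hy => by linarith [hlip y x (by linarith [hy.2]) (by linarith [hy.1])]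
    rw [hm, intervalIntegral.integral_const] at h1
    simp at h1
    linarith

/-- The growth condition with exponent less than `2` closes the estimate at the maximum. -/
theorem exists_bound_of_quadratic {σ C η : ℝ} (hσ : 0 < σ) (hC : 0 < C) (hη : 1 ≤ η)
    (hη2 : η < 2) : ∃ D : ℝ, ∃ q : ℕ, 1 ≤ q ∧ 0 ≤ D ∧ ∀ N K τ p A : ℝ, 0 ≤ N → 0 ≤ K → 0 < τ →
      τ ≤ 3 / 2 → N / τ - K ≤ p → A ≤ C * (1 + (N / τ + K)) ^ η →
      σ * (τ * p) ^ 2 ≤ N + τ ^ 2 * K * (1 + A) → N ≤ D * (1 + K) ^ q := by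
  -- The quadratic inequality reduces to `N ^ (2 - η) ≤ C3 (1 + K)`. Since `C3 ≥ 1`, the exponent `1
  -- / (2 - η)` may be rounded up to the integer `q`.
  set q : ℕ := ⌈1 / (2 - η)⌉₊ + 1 with hq
  set C3 : ℝ := max 1 (4 * (4 + 8 * C) / σ) with hC3
  have hC31 : 1 ≤ C3 := le_max_left _ _
  refine ⟨4 + C3 ^ q, q, by omega, by positivity, ?_⟩
  intro N K τ p A hN hK hτ hτ2 hp hA hmain
  have hK1 : 1 ≤ (1 + K) ^ q := one_le_pow₀ (by linarith)
  have hKq : 1 + K ≤ (1 + K) ^ q := le_self_pow₀ (by linarith) (by omega)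
  -- Either `N` is already bounded, or it dominates `K` so that the loss `τ K ≤ 3K/2` costs at most
  -- half of `N` in the lower bound for `τ p`.
  rcases le_or_gt N (4 * (1 + K)) with hcase | hcase
  · calc N ≤ 4 * (1 + K) := hcase
      _ ≤ 4 * (1 + K) ^ q := by linarith
      _ ≤ (4 + C3 ^ q) * (1 + K) ^ q := by
        gcongr
        exact le_add_of_nonneg_right (by positivity)
  have hN1 : 1 ≤ N := by linarith
  have hNpos : 0 < N := by linarith
  have h1 : N / 2 ≤ τ * p := by
    have e1 : τ * (N / τ - K) ≤ τ * p := by gcongr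
    have e2 : τ * (N / τ - K) = N - τ * K := by field_simp
    have e3 : τ * K ≤ 3 / 2 * K := by gcongr
    linarith
  have h2 : N ^ 2 / 4 ≤ (τ * p) ^ 2 := by
    have := pow_le_pow_left₀ (by positivity) h1 2
    linarith [this, show (N / 2) ^ 2 = N ^ 2 / 4 by ring]
  have hNη : N ≤ N ^ η := by
    simpa using Real.rpow_le_rpow_of_exponent_le hN1 hη
  -- The factor `τ ^ η` absorbs the singularity of `N / τ`, and the remaining `τ ^ (2 - η)` is
  -- bounded because `η < 2`; the estimate is thus uniform as `τ → 0`.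
  have h3 : τ ^ 2 * (1 + (N / τ + K)) ^ η ≤ 8 * N ^ η := by
    have e1 : τ ^ 2 = τ ^ (2 - η) * τ ^ η := by
      rw [← Real.rpow_add hτ, sub_add_cancel, Real.rpow_two]
    have e2 : τ ^ η * (1 + (N / τ + K)) ^ η = (τ + N + τ * K) ^ η := by
      rw [← Real.mul_rpow hτ.le (by positivity)]
      congr 1
      field_simp
      ring
    have e3 : (τ + N + τ * K) ^ η ≤ 4 * N ^ η := by
      calc (τ + N + τ * K) ^ η ≤ (2 * N) ^ η := by
            apply Real.rpow_le_rpow (by positivity) _ (by linarith)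
            nlinarith
        _ = 2 ^ η * N ^ η := Real.mul_rpow (by norm_num) hN
        _ ≤ 2 ^ (2 : ℝ) * N ^ η := by
            gcongr
            norm_num
        _ = 4 * N ^ η := by norm_num
    have e4 : τ ^ (2 - η) ≤ 2 := by
      calc τ ^ (2 - η) ≤ 2 ^ (2 - η) :=
            Real.rpow_le_rpow hτ.le (by linarith) (by linarith)
        _ ≤ 2 ^ (1 : ℝ) := Real.rpow_le_rpow_of_exponent_le (by norm_num) (by linarith)
        _ = 2 := Real.rpow_one 2
    calc τ ^ 2 * (1 + (N / τ + K)) ^ η = τ ^ (2 - η) * (τ ^ η * (1 + (N / τ + K)) ^ η) := by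
          rw [e1]; ring
      _ ≤ 2 * (4 * N ^ η) := by
          rw [e2]
          gcongr
      _ = 8 * N ^ η := by ring
  have h4 : τ ^ 2 * A ≤ 8 * C * N ^ η := by
    calc τ ^ 2 * A ≤ τ ^ 2 * (C * (1 + (N / τ + K)) ^ η) := by gcongr
      _ = C * (τ ^ 2 * (1 + (N / τ + K)) ^ η) := by ring
      _ ≤ C * (8 * N ^ η) := by gcongr
      _ = _ := by ring
  have h5 : σ * (N ^ 2 / 4) ≤ (4 + 8 * C) * (1 + K) * N ^ η := by
    have e1 : σ * (N ^ 2 / 4) ≤ N + τ ^ 2 * K * (1 + A) :=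
      (mul_le_mul_of_nonneg_left h2 hσ.le).trans hmain
    have e2 : τ ^ 2 * K ≤ 3 * K * N ^ η := by
      have : τ ^ 2 ≤ 3 := by nlinarith
      calc τ ^ 2 * K ≤ 3 * K := by gcongr
        _ ≤ 3 * K * N ^ η := le_mul_of_one_le_right (by positivity) (hN1.trans hNη)
    have e3 : τ ^ 2 * K * A ≤ 8 * C * K * N ^ η := by
      calc τ ^ 2 * K * A = K * (τ ^ 2 * A) := by ring
        _ ≤ K * (8 * C * N ^ η) := by gcongr
        _ = _ := by ring
    have e4 : 0 ≤ N ^ η := by positivity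
    have e5 : 0 ≤ K * N ^ η := by positivity
    have e6 : 0 ≤ C * N ^ η := by positivity
    nlinarith
  have h6 : N ^ (2 - η) ≤ C3 * (1 + K) := by
    have e1 : N ^ 2 = N ^ (2 - η) * N ^ η := by
      rw [← Real.rpow_add hNpos, sub_add_cancel, Real.rpow_two]
    have e2 : 0 < N ^ η := by positivity
    have e3 : σ * N ^ (2 - η) ≤ 4 * (4 + 8 * C) * (1 + K) := by
      refine le_of_mul_le_mul_right ?_ e2
      calc σ * N ^ (2 - η) * N ^ η = 4 * (σ * (N ^ 2 / 4)) := by rw [e1]; ring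
        _ ≤ 4 * ((4 + 8 * C) * (1 + K) * N ^ η) := by gcongr
        _ = _ := by ring
    calc N ^ (2 - η) ≤ 4 * (4 + 8 * C) * (1 + K) / σ := by
          rw [le_div_iff₀ hσ]; linarith
      _ = 4 * (4 + 8 * C) / σ * (1 + K) := by ring
      _ ≤ C3 * (1 + K) := by gcongr; exact le_max_right _ _
  have h7 : N ≤ (C3 * (1 + K)) ^ q := by
    have hpos : 0 < 2 - η := by linarith
    have hbase : 1 ≤ C3 * (1 + K) := by nlinarith
    calc N = (N ^ (2 - η)) ^ (1 / (2 - η)) := by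
          rw [← Real.rpow_mul hN, mul_one_div_cancel hpos.ne', Real.rpow_one]
      _ ≤ (C3 * (1 + K)) ^ (1 / (2 - η)) :=
          Real.rpow_le_rpow (by positivity) h6 (by positivity)
      _ ≤ (C3 * (1 + K)) ^ ((q : ℕ) : ℝ) := by
          apply Real.rpow_le_rpow_of_exponent_le hbase
          refine (Nat.le_ceil _).trans ?_
          rw [hq]; push_cast; linarith
      _ = _ := Real.rpow_natCast _ _
  calc N ≤ C3 ^ q * (1 + K) ^ q := by rw [← mul_pow]; exact h7
    _ ≤ _ := by gcongr; linarith

namespace IsPath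

variable {f : ℝ → ℝ} {ν : ℝ} {w u : ℝ → ℝ → ℝ}

theorem exists_decayBy_sub (h : IsPath f ν w u) (hf : ContDiff ℝ (⊤ : ℕ∞) f) (hν : 0 < ν) (r : ℕ)
    (a T : ℝ) (ha : 0 < a) :
    ∃ C, ∀ s ∈ Icc a T, DecayBy r C (fun k => fc (u s) k - fc (w s) k) := by
  obtain ⟨C, hC⟩ := h.exists_decayBy hf hν r a T ha
  obtain ⟨B, hB⟩ := h.exists_decayBy_force T r
  refine ⟨C + ‖(-1 : ℂ)‖ * B, fun s hs => ?_⟩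
  have e := ((hC s hs).anti (Nat.le_succ r)).add
    ((hB s ⟨ha.le.trans hs.1, hs.2⟩).const_mul (-1))
  simpa [sub_eq_add_neg] using e

theorem dser_sub_force (h : IsPath f ν w u) (hf : ContDiff ℝ (⊤ : ℕ∞) f) (hν : 0 < ν) (n : ℕ)
    {t : ℝ} (ht : 0 < t) (x : ℝ) : dser n (fun k => fc (u t) k - fc (w t) k) x =
      dser n (fc (u t)) x - dser n (fc (w t)) x := by
  obtain ⟨C, hC⟩ := h.exists_decayBy_at hf hν (2 + n) ht
  exact dser_sub hC ((h.smooth t ht.le).decayBy (2 + n)) x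

/-- The inequality given by the maximum principle at a maximum point `(s₀, x₀)` of
`(s - a) (u_x(s, x) - w_x(s, x) + w_x(a, x))`. -/
theorem inequality_at_max (h : IsPath f ν w u) (hf : ContDiff ℝ (⊤ : ℕ∞) f) (hν : 0 < ν)
    (hν1 : ν ≤ 1) {σ a K s₀ x₀ N : ℝ} (hconv : ∀ x, σ ≤ iteratedDeriv 2 f x) (ha : 0 < a)
    (hK : 0 ≤ K) (has : a < s₀) {z : ℝ → ℝ → ℝ}
    (hz : ∀ s x, z s x = dser 1 (fun k => fc (u s) k - fc (w s) k) x + dser 1 (fc (w a)) x)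
    (hW : ∀ j, 1 ≤ j → j ≤ 3 → ∀ x, |dser j (fc (w s₀)) x - dser j (fc (w a)) x| ≤ K)
    (hspace : ∀ x, z s₀ x ≤ z s₀ x₀)
    (htime : ∀ r ∈ Icc a s₀, (r - a) * z r x₀ ≤ (s₀ - a) * z s₀ x₀)
    (hN : N = (s₀ - a) * z s₀ x₀) (hN0 : 0 ≤ N) :
    N / (s₀ - a) - K ≤ dser 1 (fc (u s₀)) x₀ ∧ |u s₀ x₀| ≤ N / (s₀ - a) + K ∧
    σ * ((s₀ - a) * dser 1 (fc (u s₀)) x₀) ^ 2 ≤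
      N + (s₀ - a) ^ 2 * K * (1 + |deriv f (u s₀ x₀)|) := by
  have hs₀0 : 0 < s₀ := ha.trans has
  have hzU : ∀ x, z s₀ x
      = dser 1 (fc (u s₀)) x - (dser 1 (fc (w s₀)) x - dser 1 (fc (w a)) x) := by
    intro x
    rw [hz, h.dser_sub_force hf hν 1 hs₀0]
    ring
  have hzd : ∀ n x, HasDerivAt
      (fun x => dser n (fc (u s₀)) x - (dser n (fc (w s₀)) x - dser n (fc (w a)) x))
      (dser (n + 1) (fc (u s₀)) x - (dser (n + 1) (fc (w s₀)) x - dser (n + 1) (fc (w a)) x)) x :=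
    fun n x => (h.hasDerivAt_dser hf hν n hs₀0 x).sub
      ((h.hasDerivAt_dser_force n hs₀0.le x).sub (h.hasDerivAt_dser_force n ha.le x))
  -- At the maximum `u_xx` and `u_xxx` are compared with the derivatives of the force increment:
  -- equality in order two, an upper bound in order three.
  obtain ⟨hx1, hx2⟩ := nonpos_of_hasDerivAt_hasDerivAt_of_forall_le (hzd 1) (hzd 2 x₀)
    (fun y => by rw [← hzU, ← hzU]; exact hspace y)
  have htd := ((hasDerivAt_id s₀).sub_const a).mul
    ((h.hasDerivAt_time hf hν hs₀0 x₀).add_const (dser 1 (fc (w a)) x₀))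
  have hge := nonneg_of_hasDerivAt_of_le_left has htd (fun r hr => by
    have := htime r hr
    rwa [hz, hz] at this)
  rw [← hz s₀ x₀] at hge
  simp only [id, one_mul] at hge
  have hW1 := hW 1 le_rfl (by norm_num)
  have hW2 := hW 2 (by norm_num) (by norm_num) x₀
  have hW3 := abs_le.mp (hW 3 (by norm_num) le_rfl x₀)
  have hu1 := hzU x₀
  -- The maximality in `x` bounds the slope on the whole circle, and zero mean turns this into a
  -- bound on `u` itself.
  have hbound : |u s₀ x₀| ≤ z s₀ x₀ + K := by
    have hz0 : 0 ≤ z s₀ x₀ := nonneg_of_mul_nonneg_right (hN ▸ hN0) (by linarith)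
    refine abs_le_of_deriv_le (by positivity) (h.memH1 s₀ hs₀0.le).periodic
      (h.memH1 s₀ hs₀0.le).zero_mean (h.hasDerivAt_space hf hν hs₀0) (fun x => ?_) x₀
    have e1 := hspace x
    rw [hzU x] at e1
    linarith [(abs_le.mp (hW1 x)).2]
  generalize dser 3 (fc (u s₀)) x₀ = U3 at *
  generalize dser 2 (fc (u s₀)) x₀ = U2 at *
  generalize dser 1 (fc (u s₀)) x₀ = p at *
  generalize dser 3 (fc (w s₀)) x₀ - dser 3 (fc (w a)) x₀ = W3 at *
  generalize dser 2 (fc (w s₀)) x₀ - dser 2 (fc (w a)) x₀ = W2 at *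
  generalize deriv f (u s₀ x₀) = A at *
  have hc := hconv (u s₀ x₀)
  generalize iteratedDeriv 2 f (u s₀ x₀) = F at *
  generalize z s₀ x₀ = Z at *
  have hτ0 : 0 < s₀ - a := by linarith
  generalize s₀ - a = τ at *
  have hZ : N / τ = Z := by rw [hN]; field_simp
  rw [hZ]
  refine ⟨by linarith [(abs_le.mp (hW1 x₀)).1], hbound, ?_⟩
  -- Here `ν ≤ 1` makes the estimate independent of the viscosity.
  have h3 : ν * U3 ≤ K := by
    have e1 : U3 ≤ K := by linarith [hW3.2]
    rcases le_or_gt U3 0 with hc | hc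
    · nlinarith
    · nlinarith
  have h2 : -(A * U2) ≤ |A| * K := by
    rw [show U2 = W2 by linarith]
    refine (neg_le_abs _).trans ?_
    rw [abs_mul]
    exact mul_le_mul_of_nonneg_left hW2 (abs_nonneg _)
  have e1 : σ * p ^ 2 ≤ F * p ^ 2 := mul_le_mul_of_nonneg_right hc (sq_nonneg p)
  -- The sign of the time derivative of `(s - a) z` at the maximum; multiplying by `τ` then makes `N
  -- = τ Z` appear.
  have e2 : 0 ≤ Z + τ * (K - σ * p ^ 2 + |A| * K) := by
    refine hge.trans (add_le_add le_rfl (mul_le_mul_of_nonneg_left ?_ hτ0.le))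
    linarith
  have e3 : 0 ≤ τ * (Z + τ * (K - σ * p ^ 2 + |A| * K)) := mul_nonneg hτ0.le e2
  have e5 : τ * (Z + τ * (K - σ * p ^ 2 + |A| * K))
      = N + τ ^ 2 * K * (1 + |A|) - σ * (τ * p) ^ 2 := by rw [hN]; ring
  linarith

/-- Oleinik's estimate: the slopes of a solution are bounded from above in terms of the force. -/
theorem exists_slope_bound (hf : IsFlux f) : ∃ D : ℝ, ∃ q : ℕ, 1 ≤ q ∧ 0 ≤ D ∧
    ∀ (ν : ℝ) (w u : ℝ → ℝ → ℝ), IsPath f ν w u → 0 < ν → ν ≤ 1 → ∀ a K : ℝ, 0 < a → 0 ≤ K →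
      (∀ j, 1 ≤ j → j ≤ 3 → ∀ s ∈ Icc a (a + 3 / 2), ∀ x,
        |dser j (fc (w s)) x - dser j (fc (w a)) x| ≤ K) →
      ∀ s ∈ Icc (a + 1 / 2) (a + 3 / 2), ∀ x, deriv (u s) x ≤ D * (1 + K) ^ q := by
  obtain ⟨σ, hσ, hconv⟩ := hf.strongly_convex
  obtain ⟨η, -, hη1, hη2, hgrow⟩ := hf.growth
  obtain ⟨C, hC, hfC⟩ := hgrow 1
  rw [iteratedDeriv_one] at hfC
  obtain ⟨D, q, hq, hD, hquad⟩ := exists_bound_of_quadratic hσ hC hη1 hη2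
  refine ⟨2 * D + 1, q, hq, by positivity, ?_⟩
  intro ν w u h hν hν1 a K ha hK hW
  have hsm := hf.smooth
  obtain ⟨z, hz⟩ : ∃ z : ℝ → ℝ → ℝ, ∀ s x,
      z s x = dser 1 (fun k => fc (u s) k - fc (w s) k) x + dser 1 (fc (w a)) x :=
    ⟨_, fun _ _ => rfl⟩
  have haT : a ≤ a + 3 / 2 := by linarith
  have hzcont : ContinuousOn (fun p : ℝ × ℝ => z p.1 p.2) (Icc a (a + 3 / 2) ×ˢ univ) := by
    simp only [hz]
    obtain ⟨B, hB⟩ := h.exists_decayBy_sub hsm hν 3 a (a + 3 / 2) ha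
    refine (continuousOn_dser (n := 1) hB fun k => ?_).add ?_
    · exact ((h.continuousOn_fc k).sub (h.continuousOn_fc_force k)).mono
        (Icc_subset_Ici_self.trans (Ici_subset_Ici.mpr ha.le))
    · have : Continuous (dser 1 (fc (w a))) :=
        continuous_iff_continuousAt.mpr fun x =>
          (h.hasDerivAt_dser_force 1 ha.le x).continuousAt
      exact (this.comp continuous_snd).continuousOn
  have hZcont : ContinuousOn (fun p : ℝ × ℝ => (p.1 - a) * z p.1 p.2)
      (Icc a (a + 3 / 2) ×ˢ Icc 0 1) :=
    ((continuous_fst.sub continuous_const).continuousOn).mul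
      (hzcont.mono (prod_mono le_rfl (subset_univ _)))
  obtain ⟨⟨s₀, x₀⟩, hmem, hmax⟩ := (isCompact_Icc.prod isCompact_Icc).exists_isMaxOn
    ⟨((a : ℝ), (0 : ℝ)), ⟨⟨le_rfl, haT⟩, ⟨le_rfl, zero_le_one⟩⟩⟩ hZcont
  obtain ⟨N, hN⟩ : ∃ N, N = (s₀ - a) * z s₀ x₀ := ⟨_, rfl⟩
  have hs₀ : s₀ ∈ Icc a (a + 3 / 2) := hmem.1
  have hmax' : ∀ s ∈ Icc a (a + 3 / 2), ∀ x, (s - a) * z s x ≤ (s₀ - a) * z s₀ x₀ := by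
    intro s hs x
    have := hmax (show (s, Int.fract x) ∈ Icc a (a + 3 / 2) ×ˢ Icc (0 : ℝ) 1 from
      ⟨hs, (Int.fract_nonneg x), (Int.fract_lt_one x).le⟩)
    simp only [mem_ofPred_eq] at this
    have hper : Function.Periodic (z s) 1 := by
      rw [show z s = _ from funext (hz s)]
      exact (dser_periodic 1 _).add (dser_periodic 1 _)
    rwa [periodic_fract hper] at this
  have hN0 : 0 ≤ N := by
    have := hmax' a ⟨le_rfl, haT⟩ 0
    rw [hN]
    simpa using this
  have hNbound : N ≤ D * (1 + K) ^ q := by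
    -- A maximum at the initial time has value zero because of the weight `s - a`, whatever the data
    -- there.
    rcases eq_or_lt_of_le hs₀.1 with heq | hlt
    · have : N = 0 := by rw [hN, ← heq]; ring
      rw [this]; positivity
    have hτ0 : 0 < s₀ - a := by linarith
    obtain ⟨h1, h2, h3⟩ := h.inequality_at_max hsm hν hν1 hconv ha hK hlt hz
      (fun j hj hj3 => hW j hj hj3 s₀ hs₀)
      (fun x => le_of_mul_le_mul_left (hmax' s₀ hs₀ x) hτ0)
      (fun r hr => hmax' r ⟨hr.1, hr.2.trans hs₀.2⟩ x₀) hN hN0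
    refine hquad N K (s₀ - a) _ _ hN0 hK hτ0 (by linarith [hs₀.2]) h1 ?_ h3
    refine (hfC _).trans ?_
    gcongr
  intro s hs x
  have hs0 : 0 < s := by linarith [hs.1]
  have hsT : s ∈ Icc a (a + 3 / 2) := ⟨by linarith [hs.1], hs.2⟩
  rw [(h.hasDerivAt_space hsm hν hs0 x).deriv]
  -- Here `s - a ≥ 1/2`, and `N ≥ 0` covers negative `z`.
  have e1 : z s x ≤ 2 * N := by
    have e := hmax' s hsT x
    rw [← hN] at e
    rcases le_or_gt (z s x) 0 with hc | hc
    · linarith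
    · nlinarith [hs.1]
  have e2 := hz s x
  rw [h.dser_sub_force hsm hν 1 hs0] at e2
  have e3 := (abs_le.mp (hW 1 le_rfl (by norm_num) s hsT x)).2
  have e4 : K ≤ (1 + K) ^ q := by
    have : 1 + K ≤ (1 + K) ^ q := le_self_pow₀ (by linarith) (by omega)
    linarith
  have e5 : dser 1 (fc (u s)) x ≤ 2 * N + K := by linarith
  calc dser 1 (fc (u s)) x ≤ 2 * N + K := e5
    _ ≤ 2 * (D * (1 + K) ^ q) + (1 + K) ^ q := by linarith
    _ = (2 * D + 1) * (1 + K) ^ q := by ring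

/-! ### The maximal slope of a path -/

theorem continuousOn_slope (h : IsPath f ν w u) (hf : ContDiff ℝ (⊤ : ℕ∞) f) (hν : 0 < ν)
    {a T : ℝ} (ha : 0 < a) :
    ContinuousOn (fun p : ℝ × ℝ => deriv (u p.1) p.2) (Icc a T ×ˢ univ) := by
  obtain ⟨C, hC⟩ := h.exists_decayBy hf hν 2 a T ha
  refine (continuousOn_dser (n := 1) hC fun k => (h.continuousOn_fc k).mono
    (Icc_subset_Ici_self.trans (Ici_subset_Ici.mpr ha.le))).congr fun p hp => ?_
  exact (h.hasDerivAt_space hf hν (ha.trans_le hp.1.1) p.2).deriv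

theorem differentiable (h : IsPath f ν w u) (hf : ContDiff ℝ (⊤ : ℕ∞) f) (hν : 0 < ν)
    {t : ℝ} (ht : 0 < t) : Differentiable ℝ (u t) := fun x =>
  (h.hasDerivAt_space hf hν ht x).differentiableAt

theorem deriv_periodic {v : ℝ → ℝ} (hp : Function.Periodic v 1) :
    Function.Periodic (deriv v) 1 := by
  have := periodic_iteratedDeriv hp 1
  rwa [iteratedDeriv_one] at this

theorem isGreatest_slopes (h : IsPath f ν w u) (hf : ContDiff ℝ (⊤ : ℕ∞) f) (hν : 0 < ν)
    {t : ℝ} (ht : 0 < t) : IsGreatest (slopes u t) (sSup (slopes u t)) := by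
  obtain ⟨⟨s, x⟩, hmem, hmax⟩ := (isCompact_Icc.prod isCompact_Icc).exists_isMaxOn
    ⟨((t : ℝ), (0 : ℝ)), ⟨⟨le_rfl, by linarith⟩, ⟨le_rfl, zero_le_one⟩⟩⟩
    ((h.continuousOn_slope hf hν (T := t + 1) ht).mono
      (prod_mono le_rfl (subset_univ (Icc 0 1))))
  have hg : IsGreatest (slopes u t) (deriv (u s) x) := by
    refine ⟨⟨s, hmem.1, x, rfl⟩, ?_⟩
    rintro _ ⟨r, hr, y, rfl⟩
    have := hmax (show (r, Int.fract y) ∈ Icc t (t + 1) ×ˢ Icc (0 : ℝ) 1 from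
      ⟨hr, Int.fract_nonneg y, (Int.fract_lt_one y).le⟩)
    simp only [mem_ofPred_eq] at this
    rwa [periodic_fract (deriv_periodic (h.memH1 r (ht.le.trans hr.1)).periodic)] at this
  rw [hg.csSup_eq]
  exact hg

/-- Rolle's theorem on one period. It makes the maximal slope nonnegative, so that real powers of it
are monotone. -/
theorem zero_mem_slopes (h : IsPath f ν w u) {t : ℝ} (ht : 0 < t) : 0 ∈ slopes u t := by
  have hm := h.memH1 t ht.le
  obtain ⟨c, -, hc⟩ := exists_deriv_eq_zero (f := u t) zero_lt_one
    hm.continuous.continuousOn (by simpa using (hm.periodic 0).symm)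
  exact ⟨t, ⟨le_rfl, by linarith⟩, c, hc.symm⟩

theorem sSup_slopes_nonneg (h : IsPath f ν w u) (hf : ContDiff ℝ (⊤ : ℕ∞) f) (hν : 0 < ν)
    {t : ℝ} (ht : 0 < t) : 0 ≤ sSup (slopes u t) :=
  (h.isGreatest_slopes hf hν ht).2 (h.zero_mem_slopes ht)

/-- The maximal slope is the least upper bound of countably many difference quotients. -/
theorem isLUB_slopes (h : IsPath f ν w u) (hf : ContDiff ℝ (⊤ : ℕ∞) f) (hν : 0 < ν)
    {t : ℝ} (ht : 0 < t) :
    IsLUB {y | ∃ i : ℚ × ℚ × ℚ, slope (u (t + max 0 (min (i.1 : ℝ) 1))) i.2.1 i.2.2 = y}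
      (sSup (slopes u t)) := by
  have hg := h.isGreatest_slopes hf hν ht
  -- Clamping lets all rationals index times in `[t, t + 1]` without a subtype.
  have hclamp : ∀ q : ℝ, t + max 0 (min q 1) ∈ Icc t (t + 1) := fun q =>
    ⟨by linarith [le_max_left 0 (min q 1)],
      by linarith [max_le zero_le_one (min_le_right q 1)]⟩
  have hmvt : ∀ s ∈ Icc t (t + 1), ∀ x y : ℝ, x < y → slope (u s) x y ≤ sSup (slopes u t) := by
    intro s hs x y hxy
    have hs0 : 0 < s := ht.trans_le hs.1
    have hd := h.differentiable hf hν hs0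
    obtain ⟨c, -, hc⟩ := exists_deriv_eq_slope (u s) hxy hd.continuous.continuousOn
      hd.differentiableOn
    rw [slope_def_field, ← hc]
    exact hg.2 ⟨s, hs, c, rfl⟩
  constructor
  · rintro _ ⟨⟨q, x, y⟩, rfl⟩
    simp only
    rcases lt_trichotomy (x : ℝ) (y : ℝ) with hxy | hxy | hxy
    · exact hmvt _ (hclamp q) x y hxy
    · rw [hxy, slope_same]; exact h.sSup_slopes_nonneg hf hν ht
    · rw [slope_comm]; exact hmvt _ (hclamp q) y x hxy
  · intro b hb
    -- A bound at clamped rational times extends to all times because `u` is continuous in time at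
    -- each fixed point.
    have h1 : ∀ s ∈ Icc t (t + 1), ∀ x y : ℚ, x < y → u s y - u s x ≤ b * (y - x) := by
      intro s hs x y hxy
      have hxy' : (0 : ℝ) < y - x := by exact_mod_cast sub_pos.mpr hxy
      have hcont : ∀ x : ℝ, Continuous fun q : ℝ => u (t + max 0 (min q 1)) x := fun x =>
        (h.continuousOn_eval x).comp_continuous (by fun_prop)
          fun q => ht.le.trans (hclamp q).1
      have hall : ∀ q : ℝ, u (t + max 0 (min q 1)) y - u (t + max 0 (min q 1)) x
          ≤ b * (y - x) := by
        intro q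
        refine Rat.denseRange_cast.induction_on (p := fun q : ℝ =>
          u (t + max 0 (min q 1)) y - u (t + max 0 (min q 1)) x ≤ b * (y - x)) q
          (isClosed_le ((hcont y).sub (hcont x)) continuous_const) fun q => ?_
        have := hb ⟨(q, x, y), rfl⟩
        simp only at this
        rwa [slope_def_field, div_le_iff₀ hxy'] at this
      have e := hall (s - t)
      rwa [min_eq_left (by linarith [hs.2]), max_eq_right (by linarith [hs.1]),
        add_sub_cancel] at e
    rw [(show sSup (slopes u t) ≤ b ↔ ∀ y ∈ slopes u t, y ≤ b from
      ⟨fun hle y hy => (hg.2 hy).trans hle, fun hall => hall _ hg.1⟩)]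
    rintro _ ⟨s, hs, x, rfl⟩
    have hd := h.differentiable hf hν (ht.trans_le hs.1)
    -- Rational increments `1 / (n + 1)` let the bound pass from rational to real `x` by continuity;
    -- `n → ∞` then yields the derivative.
    have h2 : ∀ n : ℕ, u s (x + 1 / ((n : ℝ) + 1)) - u s x ≤ b * (1 / ((n : ℝ) + 1)) := by
      intro n
      refine Rat.denseRange_cast.induction_on (p := fun x : ℝ =>
        u s (x + 1 / ((n : ℝ) + 1)) - u s x ≤ b * (1 / ((n : ℝ) + 1))) x
        (isClosed_le ((hd.continuous.comp (by fun_prop)).sub hd.continuous) continuous_const)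
        fun q => ?_
      have := h1 s hs q (q + 1 / ((n : ℚ) + 1)) (by
        have : (0 : ℚ) < 1 / ((n : ℚ) + 1) := by positivity
        linarith)
      push_cast at this
      simpa using this
    have h3 := (hasDerivAt_iff_tendsto_slope_zero.mp (hd x).hasDerivAt).comp
      (show Tendsto (fun n : ℕ => 1 / ((n : ℝ) + 1)) atTop (𝓝[≠] 0) from
        tendsto_nhdsWithin_iff.mpr ⟨tendsto_one_div_add_atTop_nhds_zero_nat,
          Eventually.of_forall fun n => by
            have : (0 : ℝ) < 1 / ((n : ℝ) + 1) := by positivity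
            exact this.ne'⟩)
    refine le_of_tendsto h3 (Eventually.of_forall fun n => ?_)
    simp only [Function.comp, smul_eq_mul]
    have hn : (0 : ℝ) < 1 / ((n : ℝ) + 1) := by positivity
    rw [inv_mul_le_iff₀ hn, mul_comm]
    exact h2 n

end IsPath

/-! ### Chaining -/

/-- An odd point of level `m + 1` is one increment away from a point of level `m`, and an even one
already lies there. The bound is `B` times the geometric sum `∑ i ≤ m, (5/6)^i`. -/
theorem abs_sub_le_of_dyadic {g : ℝ → ℝ} {B : ℝ}
    (h : ∀ m j : ℕ, j < 2 ^ m → |g ((j + 1) / 2 ^ m) - g (j / 2 ^ m)| ≤ B * (5 / 6) ^ m) (m : ℕ) :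
    ∀ j : ℕ, j ≤ 2 ^ m → |g (j / 2 ^ m) - g 0| ≤ 6 * B * (1 - (5 / 6) ^ (m + 1)) := by
  have hB : 0 ≤ B := by
    have := (abs_nonneg _).trans (h 0 0 (by norm_num))
    simpa using this
  induction m with
  | zero =>
    intro j hj
    have hj' : j = 0 ∨ j = 1 := by
      rw [pow_zero] at hj
      omega
    rcases hj' with rfl | rfl
    · simp; linarith
    · have := h 0 0 (by norm_num)
      norm_num at this ⊢
      linarith
  | succ m ih =>
    intro j hj
    have hpow : (0 : ℝ) ≤ (5 / 6) ^ (m + 1) := by positivity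
    have hstep : ∀ i : ℕ, ((2 * i : ℕ) : ℝ) / 2 ^ (m + 1) = i / 2 ^ m := by
      intro i
      rw [pow_succ]; push_cast
      field_simp
    have hsucc : (5 / 6 : ℝ) ^ (m + 1 + 1) = 5 / 6 * (5 / 6) ^ (m + 1) := pow_succ' _ _
    rcases Nat.even_or_odd' j with ⟨i, rfl | rfl⟩
    · rw [hstep]
      have h1 := ih i (by rw [pow_succ] at hj; omega)
      refine h1.trans ?_
      gcongr 6 * B * (1 - ?_)
      rw [hsucc]; linarith
    · have hi : i < 2 ^ m := by rw [pow_succ] at hj; omega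
      have h1 := ih i hi.le
      have h2 := h (m + 1) (2 * i) (by rw [pow_succ]; omega)
      rw [hstep] at h2
      have e : ((2 * i + 1 : ℕ) : ℝ) = ((2 * i : ℕ) : ℝ) + 1 := by push_cast; ring
      rw [e]
      have h3 := abs_sub_le (g ((((2 * i : ℕ) : ℝ) + 1) / 2 ^ (m + 1))) (g (i / 2 ^ m)) (g 0)
      rw [hsucc]
      nlinarith

/-- A continuous function whose dyadic increments decay geometrically is bounded. -/
theorem abs_sub_le_of_chaining {g : ℝ → ℝ} {B : ℝ} (hc : ContinuousOn g (Icc 0 1))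
    (h : ∀ m j : ℕ, j < 2 ^ m → |g ((j + 1) / 2 ^ m) - g (j / 2 ^ m)| ≤ B * (5 / 6) ^ m)
    {r : ℝ} (hr : r ∈ Icc (0 : ℝ) 1) : |g r - g 0| ≤ 6 * B := by
  have hB : 0 ≤ B := by
    have := (abs_nonneg _).trans (h 0 0 (by norm_num))
    simpa using this
  have hle : ∀ m : ℕ, ⌊r * 2 ^ m⌋₊ ≤ 2 ^ m := fun m => by
    refine Nat.floor_le_of_le ?_
    push_cast
    exact mul_le_of_le_one_left (by positivity) hr.2
  have hlim : Tendsto (fun m : ℕ => (⌊r * 2 ^ m⌋₊ : ℝ) / 2 ^ m) atTop (𝓝 r) :=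
    (tendsto_nat_floor_mul_div_atTop hr.1).comp (tendsto_pow_atTop_atTop_of_one_lt one_lt_two)
  have hmem : ∀ m : ℕ, (⌊r * 2 ^ m⌋₊ : ℝ) / 2 ^ m ∈ Icc (0 : ℝ) 1 := fun m =>
    ⟨by positivity, by
      rw [div_le_one (by positivity)]
      exact_mod_cast hle m⟩
  have h2 : Tendsto (fun m : ℕ => |g ((⌊r * 2 ^ m⌋₊ : ℝ) / 2 ^ m) - g 0|) atTop
      (𝓝 |g r - g 0|) :=
    (((hc r hr).tendsto.comp (tendsto_nhdsWithin_iff.mpr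
      ⟨hlim, Eventually.of_forall hmem⟩)).sub_const _).abs
  refine le_of_tendsto h2 (Eventually.of_forall fun m => ?_)
  refine (abs_sub_le_of_dyadic h m _ (hle m)).trans ?_
  have : (0 : ℝ) ≤ (5 / 6) ^ (m + 1) := by positivity
  nlinarith

/-! ### Gaussian moments -/

/-- Scaling: a centred Gaussian of variance `v` is `√v` times a standard one, so `c` is the standard
moment. -/
theorem exists_gaussian_moment (n : ℕ) : ∃ c : ℝ, 0 ≤ c ∧ ∀ v : ℝ≥0,
    ∫⁻ x, ENNReal.ofReal (x ^ (2 * n)) ∂(gaussianReal 0 v) = ENNReal.ofReal (c * (v : ℝ) ^ n) := by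
  have hev : ∀ x : ℝ, 0 ≤ x ^ (2 * n) := fun x => by rw [pow_mul]; positivity
  have hint : Integrable (fun x : ℝ => x ^ (2 * n)) (gaussianReal 0 1) := by
    have := (memLp_id_gaussianReal (μ := 0) (v := 1) ((2 * n : ℕ) : ℝ≥0)).integrable_norm_pow'
    refine this.congr (ae_of_all _ fun x => ?_)
    simp only [id, Real.norm_eq_abs]
    rw [pow_mul, sq_abs, ← pow_mul]
  refine ⟨∫ x, x ^ (2 * n) ∂(gaussianReal 0 1), integral_nonneg hev, fun v => ?_⟩
  have hv : gaussianReal 0 v = (gaussianReal 0 1).map (Real.sqrt v * ·) := by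
    rw [gaussianReal_map_const_mul, mul_zero, mul_one]
    congr 1
    ext
    simp
  rw [hv, lintegral_map (by fun_prop) (by fun_prop), mul_comm (∫ x, _ ∂_),
    ENNReal.ofReal_mul (by positivity),
    ofReal_integral_eq_lintegral_ofReal hint (ae_of_all _ hev), ← lintegral_const_mul _ (by fun_prop)]
  refine lintegral_congr fun x => ?_
  rw [← ENNReal.ofReal_mul (by positivity), mul_pow, pow_mul (Real.sqrt v), Real.sq_sqrt (NNReal.coe_nonneg v)]

/-! ### Trigonometric modes of the Wiener process -/

/-- The trigonometric functions `cos (2πkx)` and `sin (2πkx)`, `k ≠ 0`. -/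
noncomputable def mode (κ : ℤ × Bool) (x : ℝ) : ℝ :=
  -- The constant mode is replaced by `0`, so that every index gives a function of zero mean.
  if κ.1 = 0 then 0 else
    if κ.2 then Real.cos (2 * Real.pi * κ.1 * x) else Real.sin (2 * Real.pi * κ.1 * x)

theorem continuous_mode (κ : ℤ × Bool) : Continuous (mode κ) := by
  unfold mode
  split_ifs <;> fun_prop

theorem abs_mode_le (κ : ℤ × Bool) (x : ℝ) : |mode κ x| ≤ 1 := by
  unfold mode
  split_ifs
  · simp
  · exact Real.abs_cos_le_one _
  · exact Real.abs_sin_le_one _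

theorem integral_mul_mode {v : ℝ → ℝ} (hv : IntervalIntegrable v volume 0 1) (κ : ℤ × Bool) :
    ∫ x in (0 : ℝ)..1, v x * mode κ x =
      if κ.1 = 0 then 0 else if κ.2 then (fc v κ.1).re else -(fc v κ.1).im := by
  rw [fc_re_im hv]
  unfold mode
  split_ifs <;> simp

theorem abs_integral_mul_mode_le {v : ℝ → ℝ} (hv : IntervalIntegrable v volume 0 1)
    (κ : ℤ × Bool) : |∫ x in (0 : ℝ)..1, v x * mode κ x| ≤ ‖fc v κ.1‖ := by
  rw [integral_mul_mode hv]
  split_ifs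
  · simp
  · exact Complex.abs_re_le_norm _
  · rw [abs_neg]; exact Complex.abs_im_le_norm _

theorem MemSmooth.norm_fc_le {v : ℝ → ℝ} (hv : MemSmooth v) (k : ℤ) :
    ‖fc v k‖ ≤ |∫ x in (0 : ℝ)..1, v x * mode (k, true) x|
      + |∫ x in (0 : ℝ)..1, v x * mode (k, false) x| := by
  have hi := hv.contDiff.continuous.intervalIntegrable (μ := volume) 0 1
  rw [integral_mul_mode hi, integral_mul_mode hi]
  by_cases hk : k = 0
  · subst hk
    rw [fc_zero_eq hv.zero_mean]
    simp
  · simpa [hk] using Complex.norm_le_abs_re_add_abs_im (fc v k)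

theorem integral_mode (κ : ℤ × Bool) : ∫ x in (0 : ℝ)..1, mode κ x = 0 := by
  have h0 : ∀ k : ℤ, k ≠ 0 → fc (fun _ => (1 : ℝ)) k = 0 := by
    intro k hk
    have h1 : AbsolutelyContinuousOnInterval (fun _ : ℝ => (1 : ℝ)) 0 1 :=
      ContDiffOn.absolutelyContinuousOnInterval (by fun_prop)
    have h2 := fc_deriv h1 rfl k
    have h3 : fc (deriv fun _ : ℝ => (1 : ℝ)) k = 0 := by simp [fc]
    rw [h3] at h2
    have hf : freq k ≠ 0 := by simp [freq, hk, Real.pi_ne_zero]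
    exact (mul_eq_zero.mp h2.symm).resolve_left hf
  have h := integral_mul_mode (v := fun _ => (1 : ℝ)) intervalIntegrable_const κ
  simp only [one_mul] at h
  rw [h]
  split_ifs with h1 h2
  · rfl
  · rw [h0 _ h1, Complex.zero_re]
  · rw [h0 _ h1, Complex.zero_im, neg_zero]

theorem memLp_mode (κ : ℤ × Bool) : MemLp (mode κ) 2 circleMeasure :=
  MemLp.of_bound (continuous_mode κ).aestronglyMeasurable 1 (ae_of_all _ (abs_mode_le κ))

/-- The trigonometric modes as elements of `L₂`. -/
noncomputable def modeL2 (κ : ℤ × Bool) : L2Zero :=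
  ⟨(memLp_mode κ).toLp (mode κ), by
    change ∫ x, (memLp_mode κ).toLp (mode κ) x ∂circleMeasure = 0
    rw [integral_congr_ae (memLp_mode κ).coeFn_toLp, ← intervalIntegral.integral_of_le zero_le_one]
    exact integral_mode κ⟩

theorem coe_modeL2 (κ : ℤ × Bool) :
    ((modeL2 κ : Lp ℝ 2 circleMeasure) : ℝ → ℝ) =ᵐ[circleMeasure] mode κ :=
  (memLp_mode κ).coeFn_toLp

theorem norm_modeL2_le (κ : ℤ × Bool) : ‖modeL2 κ‖ ≤ 1 := by
  have h := Lp.norm_le_of_ae_bound (f := (modeL2 κ : Lp ℝ 2 circleMeasure)) zero_le_one (by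
    filter_upwards [coe_modeL2 κ] with x hx
    rw [hx]; exact abs_mode_le κ x)
  simpa [measureUnivNNReal] using h

theorem wt_le_norm_freq {k : ℤ} (hk : k ≠ 0) : wt k ≤ ‖freq k‖ := by
  refine le_of_sq_le_sq ?_ (norm_nonneg _)
  rw [norm_freq]
  refine (IsPath.wt_sq_le k hk).trans (le_of_eq ?_)
  rw [mul_pow, mul_pow _ |(k : ℝ)|, sq_abs]

/-- The variances of the modes decay fast, since the correlation operator is smoothing. -/
theorem IsCorrelationOperator.exists_variance_le {Q : L2Zero →L[ℝ] L2Zero}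
    (hQ : IsCorrelationOperator Q) (r : ℕ) :
    ∃ C : ℝ, 0 ≤ C ∧ ∀ κ, ⟪Q (modeL2 κ), modeL2 κ⟫_ℝ ≤ C * (wt κ.1 ^ r)⁻¹ := by
  obtain ⟨C, hC⟩ := hQ.smoothing r
  refine ⟨|C|, abs_nonneg C, fun κ => ?_⟩
  obtain ⟨g, hg, hgQ, hgC⟩ := hC (modeL2 κ)
  have hi := hg.contDiff.continuous.intervalIntegrable (μ := volume) 0 1
  -- The variance is, up to sign, the real or imaginary part of a Fourier coefficient of the smooth
  -- function `Q (modeL2 κ)`, whose Sobolev norms are bounded uniformly in the mode.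
  have e : ⟪Q (modeL2 κ), modeL2 κ⟫_ℝ = ∫ x in (0 : ℝ)..1, g x * mode κ x := by
    rw [Submodule.coe_inner, L2.inner_def, intervalIntegral.integral_of_le zero_le_one]
    refine integral_congr_ae ?_
    filter_upwards [hgQ, coe_modeL2 κ] with x h1 h2
    rw [h1, h2]
    simp [mul_comm]
  have hw := wt_pos κ.1
  rw [e]
  by_cases hk : κ.1 = 0
  · rw [integral_mul_mode hi, if_pos hk]
    positivity
  · refine (le_abs_self _).trans ((abs_integral_mul_mode_le hi κ).trans ?_)
    rw [← div_eq_mul_inv, le_div_iff₀ (by positivity), mul_comm]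
    calc wt κ.1 ^ r * ‖fc g κ.1‖ ≤ ‖freq κ.1‖ ^ r * ‖fc g κ.1‖ := by
          gcongr; exact wt_le_norm_freq hk
      _ ≤ sobolevNorm r g := norm_freq_pow_mul_fc_le hg.contDiff hg.periodic r κ.1
      _ ≤ C * ‖modeL2 κ‖ := hgC
      _ ≤ |C| * 1 := by gcongr; exacts [le_abs_self C, norm_modeL2_le κ]
      _ = |C| := mul_one _

theorem IsWiener.hasLaw_mode {Ω : Type*} {mΩ : MeasurableSpace Ω} {P : Measure Ω}
    {𝓕 : Filtration ℝ≥0 mΩ} {Q : L2Zero →L[ℝ] L2Zero} {w : ℝ → Ω → ℝ → ℝ}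
    (hw : IsWiener P 𝓕 Q w) {s t : ℝ} (hs : 0 ≤ s) (hst : s ≤ t) (κ : ℤ × Bool) :
    HasLaw (fun ω => ∫ x in (0 : ℝ)..1, (w t ω x - w s ω x) * mode κ x)
      (gaussianReal 0 ((t - s) * ⟪Q (modeL2 κ), modeL2 κ⟫_ℝ).toNNReal) P := by
  have h := hw.gaussian ⟨s, hs⟩ ⟨t, hs.trans hst⟩ hst (modeL2 κ)
  have e : (fun ω => ∫ x in (0 : ℝ)..1, (w t ω x - w s ω x) * mode κ x) = fun ω =>
      ∫ x in (0 : ℝ)..1, (w t ω x - w s ω x) * (modeL2 κ : Lp ℝ 2 circleMeasure) x := by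
    funext ω
    rw [intervalIntegral.integral_of_le zero_le_one, intervalIntegral.integral_of_le zero_le_one]
    refine integral_congr_ae ?_
    filter_upwards [coe_modeL2 κ] with x hx
    rw [hx]
  rw [e]
  exact h

/-! ### Moments of the force -/

/-- The `j`-th dyadic increment of level `m` of a mode, starting at time `a`. -/
noncomputable def dyadicIncrement {Ω : Type*} (w : ℝ → Ω → ℝ → ℝ) (a : ℝ) (κ : ℤ × Bool)
    (m j : ℕ) (ω : Ω) : ℝ :=
  ∫ x in (0 : ℝ)..1, (w (a + 3 / 2 * ((j + 1) / 2 ^ m)) ω x - w (a + 3 / 2 * (j / 2 ^ m)) ω x)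
    * mode κ x

/-- A weighted sum of the `2n`-th powers of all dyadic increments of all modes. -/
noncomputable def incrementSum {Ω : Type*} (w : ℝ → Ω → ℝ → ℝ) (a : ℝ) (n : ℕ) (ω : Ω) : ENNReal :=
  ∑' i : (ℤ × Bool) × ℕ, ∑ j ∈ Finset.range (2 ^ i.2),
    ENNReal.ofReal (((6 / 5) ^ i.2 * wt i.1.1 ^ 5 * dyadicIncrement w a i.1 i.2 j ω) ^ (2 * n))

theorem summable_incrementBound :
    Summable fun i : (ℤ × Bool) × ℕ => (wt i.1.1 ^ 2)⁻¹ * (3 / 4 : ℝ) ^ i.2 := by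
  have h1 : Summable fun κ : ℤ × Bool => (wt κ.1 ^ 2)⁻¹ * (1 : ℝ) :=
    summable_wt.mul_of_nonneg (g := fun _ : Bool => (1 : ℝ)) (Summable.of_finite)
      (fun k => by have := wt_pos k; positivity) (fun _ => zero_le_one)
  simp only [mul_one] at h1
  exact h1.mul_of_nonneg (g := fun m : ℕ => (3 / 4 : ℝ) ^ m)
    (summable_geometric_of_lt_one (by norm_num) (by norm_num))
    (fun κ => by have := wt_pos κ.1; positivity) (fun m => by positivity)

section

variable {Ω : Type*} {mΩ : MeasurableSpace Ω} {P : Measure Ω} {𝓕 : Filtration ℝ≥0 mΩ}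
  {Q : L2Zero →L[ℝ] L2Zero} {w : ℝ → Ω → ℝ → ℝ}

theorem IsWiener.hasLaw_dyadicIncrement (hw : IsWiener P 𝓕 Q w) {a : ℝ} (ha : 0 ≤ a)
    (κ : ℤ × Bool) (m j : ℕ) : HasLaw (dyadicIncrement w a κ m j)
      (gaussianReal 0 (3 / 2 / 2 ^ m * ⟪Q (modeL2 κ), modeL2 κ⟫_ℝ).toNNReal) P := by
  have h := hw.hasLaw_mode (s := a + 3 / 2 * (j / 2 ^ m)) (t := a + 3 / 2 * ((j + 1) / 2 ^ m))
    (by positivity) (by gcongr; linarith) κ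
  have e : a + 3 / 2 * (((j : ℝ) + 1) / 2 ^ m) - (a + 3 / 2 * (j / 2 ^ m)) = 3 / 2 / 2 ^ m := by
    field_simp
    ring
  rw [e] at h
  exact h

theorem IsWiener.aemeasurable_incrementSum (hw : IsWiener P 𝓕 Q w) {a : ℝ} (ha : 0 ≤ a) (n : ℕ) :
    AEMeasurable (incrementSum w a n) P := by
  refine AEMeasurable.tsum fun i => Finset.aemeasurable_fun_sum _ fun j _ => ?_
  exact (((hw.hasLaw_dyadicIncrement ha i.1 i.2 j).aemeasurable.const_mul _).pow_const _).ennreal_ofReal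

/-- The expectation of `incrementSum` is bounded in terms of the correlation operator only. -/
theorem exists_lintegral_incrementSum_le (hQ : IsCorrelationOperator Q) {n : ℕ} (hn : 3 ≤ n) :
    ∃ M : ℝ, 0 ≤ M ∧ ∀ (Ω : Type*) (mΩ : MeasurableSpace Ω) (P : Measure Ω)
      (𝓕 : Filtration ℝ≥0 mΩ) (w : ℝ → Ω → ℝ → ℝ), IsWiener P 𝓕 Q w → ∀ a : ℝ, 0 ≤ a →
        ∫⁻ ω, incrementSum w a n ω ∂P ≤ ENNReal.ofReal M := by
  obtain ⟨c, hc, hmom⟩ := exists_gaussian_moment n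
  obtain ⟨C, hC, hvar⟩ := hQ.exists_variance_le 12
  set A := c * (3 / 2 * C) ^ n with hA
  have hterm : ∀ i : (ℤ × Bool) × ℕ, 0 ≤ A * ((wt i.1.1 ^ 2)⁻¹ * (3 / 4 : ℝ) ^ i.2) := fun i => by
    have := wt_pos i.1.1
    positivity
  refine ⟨∑' i : (ℤ × Bool) × ℕ, A * ((wt i.1.1 ^ 2)⁻¹ * (3 / 4 : ℝ) ^ i.2),
    tsum_nonneg hterm, ?_⟩
  intro Ω mΩ P 𝓕 w hw a ha
  have hmeas : ∀ (i : (ℤ × Bool) × ℕ) (j : ℕ), AEMeasurable (fun ω => ENNReal.ofReal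
      (((6 / 5) ^ i.2 * wt i.1.1 ^ 5 * dyadicIncrement w a i.1 i.2 j ω) ^ (2 * n))) P :=
    fun i j => (((hw.hasLaw_dyadicIncrement ha i.1 i.2 j).aemeasurable.const_mul _).pow_const
      _).ennreal_ofReal
  unfold incrementSum
  rw [lintegral_tsum fun i => Finset.aemeasurable_fun_sum _ fun j _ => hmeas i j,
    ENNReal.ofReal_tsum_of_nonneg hterm (summable_incrementBound.mul_left A)]
  refine ENNReal.tsum_le_tsum fun i => ?_
  rw [lintegral_finsetSum' _ fun j _ => hmeas i j]
  obtain ⟨κ, m⟩ := i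
  have hw0 := wt_pos κ.1
  have hone : ∀ j : ℕ, ∫⁻ ω, ENNReal.ofReal
      (((6 / 5) ^ m * wt κ.1 ^ 5 * dyadicIncrement w a κ m j ω) ^ (2 * n)) ∂P ≤
      ENNReal.ofReal (A * (wt κ.1 ^ 2)⁻¹ * (18 / 25) ^ (m * n)) := by
    intro j
    set β : ℝ := (6 / 5) ^ m * wt κ.1 ^ 5 with hβ
    have hβ0 : 0 ≤ β := by positivity
    set v := (3 / 2 / 2 ^ m * ⟪Q (modeL2 κ), modeL2 κ⟫_ℝ).toNNReal with hv
    have hvle : (v : ℝ) ≤ 3 / 2 / 2 ^ m * (C * (wt κ.1 ^ 12)⁻¹) := by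
      rw [hv, Real.coe_toNNReal']
      exact max_le (by gcongr; exact hvar κ) (by positivity)
    have e1 : ∀ ω, ENNReal.ofReal ((β * dyadicIncrement w a κ m j ω) ^ (2 * n))
        = ENNReal.ofReal (β ^ (2 * n))
          * ENNReal.ofReal ((dyadicIncrement w a κ m j ω) ^ (2 * n)) := fun ω => by
      rw [mul_pow, ENNReal.ofReal_mul (by positivity)]
    have hlaw := hw.hasLaw_dyadicIncrement ha κ m j
    simp only [e1]
    rw [lintegral_const_mul' _ _ ENNReal.ofReal_ne_top,
      hlaw.lintegral_comp (f := fun x => ENNReal.ofReal (x ^ (2 * n))) (by fun_prop), hmom,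
      ← ENNReal.ofReal_mul (by positivity)]
    refine ENNReal.ofReal_le_ofReal ?_
    -- The weight contributes `(36/25) ^ m` and `wt ^ 10`. The variance supplies `2 ^ (-m)` and `wt
    -- ^ (-12)`, leaving a geometric factor and a summable one.
    have e2 : β ^ 2 * v ≤ 3 / 2 * C * ((18 / 25) ^ m * (wt κ.1 ^ 2)⁻¹) := by
      calc β ^ 2 * v ≤ β ^ 2 * (3 / 2 / 2 ^ m * (C * (wt κ.1 ^ 12)⁻¹)) := by gcongr
        _ = 3 / 2 * C * (((6 / 5) ^ 2 / 2) ^ m * (wt κ.1 ^ 2)⁻¹) := by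
            rw [hβ, div_pow ((6 / 5 : ℝ) ^ 2), ← pow_mul, mul_comm 2 m, pow_mul]
            field_simp
        _ = _ := by norm_num
    calc β ^ (2 * n) * (c * (v : ℝ) ^ n) = c * (β ^ 2 * v) ^ n := by rw [mul_pow, pow_mul]; ring
      _ ≤ c * (3 / 2 * C * ((18 / 25) ^ m * (wt κ.1 ^ 2)⁻¹)) ^ n := by gcongr
      _ = A * ((wt κ.1 ^ 2)⁻¹) ^ n * (18 / 25) ^ (m * n) := by
          rw [hA, mul_pow _ _ n, mul_pow _ _ n, pow_mul]; ring
      _ ≤ A * (wt κ.1 ^ 2)⁻¹ * (18 / 25) ^ (m * n) := by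
          gcongr
          exact pow_le_of_le_one (by positivity)
            (inv_le_one_of_one_le₀ (one_le_pow₀ (one_le_wt _))) (by omega)
  refine (Finset.sum_le_sum fun j _ => hone j).trans ?_
  rw [Finset.sum_const, Finset.card_range, ← ENNReal.ofReal_nsmul]
  refine ENNReal.ofReal_le_ofReal ?_
  -- There are `2 ^ m` increments at level `m`; `n ≥ 3` is what makes `2 (18/25) ^ n` at most `3/4`.
  have e3 : (2 : ℝ) ^ m * (18 / 25) ^ (m * n) ≤ (3 / 4) ^ m := by
    rw [mul_comm m n, pow_mul, ← mul_pow]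
    refine pow_le_pow_left₀ (by positivity) ?_ m
    calc (2 : ℝ) * (18 / 25) ^ n ≤ 2 * (18 / 25) ^ 3 := by
          gcongr ?_ * ?_
          exact pow_le_pow_of_le_one (by norm_num) (by norm_num) hn
      _ ≤ 3 / 4 := by norm_num
  rw [nsmul_eq_mul]
  push_cast
  calc (2 : ℝ) ^ m * (A * (wt κ.1 ^ 2)⁻¹ * (18 / 25) ^ (m * n))
      = A * ((wt κ.1 ^ 2)⁻¹ * (2 ^ m * (18 / 25) ^ (m * n))) := by ring
    _ ≤ _ := by gcongr

/-- A single term of a sum of nonnegative terms is at most the sum; taking the `2n`-th root and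
dividing by the weight gives geometric decay in the level and order five in the frequency. -/
theorem abs_dyadicIncrement_le {a : ℝ} {n : ℕ} (hn : n ≠ 0) {ω : Ω}
    (hfin : incrementSum w a n ω ≠ ⊤) (κ : ℤ × Bool) (m j : ℕ) (hj : j < 2 ^ m) :
    |dyadicIncrement w a κ m j ω| ≤
      (incrementSum w a n ω).toReal ^ (((2 * n : ℕ) : ℝ)⁻¹) * (wt κ.1 ^ 5)⁻¹ * (5 / 6) ^ m := by
  set β : ℝ := (6 / 5) ^ m * wt κ.1 ^ 5 with hβ
  have hw0 := wt_pos κ.1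
  have hβ0 : 0 < β := by positivity
  have h1 : ENNReal.ofReal ((β * dyadicIncrement w a κ m j ω) ^ (2 * n))
      ≤ incrementSum w a n ω := by
    refine le_trans ?_ (ENNReal.le_tsum ((κ, m) : (ℤ × Bool) × ℕ))
    exact Finset.single_le_sum (f := fun j => ENNReal.ofReal
      (((6 / 5) ^ m * wt κ.1 ^ 5 * dyadicIncrement w a κ m j ω) ^ (2 * n)))
      (fun _ _ => zero_le) (Finset.mem_range.mpr hj)
  have h2 : |β * dyadicIncrement w a κ m j ω| ^ (2 * n) ≤ (incrementSum w a n ω).toReal := by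
    rw [pow_mul, sq_abs, ← pow_mul]
    exact (ENNReal.ofReal_le_iff_le_toReal hfin).mp h1
  have h3 : |β * dyadicIncrement w a κ m j ω| ≤
      (incrementSum w a n ω).toReal ^ (((2 * n : ℕ) : ℝ)⁻¹) := by
    rw [← Real.pow_rpow_inv_natCast (abs_nonneg (β * dyadicIncrement w a κ m j ω))
      (by omega : 2 * n ≠ 0)]
    exact Real.rpow_le_rpow (by positivity) h2 (by positivity)
  rw [abs_mul, abs_of_pos hβ0] at h3
  have e : (wt κ.1 ^ 5)⁻¹ * (5 / 6 : ℝ) ^ m = β⁻¹ := by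
    rw [hβ, mul_inv, ← inv_pow (6 / 5 : ℝ) m, mul_comm]
    norm_num
  rw [mul_assoc, e, ← div_eq_mul_inv, le_div_iff₀ hβ0, mul_comm]
  exact h3

/-- The derivatives of the increments of a path of the force are bounded in terms of
`incrementSum`. -/
theorem abs_dser_sub_le {a : ℝ} (ha : 0 ≤ a) {n : ℕ} (hn : n ≠ 0) {ω : Ω}
    (hs : ∀ t : ℝ, 0 ≤ t → MemSmooth (w t ω)) (hc : ContinuousInH 0 fun t => w t ω)
    (hfin : incrementSum w a n ω ≠ ⊤) {j : ℕ} (hj : j ≤ 3) {s : ℝ}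
    (hsa : s ∈ Icc a (a + 3 / 2)) (x : ℝ) :
    |dser j (fc (w s ω)) x - dser j (fc (w a ω)) x| ≤
      4116 * wtSum * (incrementSum w a n ω).toReal ^ (((2 * n : ℕ) : ℝ)⁻¹) := by
  set R := (incrementSum w a n ω).toReal ^ (((2 * n : ℕ) : ℝ)⁻¹) with hR
  have hR0 : 0 ≤ R := by positivity
  have hs0 : 0 ≤ s := ha.trans hsa.1
  have hI : ∀ t, 0 ≤ t → IntervalIntegrable (w t ω) volume 0 1 := fun t ht =>
    (hs t ht).contDiff.continuous.intervalIntegrable 0 1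
  have hmode : ∀ κ : ℤ × Bool, |∫ x in (0 : ℝ)..1, (w s ω x - w a ω x) * mode κ x|
      ≤ 6 * (R * (wt κ.1 ^ 5)⁻¹) := by
    intro κ
    have hcont : ContinuousOn (fun t => ∫ x in (0 : ℝ)..1, w t ω x * mode κ x) (Ici 0) := by
      have h1 := continuousOn_fc_of_memSmooth hs hc κ.1
      have h2 : ∀ t ∈ Ici (0 : ℝ), ∫ x in (0 : ℝ)..1, w t ω x * mode κ x =
          if κ.1 = 0 then 0 else if κ.2 then (fc (w t ω) κ.1).re else -(fc (w t ω) κ.1).im :=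
        fun t ht => integral_mul_mode (hI t ht) κ
      refine ContinuousOn.congr ?_ h2
      split_ifs
      · exact continuousOn_const
      · exact Complex.continuous_re.comp_continuousOn h1
      · exact (Complex.continuous_im.comp_continuousOn h1).neg
    have hsub : ∀ t r, 0 ≤ t → 0 ≤ r → ∫ x in (0 : ℝ)..1, (w t ω x - w r ω x) * mode κ x =
        (∫ x in (0 : ℝ)..1, w t ω x * mode κ x) - ∫ x in (0 : ℝ)..1, w r ω x * mode κ x := by
      intro t r ht hr
      rw [← intervalIntegral.integral_sub
        ((hI t ht).mul_continuousOn (continuous_mode κ).continuousOn)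
        ((hI r hr).mul_continuousOn (continuous_mode κ).continuousOn)]
      simp only [sub_mul]
    -- Time is rescaled from `[a, a + 3/2]` to `[0, 1]`.
    have key := abs_sub_le_of_chaining
      (g := fun r => ∫ x in (0 : ℝ)..1, w (a + 3 / 2 * r) ω x * mode κ x)
      (B := R * (wt κ.1 ^ 5)⁻¹)
      (hcont.comp (by fun_prop) fun r hr => by
        have := hr.1
        simp only [mem_Ici]
        positivity)
      (fun m j hj => by
        have := abs_dyadicIncrement_le hn hfin κ m j hj
        rwa [dyadicIncrement, hsub _ _ (by positivity) (by positivity)] at this)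
      (r := (s - a) / (3 / 2)) ⟨div_nonneg (by linarith [hsa.1]) (by norm_num), by
        rw [div_le_one (by norm_num)]; linarith [hsa.2]⟩
    simp only [mul_zero, add_zero] at key
    rw [mul_div_cancel₀ _ (by norm_num : (3 / 2 : ℝ) ≠ 0), add_sub_cancel] at key
    rwa [hsub s a hs0 ha]
  -- Order five pays for three derivatives and an absolutely convergent series. The factor `12` is
  -- `6` from chaining, once for the cosine and once for the sine.
  have hdecay : DecayBy 5 (12 * R) fun k => fc (w s ω) k - fc (w a ω) k := by
    intro k
    have hw0 := wt_pos k
    beta_reduce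
    rw [← fc_sub (hI s hs0) (hI a ha)]
    have h1 := ((hs s hs0).sub (hs a ha)).norm_fc_le k
    have h2 := hmode (k, true)
    have h3 := hmode (k, false)
    calc wt k ^ 5 * ‖fc (fun x => w s ω x - w a ω x) k‖
        ≤ wt k ^ 5 * (6 * (R * (wt k ^ 5)⁻¹) + 6 * (R * (wt k ^ 5)⁻¹)) := by
          gcongr
          exact h1.trans (add_le_add h2 h3)
      _ = 12 * R := by field_simp; ring
  rw [← dser_sub ((hs s hs0).decayBy (2 + j)) ((hs a ha).decayBy (2 + j))]
  refine (Complex.abs_re_le_norm _).trans ?_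
  refine (norm_ser_le (DecayBy.freq_pow_mul (r := 2) (n := j) (hdecay.anti (by omega))) x).trans ?_
  have h7 : (7 : ℝ) ^ j ≤ 343 := by
    calc (7 : ℝ) ^ j ≤ 7 ^ 3 := pow_le_pow_right₀ (by norm_num) hj
      _ = 343 := by norm_num
  have := wtSum_nonneg
  calc 7 ^ j * (12 * R) * wtSum ≤ 343 * (12 * R) * wtSum := by gcongr
    _ = 4116 * wtSum * R := by ring

end

/-! ### Random solutions -/

section

variable {Ω : Type*} {mΩ : MeasurableSpace Ω} {P : Measure Ω} {𝓕 : Filtration ℝ≥0 mΩ}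
  {Q : L2Zero →L[ℝ] L2Zero} {f : ℝ → ℝ} {ν : ℝ} {w u : ℝ → Ω → ℝ → ℝ}

theorem IsSolution.ae_isPath (hw : IsWiener P 𝓕 Q w) (hu : IsSolution P 𝓕 f ν w u) :
    ∀ᵐ ω ∂P, IsPath f ν (fun s => w s ω) (fun s => u s ω) := by
  filter_upwards [hu.memH1, hu.continuous, hu.equation, hw.smooth, hw.continuous]
    with ω h1 h2 h3 h4 h5
  exact ⟨h1, h2, h4, h5, h3⟩

/-- The supremum over uncountably many times and points is almost surely a countable supremum of
difference quotients, each measurable by adaptedness. -/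
theorem IsSolution.aemeasurable_maxSlope (hw : IsWiener P 𝓕 Q w) (hu : IsSolution P 𝓕 f ν w u)
    (hf : ContDiff ℝ (⊤ : ℕ∞) f) (hν : 0 < ν) {t : ℝ} (ht : 0 < t) :
    AEMeasurable (maxSlope u t) P := by
  refine AEMeasurable.isLUB (f := fun (i : ℚ × ℚ × ℚ) ω =>
    slope (u (t + max 0 (min (i.1 : ℝ) 1)) ω) i.2.1 i.2.2) (fun i => ?_) ?_
  · have h0 : 0 ≤ t + max 0 (min (i.1 : ℝ) 1) := by positivity
    have hm : Measurable (u (t + max 0 (min (i.1 : ℝ) 1))) :=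
      (hu.adapted ⟨_, h0⟩).mono (𝓕.le _) le_rfl
    have hx : ∀ x : ℝ, Measurable fun ω => u (t + max 0 (min (i.1 : ℝ) 1)) ω x := fun x =>
      (measurable_pi_apply x).comp hm
    simp only [slope_def_field]
    exact (((hx _).sub (hx _)).div_const _).aemeasurable
  · filter_upwards [hu.ae_isPath hw] with ω h
    exact h.isLUB_slopes hf hν ht

/-- An integrable random variable which controls the force on `[t - 1/2, t + 1]`. -/
theorem IsWiener.exists_control [IsProbabilityMeasure P] (hw : IsWiener P 𝓕 Q w) {a M : ℝ}
    (ha : 0 ≤ a) {n : ℕ} (hn : n ≠ 0) (hM0 : 0 ≤ M)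
    (hM : ∫⁻ ω, incrementSum w a n ω ∂P ≤ ENNReal.ofReal M) :
    ∃ R : Ω → ℝ, Measurable R ∧ (∀ ω, 0 ≤ R ω) ∧ Integrable (fun ω => R ω ^ (2 * n)) P ∧
      ∫ ω, R ω ^ (2 * n) ∂P ≤ M ∧ ∀ᵐ ω ∂P, ∀ j ≤ 3, ∀ s ∈ Icc a (a + 3 / 2), ∀ x,
        |dser j (fc (w s ω)) x - dser j (fc (w a ω)) x| ≤ 4116 * wtSum * R ω := by
  have hmeas := hw.aemeasurable_incrementSum ha n
  have hfin : ∫⁻ ω, incrementSum w a n ω ∂P ≠ ⊤ := ne_top_of_le_ne_top ENNReal.ofReal_ne_top hM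
  have hpow : ∀ ω, ((hmeas.mk _ ω).toReal ^ (((2 * n : ℕ) : ℝ)⁻¹)) ^ (2 * n)
      = (hmeas.mk _ ω).toReal := fun ω =>
    Real.rpow_inv_natCast_pow ENNReal.toReal_nonneg (by omega)
  have hfin' : ∫⁻ ω, hmeas.mk _ ω ∂P ≠ ⊤ := by rwa [← lintegral_congr_ae hmeas.ae_eq_mk]
  -- `R` is the `2n`-th root of a measurable version of the sum; `toReal` makes it finite also on
  -- the null set where the sum is infinite.
  refine ⟨fun ω => (hmeas.mk _ ω).toReal ^ (((2 * n : ℕ) : ℝ)⁻¹),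
    (hmeas.measurable_mk.ennreal_toReal).pow_const _, fun ω => by positivity, ?_, ?_, ?_⟩
  · simp only [hpow]
    exact integrable_toReal_of_lintegral_ne_top hmeas.measurable_mk.aemeasurable hfin'
  · simp only [hpow]
    rw [integral_toReal hmeas.measurable_mk.aemeasurable
      (ae_lt_top hmeas.measurable_mk hfin'), ← lintegral_congr_ae hmeas.ae_eq_mk]
    exact ENNReal.toReal_le_of_le_ofReal hM0 hM
  · filter_upwards [hw.smooth, hw.continuous, hmeas.ae_eq_mk, ae_lt_top' hmeas hfin]
      with ω h1 h2 h3 h4 j hj s hs x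
    rw [← h3]
    exact abs_dser_sub_le ha hn h1 (h2 0) h4.ne hj hs x

end

end WhiteBurgers

/-! ### The moment bound for the maximal slope -/

theorem theorem5p1 (f : ℝ → ℝ) (hf : WhiteBurgers.IsFlux f)
    (Q : WhiteBurgers.L2Zero →L[ℝ] WhiteBurgers.L2Zero)
    (hQ : WhiteBurgers.IsCorrelationOperator Q) (k : ℝ) (hk : 1 ≤ k) :
    ∃ C : ℝ, ∀ (Ω : Type*) (mΩ : MeasurableSpace Ω) (P : Measure Ω), IsProbabilityMeasure P →
      ∀ (𝓕 : Filtration ℝ≥0 mΩ) (w : ℝ → Ω → ℝ → ℝ), WhiteBurgers.IsWiener P 𝓕 Q w →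
      ∀ ν : ℝ, 0 < ν → ν ≤ 1 → ∀ t : ℝ, 1 ≤ t →
        (∀ u : ℝ → Ω → ℝ → ℝ, WhiteBurgers.IsSolution P 𝓕 f ν w u →
          (∀ᵐ ω ∂P, (∀ s ∈ Icc t (t + 1), Differentiable ℝ (u s ω)) ∧
            IsGreatest (WhiteBurgers.slopes (fun s => u s ω) t) (WhiteBurgers.maxSlope u t ω)) ∧
          AEMeasurable (WhiteBurgers.maxSlope u t) P ∧
          Integrable (fun ω => WhiteBurgers.maxSlope u t ω ^ k) P ∧
          ∫ ω, WhiteBurgers.maxSlope u t ω ^ k ∂P ≤ C) ∧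
        (∃ Y : Ω → ℝ, Measurable Y ∧ (∀ ω, 0 ≤ Y ω) ∧
          Integrable (fun ω => Y ω ^ k) P ∧ ∫ ω, Y ω ^ k ∂P ≤ C ∧
          ∀ u : ℝ → Ω → ℝ → ℝ, WhiteBurgers.IsSolution P 𝓕 f ν w u →
            ∀ᵐ ω ∂P, WhiteBurgers.maxSlope u t ω ≤ Y ω) := by
  obtain ⟨D, q, -, hD, hslope⟩ := WhiteBurgers.IsPath.exists_slope_bound hf
  -- Large enough that `2n ≥ qk`, so the `2n`-th moment of `R` controls the `k`-th moment of `Y`;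
  -- the `3` ensures summability over dyadic levels.
  set n : ℕ := ⌈q * k⌉₊ + 3 with hn
  have hqk : (q : ℝ) * k ≤ ((2 * n : ℕ) : ℝ) := by
    have := Nat.le_ceil ((q : ℝ) * k)
    rw [hn]; push_cast
    nlinarith [Nat.cast_nonneg (α := ℝ) ⌈(q : ℝ) * k⌉₊]
  obtain ⟨M, hM0, hM⟩ := WhiteBurgers.exists_lintegral_incrementSum_le hQ (n := n) (by omega)
  set c : ℝ := 4116 * WhiteBurgers.wtSum with hc
  have hc0 : 0 ≤ c := mul_nonneg (by norm_num) WhiteBurgers.wtSum_nonneg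
  have hk0 : 0 ≤ k := by linarith
  -- From `(1 + x) ^ (2n) ≤ 2 ^ (2n) (1 + x ^ (2n))` with `x = c R`, and from the bound `M` on the
  -- `2n`-th moment of `R`.
  refine ⟨D ^ k * (2 ^ (2 * n) * (1 + c ^ (2 * n) * M)), ?_⟩
  intro Ω mΩ P hP 𝓕 w hw ν hν hν1 t ht
  have ht0 : 0 < t := by linarith
  -- Starting half a unit before `t` keeps `a` positive, where paths are smooth, and makes `[a +
  -- 1/2, a + 3/2]` equal to `[t, t + 1]`.
  obtain ⟨R, hRm, hR0, hRi, hRM, hRb⟩ := hw.exists_control (a := t - 1 / 2) (by linarith)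
    (by omega : n ≠ 0) hM0 (hM Ω mΩ P 𝓕 w hw (t - 1 / 2) (by linarith))
  obtain ⟨Y, hY⟩ : ∃ Y : Ω → ℝ, ∀ ω, Y ω = D * (1 + c * R ω) ^ q := ⟨_, fun _ => rfl⟩
  have hYm : Measurable Y := by
    rw [funext hY]
    exact (((hRm.const_mul c).const_add 1).pow_const q).const_mul D
  have hY0 : ∀ ω, 0 ≤ Y ω := fun ω => by
    have := hR0 ω
    rw [hY]; positivity
  have hYle : ∀ ω, Y ω ^ k ≤ D ^ k * (2 ^ (2 * n) * (1 + c ^ (2 * n) * R ω ^ (2 * n))) := by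
    intro ω
    have hcR : 0 ≤ c * R ω := mul_nonneg hc0 (hR0 ω)
    rw [hY, Real.mul_rpow hD (by positivity)]
    gcongr
    calc ((1 + c * R ω) ^ q) ^ k = (1 + c * R ω) ^ ((q : ℝ) * k) := by
          rw [Real.rpow_mul (by positivity), Real.rpow_natCast]
      _ ≤ (1 + c * R ω) ^ ((2 * n : ℕ) : ℝ) :=
          Real.rpow_le_rpow_of_exponent_le (by linarith) hqk
      _ = (1 + c * R ω) ^ (2 * n) := Real.rpow_natCast _ _
      _ ≤ 2 ^ (2 * n - 1) * (1 ^ (2 * n) + (c * R ω) ^ (2 * n)) :=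
          add_pow_le zero_le_one hcR _
      _ ≤ 2 ^ (2 * n) * (1 + c ^ (2 * n) * R ω ^ (2 * n)) := by
          rw [one_pow, mul_pow]
          have := hR0 ω
          gcongr
          · norm_num
          · omega
  have hbi : Integrable (fun ω => D ^ k * (2 ^ (2 * n) * (1 + c ^ (2 * n) * R ω ^ (2 * n)))) P :=
    (((integrable_const 1).add (hRi.const_mul _)).const_mul _).const_mul _
  have hYi : Integrable (fun ω => Y ω ^ k) P :=
    hbi.mono' (hYm.pow_const k).aestronglyMeasurable (ae_of_all _ fun ω => by
      rw [Real.norm_of_nonneg (Real.rpow_nonneg (hY0 ω) k)]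
      exact hYle ω)
  have hYC : ∫ ω, Y ω ^ k ∂P ≤ D ^ k * (2 ^ (2 * n) * (1 + c ^ (2 * n) * M)) := by
    refine (integral_mono hYi hbi hYle).trans ?_
    rw [integral_const_mul, integral_const_mul, integral_add (integrable_const 1)
      (hRi.const_mul _), integral_const_mul]
    simp only [integral_const, probReal_univ, one_smul]
    gcongr
  have hXY : ∀ u : ℝ → Ω → ℝ → ℝ, WhiteBurgers.IsSolution P 𝓕 f ν w u → ∀ᵐ ω ∂P, WhiteBurgers.maxSlope u t ω ≤ Y ω := by
    intro u hu
    filter_upwards [hu.ae_isPath hw, hRb] with ω hpath hR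
    obtain ⟨s, hs, x, hx⟩ := (hpath.isGreatest_slopes hf.smooth hν ht0).1
    rw [WhiteBurgers.maxSlope, hx, hY]
    exact hslope ν _ _ hpath hν hν1 (t - 1 / 2) (c * R ω) (by linarith)
      (mul_nonneg hc0 (hR0 ω)) (fun j _ hj => hR j hj) s
      ⟨by linarith [hs.1], by linarith [hs.2]⟩ x
  refine ⟨fun u hu => ?_, Y, hYm, hY0, hYi, hYC, hXY⟩
  have hm := hu.aemeasurable_maxSlope hw hf.smooth hν ht0
  have hle : ∀ᵐ ω ∂P, 0 ≤ WhiteBurgers.maxSlope u t ω ^ k ∧ WhiteBurgers.maxSlope u t ω ^ k ≤ Y ω ^ k := by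
    filter_upwards [hu.ae_isPath hw, hXY u hu] with ω hpath h
    have h0 := hpath.sSup_slopes_nonneg hf.smooth hν ht0
    exact ⟨Real.rpow_nonneg h0 k, Real.rpow_le_rpow h0 h hk0⟩
  have hXi : Integrable (fun ω => WhiteBurgers.maxSlope u t ω ^ k) P :=
    hYi.mono' (hm.pow_const k).aestronglyMeasurable (by
      filter_upwards [hle] with ω h
      rw [Real.norm_of_nonneg h.1]
      exact h.2)
  refine ⟨?_, hm, hXi, (integral_mono_ae hXi hYi (hle.mono fun ω h => h.2)).trans hYC⟩
  filter_upwards [hu.ae_isPath hw] with ω hpath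
  exact ⟨fun s hs => hpath.differentiable hf.smooth hν (ht0.trans_le hs.1),
    hpath.isGreatest_slopes hf.smooth hν ht0⟩
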